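/- Let $\mathbb{K}$ be a field of characteristic $0$ and $G$ a group acting linearly, by maps of degree $0$, on a graded $\mathbb{K}$-vector space $V=\bigoplus_{i\in\mathbb{Z}}V^i$. Let $S^c(V)=\bigoplus_{n\ge0}V^{\odot n}$ be the graded symmetric coalgebra of $V$ and $p\colon S^c(V)\to V$ the projection onto $V^{\odot1}=V$. An $L_\infty[1]$ algebra structure on $V$ is a coderivation $Q$ of degree $1$ of $S^c(V)$ with $Q\circ Q=0$ and $p(Q(1))=0$; its Taylor coefficients are $q_n=p\circ Q|_{V^{\odot n}}\colon V^{\odot n}\to V$, and $H(V,q_1)$ is the cohomology of the complex $(V,q_1)$. An $L_\infty[1]$ morphism $F\colon(V,Q)\dashrightarrow(W,R)$ is a morphism of counital coaugmented DG coalgebras $(S^c(V),Q)\to(S^c(W),R)$, with Taylor coefficients $f_n=p\circ F|_{V^{\odot n}}\colon V^{\odot n}\to W$; it is a weak equivalence if $f_1\colon(V,q_1)\to(W,r_1)$ is a quasi-isomorphism. Structures and morphisms are called $G$-equivariant if all their Taylor coefficients with $n\ge1$ are $G$-equivariant. The bracket $q_2$ induces a bracket $r_2\colon H(V,q_1)^{\odot2}\to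 H(V,q_1)$, $r_2([x],[y])=[q_2(x,y)]$, and $(H(V,q_1),r_2)$ denotes the $L_\infty[1]$ algebra on $H(V,q_1)$ whose only nonzero Taylor coefficient is $r_2$. The $L_\infty[1]$ algebra $(V,Q)$ is formal if there exists a weak equivalence $(V,Q)\dashrightarrow(H(V,q_1),r_2)$. If $Q$ is $G$-equivariant, then $G$ acts on $H(V,q_1)$, and $(V,Q)$ is $G$-equivariantly formal if there exists a $G$-equivariant weak equivalence $(H(V,q_1),r_2)\dashrightarrow(V,Q)$. Theorem. Let $(V,Q)$ be a $G$-equivariant $L_\infty[1]$ algebra. Assume that the following $G$-modules are semisimple (direct sums of irreducible representations): - $V^i$, for all $i\in\mathbb{Z}$; - $\operatorname{Hom}^j(H(V,q_1)^{\odot n},H(V,q_1))$, the space of linear maps of degree $j$ with the action $(g\varphi)(x)=g\,\varphi(g^{-1}x)$, for $j=0,1$ and all $n\ge2$. If $(V,Q)$ is formal, then it is $G$-equivariantly formal. -/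

import Mathlib

open scoped TensorProduct DirectSum

noncomputable section

namespace LInfty

section SymmetricCoalgebra

variable {K V W : Type*} [Field K] [AddCommGroup V] [Module K V] [AddCommGroup W] [Module K W]

/-- The Koszul sign `(-1)^n` as a scalar. -/
def ksign (K : Type*) [Field K] (n : ℤ) : K := ((n.negOnePow : ℤ) : K)

/-- A linear map between graded vector spaces which is homogeneous of degree `j`. -/
def HasDegree (𝒱 : ℤ → Submodule K V) (𝒲 : ℤ → Submodule K W) (j : ℤ) (f : V →ₗ[K] W) : Prop :=
  ∀ i : ℤ, ∀ v ∈ 𝒱 i, f v ∈ 𝒲 (i + j)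

/-- The relations `x y = (-1)^{|x||y|} y x` of graded commutativity. -/
inductive SymRel (𝒱 : ℤ → Submodule K V) : TensorAlgebra K V → TensorAlgebra K V → Prop
  | comm {i j : ℤ} {x y : V} (hx : x ∈ 𝒱 i) (hy : y ∈ 𝒱 j) :
      SymRel 𝒱 (TensorAlgebra.ι K x * TensorAlgebra.ι K y)
        (ksign K (i * j) • (TensorAlgebra.ι K y * TensorAlgebra.ι K x))

/-- The graded symmetric algebra `S(V) = ⨁ₙ V^{⊙n}` of a graded vector space `V`: the quotient of
the tensor algebra by the Koszul commutation relations. It carries the coproduct `comul`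
below, and with it is the symmetric coalgebra `S^c(V)`. -/
def Sym (𝒱 : ℤ → Submodule K V) : Type _ := RingQuot (SymRel 𝒱)

namespace Sym

variable (𝒱 : ℤ → Submodule K V) (𝒲 : ℤ → Submodule K W)

instance : Ring (Sym 𝒱) := inferInstanceAs (Ring (RingQuot (SymRel 𝒱)))

instance : Algebra K (Sym 𝒱) := inferInstanceAs (Algebra K (RingQuot (SymRel 𝒱)))

/-- The inclusion `V = V^{⊙1} → S(V)`. -/
def ι : V →ₗ[K] Sym 𝒱 :=
  (RingQuot.mkAlgHom K (SymRel 𝒱)).toLinearMap ∘ₗ TensorAlgebra.ι K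

variable {𝒱} in
theorem ι_mul_ι {i j : ℤ} {x y : V} (hx : x ∈ 𝒱 i) (hy : y ∈ 𝒱 j) :
    ι 𝒱 x * ι 𝒱 y = ksign K (i * j) • (ι 𝒱 y * ι 𝒱 x) := by
  have h := RingQuot.mkAlgHom_rel K (SymRel.comm hx hy)
  rw [map_mul, map_smul, map_mul] at h
  exact h

/-- The universal property of `S(V)`. -/
def lift {A : Type*} [Ring A] [Algebra K A] (f : V →ₗ[K] A)
    (hf : ∀ (i j : ℤ) (x y : V), x ∈ 𝒱 i → y ∈ 𝒱 j → f x * f y = ksign K (i * j) • (f y * f x)) :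
    Sym 𝒱 →ₐ[K] A :=
  RingQuot.liftAlgHom K ⟨TensorAlgebra.lift K f, by
    rintro _ _ ⟨hx, hy⟩
    simpa using hf _ _ _ _ hx hy⟩

@[simp]
theorem lift_ι {A : Type*} [Ring A] [Algebra K A] (f : V →ₗ[K] A)
    (hf : ∀ (i j : ℤ) (x y : V), x ∈ 𝒱 i → y ∈ 𝒱 j → f x * f y = ksign K (i * j) • (f y * f x))
    (v : V) : lift 𝒱 f hf (ι 𝒱 v) = f v := by
  change RingQuot.liftAlgHom K _ (RingQuot.mkAlgHom K (SymRel 𝒱) (TensorAlgebra.ι K v)) = f v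
  rw [RingQuot.liftAlgHom_mkAlgHom_apply, TensorAlgebra.lift_ι_apply]

theorem algHom_ext {A : Type*} [Ring A] [Algebra K A] {f g : Sym 𝒱 →ₐ[K] A}
    (h : ∀ v, f (ι 𝒱 v) = g (ι 𝒱 v)) : f = g := by
  exact RingQuot.ringQuot_ext' K _ _ (TensorAlgebra.hom_ext (LinearMap.ext h))

/-- The action of `V` on `K × V` by `v • (a, w) = (0, a v)`. -/
def projAux : V →ₗ[K] Module.End K (K × V) where
  toFun v := LinearMap.inr K K V ∘ₗ (LinearMap.fst K K V).smulRight v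
  map_add' v w := by ext <;> simp
  map_smul' c v := by ext <;> simp

/-- The natural projection `p : S^c(V) → V = V^{⊙1}`, which is the identity on `V` and vanishes on
`V^{⊙n}` for `n ≠ 1`. It is the second component of the action on `(1, 0)`, where `S(V)`
acts on `K × V` by the extension of `projAux`, so that products of two elements of `V` act as `0`. -/
def proj : Sym 𝒱 →ₗ[K] V :=
  LinearMap.snd K K V ∘ₗ LinearMap.applyₗ ((1, 0) : K × V) ∘ₗ
    (lift 𝒱 (projAux (K := K) (V := V)) (by
      intro i j x y _ _
      ext <;> simp [projAux])).toLinearMap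

theorem proj_one : proj 𝒱 1 = 0 := by simp [proj]

theorem proj_ι (v : V) : proj 𝒱 (ι 𝒱 v) = v := by simp [proj, projAux]

theorem proj_ι_mul_ι_mul (v w : V) (x : Sym 𝒱) : proj 𝒱 (ι 𝒱 v * (ι 𝒱 w * x)) = 0 := by
  simp [proj, projAux]

/-- The counit `S^c(V) → K`, the projection onto `V^{⊙0} = K`. -/
def counit : Sym 𝒱 →ₗ[K] K :=
  (lift 𝒱 (A := K) 0 (by intros; simp)).toLinearMap

/-- The symmetric power `V^{⊙n}` as a subspace of `S(V)`. -/
def power (n : ℕ) : Submodule K (Sym 𝒱) := LinearMap.range (ι 𝒱) ^ n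

/-- The symmetric product `(v₁, …, vₙ) ↦ v₁ ⊙ ⋯ ⊙ vₙ`. -/
def prod (n : ℕ) : MultilinearMap K (fun _ : Fin n => V) (Sym 𝒱) :=
  (MultilinearMap.mkPiAlgebraFin K n (Sym 𝒱)).compLinearMap fun _ => ι 𝒱

/-- The part of `S(V)` of degree `d`, spanned by the products `v₁ ⊙ ⋯ ⊙ vₙ` of homogeneous
elements with `|v₁| + ⋯ + |vₙ| = d`. -/
def grading (d : ℤ) : Submodule K (Sym 𝒱) :=
  Submodule.span K {x | ∃ l : List (Σ i : ℤ, 𝒱 i),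
    (l.map Sigma.fst).sum = d ∧ (l.map fun a => ι 𝒱 (a.2 : V)).prod = x}

variable {𝒱} in
theorem ι_mem_grading {i : ℤ} {v : V} (hv : v ∈ 𝒱 i) : ι 𝒱 v ∈ grading 𝒱 i :=
  Submodule.subset_span ⟨[⟨i, v, hv⟩], by simp, by simp⟩

instance : SetLike.GradedMonoid (grading 𝒱) where
  one_mem := Submodule.subset_span ⟨[], by simp, by simp⟩
  mul_mem := by
    intro i j x y hx hy
    have h : x * y ∈ grading 𝒱 i * grading 𝒱 j := Submodule.mul_mem_mul hx hy
    rw [grading, grading, Submodule.span_mul_span] at h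
    refine Submodule.span_mono ?_ h
    rintro _ ⟨_, ⟨l, hl, rfl⟩, _, ⟨l', hl', rfl⟩, rfl⟩
    exact ⟨l ++ l', by simp [hl, hl'], by simp⟩

section Graded

variable [DirectSum.Decomposition 𝒱]

/-- The inclusion of `V` with values in the direct sum of the graded pieces of `S(V)`. -/
def gradedι : V →ₗ[K] ⨁ d, grading 𝒱 d :=
  DirectSum.toModule K ℤ _ (fun i => DirectSum.lof K ℤ (fun d => grading 𝒱 d) i ∘ₗ
    ((ι 𝒱).restrict fun _ hv => ι_mem_grading hv)) ∘ₗ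
    (DirectSum.decomposeLinearEquiv 𝒱).toLinearMap

theorem gradedι_of_mem {i : ℤ} {v : V} (hv : v ∈ 𝒱 i) :
    gradedι 𝒱 v = DirectSum.of (fun d => grading 𝒱 d) i ⟨ι 𝒱 v, ι_mem_grading hv⟩ := by
  simp only [gradedι, LinearMap.comp_apply, LinearEquiv.coe_coe,
    DirectSum.decomposeLinearEquiv_apply]
  rw [DirectSum.decompose_of_mem 𝒱 hv, ← DirectSum.lof_eq_of K, DirectSum.toModule_lof]
  rfl

/-- The algebra morphism that splits an element of `S(V)` into its homogeneous components. -/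
def split : Sym 𝒱 →ₐ[K] ⨁ d, grading 𝒱 d :=
  lift 𝒱 (A := ⨁ d, grading 𝒱 d) (gradedι 𝒱) (by
    intro i j x y hx hy
    change gradedι 𝒱 x * gradedι 𝒱 y = ksign K (i * j) • (gradedι 𝒱 y * gradedι 𝒱 x)
    rw [gradedι_of_mem 𝒱 hx, gradedι_of_mem 𝒱 hy, DirectSum.of_mul_of, DirectSum.of_mul_of,
      ← DirectSum.lof_eq_of K, ← DirectSum.lof_eq_of K, ← map_smul]
    exact DirectSum.of_eq_of_gradedMonoid_eq
      (Sigma.subtype_ext (add_comm i j) (ι_mul_ι hx hy)))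

theorem split_list (l : List (Σ i : ℤ, 𝒱 i))
    (h : (l.map fun a => ι 𝒱 (a.2 : V)).prod ∈ grading 𝒱 (l.map Sigma.fst).sum) :
    split 𝒱 (l.map fun a => ι 𝒱 (a.2 : V)).prod =
      DirectSum.of (fun d => grading 𝒱 d) (l.map Sigma.fst).sum ⟨_, h⟩ := by
  induction l with
  | nil =>
    simp only [List.map_nil, List.prod_nil, map_one]
    rfl
  | cons a l ih =>
    have h' : (l.map fun a => ι 𝒱 (a.2 : V)).prod ∈ grading 𝒱 (l.map Sigma.fst).sum :=
      Submodule.subset_span ⟨l, rfl, rfl⟩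
    simp only [List.map_cons, List.prod_cons, map_mul, ih h']
    rw [split, lift_ι, gradedι_of_mem 𝒱 a.2.2, DirectSum.of_mul_of]
    exact DirectSum.of_eq_of_gradedMonoid_eq (Sigma.subtype_ext List.sum_cons.symm rfl)

theorem split_coe (d : ℤ) (x : grading 𝒱 d) :
    split 𝒱 (x : Sym 𝒱) = DirectSum.of (fun d => grading 𝒱 d) d x := by
  obtain ⟨x, hx⟩ := x
  dsimp only
  rw [← DirectSum.lof_eq_of K]
  induction hx using Submodule.span_induction with
  | mem x h =>
    obtain ⟨l, rfl, rfl⟩ := h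
    exact split_list 𝒱 l _
  | zero =>
    rw [map_zero]
    exact (map_zero _).symm
  | add x y hx hy ihx ihy =>
    rw [map_add, ihx, ihy, ← map_add]
    rfl
  | smul a x hx ih =>
    rw [map_smul, ih, ← map_smul]
    rfl

instance : GradedAlgebra (grading 𝒱) :=
  GradedAlgebra.ofAlgHom _ (split 𝒱)
    (by
      refine algHom_ext 𝒱 fun v => ?_
      change DirectSum.coeAlgHom (grading 𝒱) (split 𝒱 (ι 𝒱 v)) = ι 𝒱 v
      rw [split, lift_ι]
      induction v using DirectSum.Decomposition.inductionOn 𝒱 with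
      | zero => simp
      | homogeneous v => rw [gradedι_of_mem 𝒱 v.2, DirectSum.coeAlgHom_of]
      | add v w hv hw => rw [map_add, map_add, hv, hw, map_add])
    (split_coe 𝒱)

theorem comul_aux (i j : ℤ) (x y : V) (hx : x ∈ 𝒱 i) (hy : y ∈ 𝒱 j) :
    let f : V →ₗ[K] GradedTensorProduct K (grading 𝒱) (grading 𝒱) :=
      (GradedTensorProduct.includeLeft (grading 𝒱) (grading 𝒱)).toLinearMap ∘ₗ ι 𝒱 +
        (GradedTensorProduct.includeRight (grading 𝒱) (grading 𝒱)).toLinearMap ∘ₗ ι 𝒱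
    f x * f y = ksign K (i * j) • (f y * f x) := by
  intro f
  let L := GradedTensorProduct.includeLeft (grading 𝒱) (grading 𝒱)
  let R := GradedTensorProduct.includeRight (grading 𝒱) (grading 𝒱)
  have hf : ∀ v, f v = L (ι 𝒱 v) + R (ι 𝒱 v) := fun v => rfl
  have hLR : ∀ a b, L a * R b = GradedTensorProduct.tmul K a b := fun a b =>
    GradedTensorProduct.tmul_one_mul_one_tmul _ _ a b
  have hRL : ∀ {i j : ℤ} {x y : V}, x ∈ 𝒱 i → y ∈ 𝒱 j →
      R (ι 𝒱 x) * L (ι 𝒱 y) = ksign K (i * j) • (L (ι 𝒱 y) * R (ι 𝒱 x)) := by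
    intro i j x y hx hy
    have h := GradedTensorProduct.tmul_coe_mul_coe_tmul (R := K) (grading 𝒱) (grading 𝒱) 1
      ⟨ι 𝒱 x, ι_mem_grading hx⟩ ⟨ι 𝒱 y, ι_mem_grading hy⟩ 1
    rw [hLR, ksign, Int.cast_smul_eq_zsmul]
    rw [mul_one, one_mul] at h
    exact h
  have hs : ksign K (i * j) * ksign K (j * i) = 1 := by
    rw [mul_comm j i, ksign, ← Int.cast_mul, ← Units.val_mul, Int.units_mul_self]
    simp
  simp only [hf, add_mul, mul_add, smul_add]
  rw [hRL hx hy, hRL hy hx, ← map_mul L, ← map_mul R, ← map_mul L, ← map_mul R, ι_mul_ι hx hy,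
    map_smul, map_smul, smul_smul, hs, one_smul]
  abel

/-- The coproduct `Δ : S^c(V) → S^c(V) ⊗ S^c(V)`: the unique morphism of graded algebras with
`Δ v = v ⊗ 1 + 1 ⊗ v` for `v ∈ V`, where the product of `S(V) ⊗ S(V)` is the one with the Koszul
sign, `(a ⊗ b)(a' ⊗ b') = (-1)^{|b||a'|} aa' ⊗ bb'`. On `v₁ ⊙ ⋯ ⊙ vₙ` it is the signed sum over
all unshuffles. -/
def comul : Sym 𝒱 →ₗ[K] Sym 𝒱 ⊗[K] Sym 𝒱 :=
  (GradedTensorProduct.of K (grading 𝒱) (grading 𝒱)).symm.toLinearMap ∘ₗ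
    (lift 𝒱 ((GradedTensorProduct.includeLeft (grading 𝒱) (grading 𝒱)).toLinearMap ∘ₗ ι 𝒱 +
      (GradedTensorProduct.includeRight (grading 𝒱) (grading 𝒱)).toLinearMap ∘ₗ ι 𝒱)
      (comul_aux 𝒱)).toLinearMap

/-- The linear map `x ↦ (-1)^{|x|} x` of `S(V)`. -/
def signMap : Sym 𝒱 →ₗ[K] Sym 𝒱 :=
  DirectSum.toModule K ℤ (Sym 𝒱) (fun d => ksign K d • (grading 𝒱 d).subtype) ∘ₗ
    (DirectSum.decomposeLinearEquiv (grading 𝒱)).toLinearMap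

/-- A coderivation of degree `1` of `S^c(V)`: a linear map `Q` of degree `1` with
`Δ Q = (Q ⊗ id + id ⊗ Q) Δ`, where `(id ⊗ Q)(a ⊗ b) = (-1)^{|a|} a ⊗ Q b`. -/
structure IsCoderivation (Q : Sym 𝒱 →ₗ[K] Sym 𝒱) : Prop where
  degree : HasDegree (grading 𝒱) (grading 𝒱) 1 Q
  comul_comp : comul 𝒱 ∘ₗ Q =
    (TensorProduct.map Q LinearMap.id + TensorProduct.map (signMap 𝒱) Q) ∘ₗ comul 𝒱

variable [DirectSum.Decomposition 𝒲]

/-- A morphism of graded, counital and coaugmented coalgebras `S^c(V) → S^c(W)`. -/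
structure IsCoalgHom (F : Sym 𝒱 →ₗ[K] Sym 𝒲) : Prop where
  degree : HasDegree (grading 𝒱) (grading 𝒲) 0 F
  comul_comp : comul 𝒲 ∘ₗ F = TensorProduct.map F F ∘ₗ comul 𝒱
  counit_comp : counit 𝒲 ∘ₗ F = counit 𝒱
  map_one : F 1 = 1

end Graded

variable {𝒱 𝒲}

/-- The Taylor coefficients `fₙ : V^{⊙n} → W` of a linear map `F : S^c(V) → S^c(W)`, as
multilinear maps: `fₙ(v₁, …, vₙ) = p (F (v₁ ⊙ ⋯ ⊙ vₙ))`. -/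
def taylor (F : Sym 𝒱 →ₗ[K] Sym 𝒲) (n : ℕ) : MultilinearMap K (fun _ : Fin n => V) W :=
  (proj 𝒲 ∘ₗ F).compMultilinearMap (prod 𝒱 n)

/-- The linear part `f₁ : V → W`. -/
def linearPart (F : Sym 𝒱 →ₗ[K] Sym 𝒲) : V →ₗ[K] W := proj 𝒲 ∘ₗ F ∘ₗ ι 𝒱

theorem taylor_one (F : Sym 𝒱 →ₗ[K] Sym 𝒲) (v : Fin 1 → V) :
    taylor F 1 v = linearPart F (v 0) := by
  simp [taylor, linearPart, prod]

theorem proj_hasDegree : HasDegree (grading 𝒱) 𝒱 0 (proj 𝒱) := by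
  intro d x hx
  rw [add_zero]
  induction hx using Submodule.span_induction with
  | mem x h =>
    obtain ⟨l, rfl, rfl⟩ := h
    match l with
    | [] => simp [proj_one]
    | [a] => simp [proj_ι]
    | a :: b :: l => simp [proj_ι_mul_ι_mul]
  | zero => simp
  | add x y hx hy ihx ihy =>
    rw [map_add]
    exact add_mem ihx ihy
  | smul a x hx ih =>
    rw [map_smul]
    exact Submodule.smul_mem _ _ ih

/-- The functoriality of `S(V)` for linear maps of degree `0`. -/
def map (f : V →ₗ[K] W) (hf : HasDegree 𝒱 𝒲 0 f) : Sym 𝒱 →ₐ[K] Sym 𝒲 :=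
  lift 𝒱 (ι 𝒲 ∘ₗ f) fun i j x y hx hy => by
    have hx' := hf i x hx
    have hy' := hf j y hy
    rw [add_zero] at hx' hy'
    exact ι_mul_ι hx' hy'

@[simp]
theorem map_ι (f : V →ₗ[K] W) (hf : HasDegree 𝒱 𝒲 0 f) (v : V) :
    map f hf (ι 𝒱 v) = ι 𝒲 (f v) := by
  simp [map]

theorem map_hasDegree (f : V →ₗ[K] W) (hf : HasDegree 𝒱 𝒲 0 f) :
    HasDegree (grading 𝒱) (grading 𝒲) 0 (map f hf).toLinearMap := by
  intro d x hx
  rw [add_zero]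
  induction hx using Submodule.span_induction with
  | mem x h =>
    obtain ⟨l, rfl, rfl⟩ := h
    refine Submodule.subset_span
      ⟨l.map fun a => ⟨a.1, f a.2, by simpa using hf a.1 a.2 a.2.2⟩, ?_, ?_⟩
    · simp [Function.comp_def]
    · simp [map_list_prod, Function.comp_def]
  | zero => simp
  | add x y hx hy ihx ihy =>
    rw [map_add]
    exact add_mem ihx ihy
  | smul a x hx ih =>
    rw [map_smul]
    exact Submodule.smul_mem _ _ ih

theorem map_mem_power (f : V →ₗ[K] W) (hf : HasDegree 𝒱 𝒲 0 f) (n : ℕ) {x : Sym 𝒱}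
    (hx : x ∈ power 𝒱 n) : map f hf x ∈ power 𝒲 n := by
  have h : (power 𝒱 n).map (map f hf).toLinearMap ≤ power 𝒲 n := by
    rw [power, Submodule.map_pow, power]
    refine pow_le_pow_left₀ (by simp) ?_ n
    rintro _ ⟨_, ⟨v, rfl⟩, rfl⟩
    exact ⟨f v, (map_ι f hf v).symm⟩
  exact h ⟨x, hx, rfl⟩

end Sym

end SymmetricCoalgebra

section Cohomology

variable {K V W : Type*} [Field K] [AddCommGroup V] [Module K V] [AddCommGroup W] [Module K W]

/-- The cohomology `ker d / im d` of a differential `d`. -/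
abbrev Cohomology (d : V →ₗ[K] V) : Type _ :=
  LinearMap.ker d ⧸ (LinearMap.range d).submoduleOf (LinearMap.ker d)

/-- The class of a cocycle. -/
abbrev Cohomology.mk (d : V →ₗ[K] V) : LinearMap.ker d →ₗ[K] Cohomology d :=
  ((LinearMap.range d).submoduleOf (LinearMap.ker d)).mkQ

/-- The graded piece `Hⁱ` of the cohomology: the classes of the cocycles in `Vⁱ`. -/
def Cohomology.grading (𝒱 : ℤ → Submodule K V) (d : V →ₗ[K] V) (i : ℤ) :
    Submodule K (Cohomology d) :=
  ((𝒱 i).submoduleOf (LinearMap.ker d)).map (Cohomology.mk d)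

/-- The map induced in cohomology by a map of complexes. -/
def Cohomology.map {d : V →ₗ[K] V} {d' : W →ₗ[K] W} (f : V →ₗ[K] W) (h : f ∘ₗ d = d' ∘ₗ f) :
    Cohomology d →ₗ[K] Cohomology d' :=
  Submodule.mapQ _ _
    (f.restrict (p := LinearMap.ker d) (q := LinearMap.ker d') fun v hv => by
      rw [LinearMap.mem_ker] at hv ⊢
      rw [← LinearMap.comp_apply, ← h, LinearMap.comp_apply, hv, map_zero])
    (by
      rintro x ⟨y, hy⟩
      exact ⟨f y, by
        change d' (f y) = f x
        rw [← LinearMap.comp_apply, ← h, LinearMap.comp_apply, hy]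
        rfl⟩)

/-- `f` is a morphism of complexes that induces an isomorphism in cohomology. -/
def IsQuasiIso (d : V →ₗ[K] V) (d' : W →ₗ[K] W) (f : V →ₗ[K] W) : Prop :=
  ∃ h : f ∘ₗ d = d' ∘ₗ f, Function.Bijective (Cohomology.map f h)

section Decomposition

variable (𝒱 : ℤ → Submodule K V) [DirectSum.Decomposition 𝒱]

/-- The projection of `V` onto its component of degree `i`. -/
def component (i : ℤ) : V →ₗ[K] V :=
  (𝒱 i).subtype ∘ₗ DirectSum.component K ℤ (fun i => 𝒱 i) i ∘ₗ
    (DirectSum.decomposeLinearEquiv 𝒱).toLinearMap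

theorem component_apply (i : ℤ) (v : V) : component 𝒱 i v = (DirectSum.decompose 𝒱 v i : V) := rfl

theorem component_comm {d : V →ₗ[K] V} (hd : HasDegree 𝒱 𝒱 1 d) (i : ℤ) (v : V) :
    d (component 𝒱 i v) = component 𝒱 (i + 1) (d v) := by
  induction v using DirectSum.Decomposition.inductionOn 𝒱 with
  | zero => simp
  | @homogeneous j v =>
    rw [component_apply, component_apply]
    by_cases h : j = i
    · subst h
      rw [DirectSum.decompose_of_mem_same 𝒱 v.2, DirectSum.decompose_of_mem_same 𝒱 (hd j v v.2)]
    · rw [DirectSum.decompose_of_mem_ne 𝒱 v.2 h,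
        DirectSum.decompose_of_mem_ne 𝒱 (hd j v v.2) (by omega), map_zero]
  | add v w hv hw => simp only [map_add, hv, hw]

theorem component_mem_ker {d : V →ₗ[K] V} (hd : HasDegree 𝒱 𝒱 1 d) (i : ℤ) {v : V}
    (hv : v ∈ LinearMap.ker d) : component 𝒱 i v ∈ LinearMap.ker d := by
  rw [LinearMap.mem_ker] at hv ⊢
  rw [component_comm 𝒱 hd, hv, map_zero]

/-- The projection of the cohomology onto its component of degree `i`. -/
def cohomologyComponent {d : V →ₗ[K] V} (hd : HasDegree 𝒱 𝒱 1 d) (i : ℤ) :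
    Cohomology d →ₗ[K] Cohomology d :=
  Submodule.mapQ _ _
    ((component 𝒱 i).restrict fun _ hv => component_mem_ker 𝒱 hd i hv)
    (by
      rintro x ⟨y, hy⟩
      refine ⟨component 𝒱 (i - 1) y, ?_⟩
      rw [component_comm 𝒱 hd, hy, sub_add_cancel]
      rfl)

theorem cohomologyComponent_mk {d : V →ₗ[K] V} (hd : HasDegree 𝒱 𝒱 1 d) (i : ℤ)
    (x : LinearMap.ker d) : cohomologyComponent 𝒱 hd i (Cohomology.mk d x) =
      Cohomology.mk d ⟨component 𝒱 i x, component_mem_ker 𝒱 hd i x.2⟩ := rfl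

theorem cohomologyComponent_of_mem {d : V →ₗ[K] V} (hd : HasDegree 𝒱 𝒱 1 d) (i j : ℤ)
    {x : Cohomology d} (hx : x ∈ Cohomology.grading 𝒱 d i) :
    cohomologyComponent 𝒱 hd j x = if i = j then x else 0 := by
  obtain ⟨v, hv, rfl⟩ := hx
  have hv' : (v : V) ∈ 𝒱 i := hv
  rw [cohomologyComponent_mk]
  split_ifs with h
  · subst h
    congr 1
    exact Subtype.ext (DirectSum.decompose_of_mem_same 𝒱 hv')
  · rw [← map_zero (Cohomology.mk d)]
    congr 1
    exact Subtype.ext (DirectSum.decompose_of_mem_ne 𝒱 hv' h)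

theorem cohomology_isInternal {d : V →ₗ[K] V} (hd : HasDegree 𝒱 𝒱 1 d) :
    DirectSum.IsInternal (Cohomology.grading 𝒱 d) := by
  classical
  constructor
  · rw [injective_iff_map_eq_zero]
    intro x hx
    ext j
    have h : ∀ x : ⨁ i, Cohomology.grading 𝒱 d i,
        cohomologyComponent 𝒱 hd j (DirectSum.coeAddMonoidHom (Cohomology.grading 𝒱 d) x) =
          (x j : Cohomology d) := by
      intro x
      induction x using DirectSum.induction_on with
      | zero => simp
      | of i x =>
        rw [DirectSum.coeAddMonoidHom_of, cohomologyComponent_of_mem 𝒱 hd i j x.2,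
          DirectSum.coe_of_apply]
        split_ifs <;> rfl
      | add x y hx hy => simp only [map_add, hx, hy, DirectSum.add_apply, Submodule.coe_add]
    rw [← h, hx, map_zero]
    rfl
  · intro x
    obtain ⟨v, rfl⟩ := Submodule.mkQ_surjective _ x
    let s := (DirectSum.decompose 𝒱 (v : V)).support
    let c : ℤ → LinearMap.ker d := fun i => ⟨component 𝒱 i v, component_mem_ker 𝒱 hd i v.2⟩
    have hc : ∀ i, Cohomology.mk d (c i) ∈ Cohomology.grading 𝒱 d i := fun i =>
      ⟨c i, (DirectSum.decompose 𝒱 (v : V) i).2, rfl⟩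
    refine ⟨∑ i ∈ s, DirectSum.of (fun i => Cohomology.grading 𝒱 d i) i ⟨_, hc i⟩, ?_⟩
    rw [map_sum]
    simp only [DirectSum.coeAddMonoidHom_of]
    rw [← map_sum]
    congr 1
    ext
    rw [AddSubmonoidClass.coe_finsetSum]
    exact DirectSum.sum_support_decompose 𝒱 (v : V)

end Decomposition

end Cohomology

section Algebras

variable {K V W : Type*} [Field K] [AddCommGroup V] [Module K V] [AddCommGroup W] [Module K W]

/-- An `L∞[1]` algebra structure on the graded vector space `V`: a coderivation `Q` of degree `1` of
`S^c(V)` with vanishing constant part and `Q ∘ Q = 0`. -/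
structure LInftyStr (𝒱 : ℤ → Submodule K V) [DirectSum.Decomposition 𝒱] where
  /-- The codifferential. -/
  Q : Sym 𝒱 →ₗ[K] Sym 𝒱
  isCoderivation : Sym.IsCoderivation 𝒱 Q
  proj_Q_one : Sym.proj 𝒱 (Q 1) = 0
  Q_comp_Q : Q ∘ₗ Q = 0

namespace LInftyStr

variable {𝒱 : ℤ → Submodule K V} [DirectSum.Decomposition 𝒱]
  {𝒲 : ℤ → Submodule K W} [DirectSum.Decomposition 𝒲]

/-- The Taylor coefficients `qₙ` of the structure. -/
def q (A : LInftyStr 𝒱) (n : ℕ) : MultilinearMap K (fun _ : Fin n => V) V := Sym.taylor A.Q n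

/-- The differential `q₁` of the tangent complex. -/
def q₁ (A : LInftyStr 𝒱) : V →ₗ[K] V := Sym.linearPart A.Q

theorem q₁_hasDegree (A : LInftyStr 𝒱) : HasDegree 𝒱 𝒱 1 A.q₁ := by
  intro i v hv
  have h := Sym.proj_hasDegree (𝒱 := 𝒱) _ _
    (A.isCoderivation.degree i _ (Sym.ι_mem_grading hv))
  rwa [add_zero] at h

/-- The tangent cohomology `H(V, q₁)`. -/
abbrev H (A : LInftyStr 𝒱) : Type _ := Cohomology A.q₁

/-- The grading of the tangent cohomology. -/
abbrev gradingH (A : LInftyStr 𝒱) : ℤ → Submodule K A.H := Cohomology.grading 𝒱 A.q₁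

instance (A : LInftyStr 𝒱) : DirectSum.Decomposition A.gradingH :=
  (cohomology_isInternal 𝒱 A.q₁_hasDegree).chooseDecomposition

/-- An `L∞[1]` morphism `(V, Q) ⇢ (W, R)`: a morphism of DG coalgebras `S^c(V) → S^c(W)`. -/
structure IsMorphism (A : LInftyStr 𝒱) (B : LInftyStr 𝒲) (F : Sym 𝒱 →ₗ[K] Sym 𝒲) : Prop where
  isCoalgHom : Sym.IsCoalgHom 𝒱 𝒲 F
  comp_Q : F ∘ₗ A.Q = B.Q ∘ₗ F

/-- A weak equivalence: an `L∞[1]` morphism whose linear part is a quasi-isomorphism of the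
tangent complexes. -/
structure IsWeakEquiv (A : LInftyStr 𝒱) (B : LInftyStr 𝒲) (F : Sym 𝒱 →ₗ[K] Sym 𝒲) : Prop where
  isMorphism : IsMorphism A B F
  isQuasiIso : IsQuasiIso A.q₁ B.q₁ (Sym.linearPart F)

/-- `R` is the `L∞[1]` structure `(0, r₂, 0, 0, …)` on `H(V, q₁)`, where `r₂` is the bracket induced
by `q₂`, that is `r₂([x], [y]) = [q₂(x, y)]`. As a coderivation is determined by its Taylor
coefficients, there is at most one such `R`. -/
structure IsInducedBracket (A : LInftyStr 𝒱) (R : LInftyStr A.gradingH) : Prop where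
  two : ∀ x y : LinearMap.ker A.q₁, ∃ h : A.q 2 ![(x : V), (y : V)] ∈ LinearMap.ker A.q₁,
    R.q 2 ![Cohomology.mk A.q₁ x, Cohomology.mk A.q₁ y] = Cohomology.mk A.q₁ ⟨_, h⟩
  ne_two : ∀ n : ℕ, n ≠ 2 → R.q n = 0

/-- `(V, Q)` is formal: there is a weak equivalence `(V, Q) ⇢ (H(V, q₁), r₂)`. -/
def IsFormal (A : LInftyStr 𝒱) : Prop :=
  ∃ R : LInftyStr A.gradingH, A.IsInducedBracket R ∧
    ∃ F : Sym 𝒱 →ₗ[K] Sym A.gradingH, IsWeakEquiv A R F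

end LInftyStr

end Algebras

section Equivariance

variable {K G V W : Type*} [Field K] [Group G] [AddCommGroup V] [Module K V]
  [AddCommGroup W] [Module K W] {𝒱 : ℤ → Submodule K V} {𝒲 : ℤ → Submodule K W}

/-- A representation of `G` on the graded vector space `V`: every `g` acts with degree `0`. -/
def IsGradedRep (𝒱 : ℤ → Submodule K V) (ρ : Representation K G V) : Prop :=
  ∀ g : G, HasDegree 𝒱 𝒱 0 (ρ g)

/-- The `G`-module `Vⁱ`. -/
def gradedPiece (ρ : Representation K G V) (hρ : IsGradedRep 𝒱 ρ) (i : ℤ) :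
    Subrepresentation ρ where
  toSubmodule := 𝒱 i
  apply_mem_toSubmodule g v hv := by simpa using hρ g i v hv

/-- The action of `G` on `S(V)`, `g (v₁ ⊙ ⋯ ⊙ vₙ) = g v₁ ⊙ ⋯ ⊙ g vₙ`. -/
def symRep (ρ : Representation K G V) (hρ : IsGradedRep 𝒱 ρ) : Representation K G (Sym 𝒱) where
  toFun g := (Sym.map (ρ g) (hρ g)).toLinearMap
  map_one' := by
    have h : Sym.map (ρ 1) (hρ 1) = AlgHom.id K (Sym 𝒱) := Sym.algHom_ext 𝒱 fun v => by simp
    rw [h]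
    rfl
  map_mul' g g' := by
    have h : Sym.map (ρ (g * g')) (hρ (g * g')) = (Sym.map (ρ g) (hρ g)).comp
        (Sym.map (ρ g') (hρ g')) := Sym.algHom_ext 𝒱 fun v => by simp
    rw [h]
    rfl

/-- The `G`-module `V^{⊙n}`. -/
def powerRep (ρ : Representation K G V) (hρ : IsGradedRep 𝒱 ρ) (n : ℕ) :
    Subrepresentation (symRep ρ hρ) where
  toSubmodule := Sym.power 𝒱 n
  apply_mem_toSubmodule g _ hv := Sym.map_mem_power (ρ g) (hρ g) n hv

/-- The `G`-module `Hom^j(V^{⊙n}, V)` of linear maps of degree `j`, with the action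
`(g φ)(x) = g (φ (g⁻¹ x))`. -/
def homRep (ρ : Representation K G V) (hρ : IsGradedRep 𝒱 ρ) (j : ℤ) (n : ℕ) :
    Subrepresentation (Representation.linHom (powerRep ρ hρ n).toRepresentation ρ) where
  toSubmodule :=
    { carrier := {φ | HasDegree (fun i => (Sym.grading 𝒱 i).submoduleOf (Sym.power 𝒱 n)) 𝒱 j φ}
      add_mem' := fun ha hb i x hx => add_mem (ha i x hx) (hb i x hx)
      zero_mem' := fun i _ _ => zero_mem (𝒱 (i + j))
      smul_mem' := fun c _ ha i x hx => Submodule.smul_mem _ c (ha i x hx) }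
  apply_mem_toSubmodule g φ hφ := by
    intro i x hx
    have h1 := Sym.map_hasDegree (ρ g⁻¹) (hρ g⁻¹) i x hx
    rw [add_zero] at h1
    have h2 := hρ g _ _ (hφ i ((powerRep ρ hρ n).toRepresentation g⁻¹ x) h1)
    rw [add_zero] at h2
    exact h2

/-- A linear map `S^c(V) → S^c(W)` whose Taylor coefficients are `G`-equivariant:
`g fₙ(v₁, …, vₙ) = fₙ(g v₁, …, g vₙ)` for all `n ≥ 1`. -/
def IsEquivariant (ρ : Representation K G V) (σ : Representation K G W)
    (F : Sym 𝒱 →ₗ[K] Sym 𝒲) : Prop :=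
  ∀ (g : G) (n : ℕ), 1 ≤ n → ∀ v : Fin n → V,
    σ g (Sym.taylor F n v) = Sym.taylor F n fun k => ρ g (v k)

/-- The action of `G` on the cohomology of an equivariant differential. -/
def cohomologyRep (ρ : Representation K G V) (d : V →ₗ[K] V)
    (hd : ∀ (g : G) (v : V), ρ g (d v) = d (ρ g v)) : Representation K G (Cohomology d) :=
  (ρ.subrepresentation (LinearMap.ker d) fun g v hv => by
    rw [LinearMap.mem_ker] at hv
    rw [Submodule.mem_comap, LinearMap.mem_ker, ← hd, hv, map_zero]).quotient
    ((LinearMap.range d).submoduleOf (LinearMap.ker d)) fun g x hx => by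
      obtain ⟨y, hy⟩ := hx
      refine ⟨ρ g y, ?_⟩
      rw [← hd, hy]
      rfl

namespace LInftyStr

variable [DirectSum.Decomposition 𝒱] {ρ : Representation K G V}

/-- The `L∞[1]` structure is `G`-equivariant. -/
def IsEquivariant (A : LInftyStr 𝒱) (ρ : Representation K G V) : Prop :=
  LInfty.IsEquivariant ρ ρ A.Q

/-- The action of `G` on the tangent cohomology of a `G`-equivariant `L∞[1]` algebra. -/
def repH (A : LInftyStr 𝒱) (hA : A.IsEquivariant ρ) : Representation K G A.H :=
  cohomologyRep ρ A.q₁ fun g v => by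
    simpa only [Sym.taylor_one] using! hA g 1 le_rfl fun _ => v

theorem repH_isGradedRep (A : LInftyStr 𝒱) (hA : A.IsEquivariant ρ) (hρ : IsGradedRep 𝒱 ρ) :
    IsGradedRep A.gradingH (A.repH hA) := by
  rintro g i _ ⟨v, hv, rfl⟩
  exact ⟨_, hρ g i v hv, rfl⟩

/-- `(V, Q)` is `G`-equivariantly formal: there is a `G`-equivariant weak equivalence
`(H(V, q₁), r₂) ⇢ (V, Q)`. -/
def IsEquivariantlyFormal (A : LInftyStr 𝒱) (hA : A.IsEquivariant ρ) : Prop :=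
  ∃ R : LInftyStr A.gradingH, A.IsInducedBracket R ∧
    ∃ F : Sym A.gradingH →ₗ[K] Sym 𝒱, IsWeakEquiv R A F ∧ LInfty.IsEquivariant (A.repH hA) ρ F

end LInftyStr

end Equivariance

end LInfty

end

set_option linter.unusedSectionVars false

open scoped TensorProduct DirectSum

noncomputable section

namespace LInfty

section Signs

variable (K : Type*) [Field K]

/-! Write `H` for the cohomology. Semisimplicity of the graded pieces of `V` gives an equivariant
map `h` with `q₁ h q₁ = q₁` (`exists_homotopy`), hence an equivariant embedding `i` of `H` onto
representing cocycles. The task is to extend `i` to an equivariant `L∞[1]` morphism, one Taylor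
coefficient at a time, among coalgebra morphisms `F`; these may be prescribed freely by their Taylor
coefficients (`isCoalgHom_coexp`, `proj_coexp`).

If `F` commutes with the codifferentials in weights at most `m`, then the coefficient of `A.Q ∘ F -
F ∘ R.Q` in weight `m + 1` takes values in cocycles. Its class `ω`, a map from the symmetric power
to `H`, is the obstruction, and it is invariant because `F`, `A.Q` and `R.Q` are equivariant.
Changing `F` in weight `m` by `i ∘ φ` changes `ω` by the differential of `φ` in the complex of
coderivations of the bracket on `H`. Once the class vanishes, a coefficient in weight `m + 1` built
from `h` removes the remaining coboundary (`exists_extension`).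

Formality enters through the Euler coderivation, which multiplies the `n`-th symmetric power by `n`.
A weak equivalence `P` to `H`, in no way equivariant, makes `Φ = P ∘ F` an automorphism of the
coalgebra `S(H)`. The structure `Φ⁻¹ R Φ` agrees with `R` up to the leading term `ω`. As `R` is
quadratic, `[euler, R] = -R`; conjugating this by `Φ` and comparing coefficients in weight `n = m +
1` shows that `(2 - n) ω` is a coboundary (`exists_primitive`). In characteristic zero, with `n ≥
3`, so is `ω`. Its primitive depends on `P`, but semisimplicity of the space of degree `0`
coefficients replaces it by an invariant one (`exists_invariant_primitive`). The corrections
stabilize in each weight, so they have a limit (`exists_limit`). -/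

theorem ksign_add (m n : ℤ) : ksign K (m + n) = ksign K m * ksign K n := by
  simp [ksign, Int.negOnePow_add]

theorem ksign_zero : ksign K 0 = 1 := by simp [ksign]

end Signs

/-! ### Generators of `S(V)` and the recursive form of the coproduct. -/

namespace Sym

variable {K V W : Type*} [Field K] [AddCommGroup V] [Module K V] [AddCommGroup W] [Module K W]
variable {𝒱 : ℤ → Submodule K V} {𝒲 : ℤ → Submodule K W}

theorem mul_mem_of_ι_mul_mem {P Q : Submodule K (Sym 𝒱)} [DirectSum.Decomposition 𝒱]
    (h : ∀ (i : ℤ) (v : V), v ∈ 𝒱 i → ∀ x ∈ P, ι 𝒱 v * x ∈ Q) (v : V) {x : Sym 𝒱} (hx : x ∈ P) :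
    ι 𝒱 v * x ∈ Q := by
  induction v using DirectSum.Decomposition.inductionOn 𝒱 with
  | zero => simp
  | @homogeneous i v => exact h i v v.2 x hx
  | add v w hv hw => rw [map_add, add_mul]; exact add_mem hv hw

/-- A subspace containing `1` and stable under multiplication by homogeneous vectors is all of
`S(V)`. -/
theorem eq_top_of_ι_mul_mem [DirectSum.Decomposition 𝒱] (P : Submodule K (Sym 𝒱)) (one : 1 ∈ P)
    (mul : ∀ (i : ℤ) (v : V), v ∈ 𝒱 i → ∀ x ∈ P, ι 𝒱 v * x ∈ P) : P = ⊤ := by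
  -- The elements whose left multiplication preserves `P` form a subalgebra containing `V`. The
  -- universal property then makes it everything, and applying its elements to `1 ∈ P` gives the
  -- claim.
  let B : Subalgebra K (Sym 𝒱) :=
    { carrier := {a | ∀ x ∈ P, a * x ∈ P}
      mul_mem' := fun {a b} ha hb x hx => by rw [mul_assoc]; exact ha _ (hb _ hx)
      add_mem' := fun {a b} ha hb x hx => by rw [add_mul]; exact add_mem (ha _ hx) (hb _ hx)
      algebraMap_mem' := fun r x hx => by rw [← Algebra.smul_def]; exact P.smul_mem _ hx }
  have hv : ∀ v, ι 𝒱 v ∈ B := fun v x hx => mul_mem_of_ι_mul_mem mul v hx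
  let f : Sym 𝒱 →ₐ[K] B := lift 𝒱 ((ι 𝒱).codRestrict B.toSubmodule hv) fun i j x y hx hy =>
    Subtype.ext (ι_mul_ι hx hy)
  have hf : B.val.comp f = AlgHom.id K _ := algHom_ext 𝒱 fun v => by
    simp only [f, AlgHom.comp_apply, lift_ι]
    rfl
  rw [eq_top_iff]
  intro x _
  have h : x ∈ B := by
    rw [← AlgHom.id_apply (R := K) x, ← hf]
    exact (f x).2
  simpa using h 1 one

theorem hom_ext [DirectSum.Decomposition 𝒱] {M : Type*} [AddCommGroup M] [Module K M]
    {f g : Sym 𝒱 →ₗ[K] M} (one : f 1 = g 1)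
    (mul : ∀ (i : ℤ) (v : V), v ∈ 𝒱 i → ∀ x, f x = g x → f (ι 𝒱 v * x) = g (ι 𝒱 v * x)) :
    f = g := by
  have h := eq_top_of_ι_mul_mem (LinearMap.eqLocus f g) one mul
  ext x
  exact (h ▸ Submodule.mem_top : x ∈ LinearMap.eqLocus f g)

theorem power_zero : power 𝒱 0 = 1 := pow_zero _

theorem power_succ (n : ℕ) : power 𝒱 (n + 1) = LinearMap.range (ι 𝒱) * power 𝒱 n := pow_succ' _ _

theorem one_mem_power : (1 : Sym 𝒱) ∈ power 𝒱 0 := by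
  rw [power_zero]; exact Submodule.one_le.mp le_rfl

theorem ι_mul_mem_power (v : V) {n : ℕ} {x : Sym 𝒱} (hx : x ∈ power 𝒱 n) :
    ι 𝒱 v * x ∈ power 𝒱 (n + 1) := by
  rw [power_succ]
  exact Submodule.mul_mem_mul ⟨v, rfl⟩ hx

theorem ι_mem_power (v : V) : ι 𝒱 v ∈ power 𝒱 1 := by
  simpa using ι_mul_mem_power v (one_mem_power (𝒱 := 𝒱))

theorem power_le [DirectSum.Decomposition 𝒱] (P : ℕ → Submodule K (Sym 𝒱)) (one : 1 ∈ P 0)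
    (mul : ∀ (n : ℕ) (i : ℤ) (v : V), v ∈ 𝒱 i → ∀ x ∈ P n, ι 𝒱 v * x ∈ P (n + 1)) (n : ℕ) :
    power 𝒱 n ≤ P n := by
  induction n with
  | zero => rw [power_zero, Submodule.one_le]; exact one
  | succ n ih =>
    rw [power_succ, Submodule.mul_le]
    rintro _ ⟨v, rfl⟩ x hx
    exact mul_mem_of_ι_mul_mem (mul n) v (ih hx)

theorem grading_le (P : ℤ → Submodule K (Sym 𝒱)) (one : 1 ∈ P 0)
    (mul : ∀ (d i : ℤ) (v : V), v ∈ 𝒱 i → ∀ x ∈ P d, ι 𝒱 v * x ∈ P (i + d)) (d : ℤ) :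
    grading 𝒱 d ≤ P d := by
  rw [grading, Submodule.span_le]
  rintro _ ⟨l, rfl, rfl⟩
  induction l with
  | nil => simpa using one
  | cons a l ih => simpa using mul _ _ _ a.2.2 _ ih

theorem mem_power_zero {x : Sym 𝒱} (hx : x ∈ power 𝒱 0) : ∃ c : K, x = c • 1 := by
  rw [power_zero] at hx
  obtain ⟨c, rfl⟩ := Submodule.mem_one.mp hx
  exact ⟨c, Algebra.algebraMap_eq_smul_one c⟩

theorem mem_power_one {x : Sym 𝒱} (hx : x ∈ power 𝒱 1) : ∃ v, x = ι 𝒱 v := by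
  rw [power, pow_one] at hx
  obtain ⟨v, rfl⟩ := hx
  exact ⟨v, rfl⟩

theorem counit_one : counit 𝒱 1 = 1 := by simp [counit]

theorem counit_ι_mul (v : V) (x : Sym 𝒱) : counit 𝒱 (ι 𝒱 v * x) = 0 := by simp [counit]

theorem counit_ι (v : V) : counit 𝒱 (ι 𝒱 v) = 0 := by simp [counit]

section Graded

theorem one_mem_grading : (1 : Sym 𝒱) ∈ grading 𝒱 0 := SetLike.GradedOne.one_mem

theorem ι_mul_mem_grading {i d : ℤ} {v : V} (hv : v ∈ 𝒱 i) {x : Sym 𝒱} (hx : x ∈ grading 𝒱 d) :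
    ι 𝒱 v * x ∈ grading 𝒱 (i + d) :=
  SetLike.GradedMul.mul_mem (ι_mem_grading hv) hx

variable [DirectSum.Decomposition 𝒱] [DirectSum.Decomposition 𝒲]

/-- A product with `v` has weight one only where the other factor has weight zero, and the counit
extracts that part. -/
theorem proj_ι_mul (v : V) (x : Sym 𝒱) : proj 𝒱 (ι 𝒱 v * x) = counit 𝒱 x • v := by
  have h : (proj 𝒱) ∘ₗ LinearMap.mulLeft K (ι 𝒱 v) = (counit 𝒱).smulRight v :=
    hom_ext (by simp [proj_ι, counit_one]) fun i w _ x _ => by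
      simp [proj_ι_mul_ι_mul, counit_ι_mul]
  exact congr($h x)

variable (𝒱) in
/-- The linear map `x ↦ (-1)^{i|x|} x` of `S(V)`. -/
def sgn (i : ℤ) : Sym 𝒱 →ₗ[K] Sym 𝒱 :=
  DirectSum.toModule K ℤ (Sym 𝒱) (fun d => ksign K (i * d) • (grading 𝒱 d).subtype) ∘ₗ
    (DirectSum.decomposeLinearEquiv (grading 𝒱)).toLinearMap

theorem signMap_eq_sgn : signMap 𝒱 = sgn 𝒱 1 := by simp [signMap, sgn]

theorem sgn_of_mem (i : ℤ) {d : ℤ} {x : Sym 𝒱} (hx : x ∈ grading 𝒱 d) :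
    sgn 𝒱 i x = ksign K (i * d) • x := by
  simp only [sgn, LinearMap.comp_apply, LinearEquiv.coe_coe,
    DirectSum.decomposeLinearEquiv_apply]
  rw [DirectSum.decompose_of_mem (grading 𝒱) hx, ← DirectSum.lof_eq_of K, DirectSum.toModule_lof]
  rfl

theorem sgn_one (i : ℤ) : sgn 𝒱 i 1 = 1 := by
  rw [sgn_of_mem i one_mem_grading, mul_zero, ksign_zero, one_smul]

/-- Linear maps out of `S(V)` that agree on homogeneous elements are equal. -/
theorem hom_ext_grading {M : Type*} [AddCommGroup M] [Module K M] {f g : Sym 𝒱 →ₗ[K] M}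
    (h : ∀ (d : ℤ), ∀ x ∈ grading 𝒱 d, f x = g x) : f = g := by
  ext x
  induction x using DirectSum.Decomposition.inductionOn (grading 𝒱) with
  | zero => simp
  | @homogeneous i v => exact h i v v.2
  | add v w hv hw => rw [map_add, map_add, hv, hw]

theorem sgn_ι_mul (i : ℤ) {j : ℤ} {v : V} (hv : v ∈ 𝒱 j) (x : Sym 𝒱) :
    sgn 𝒱 i (ι 𝒱 v * x) = ksign K (i * j) • (ι 𝒱 v * sgn 𝒱 i x) := by
  have h : sgn 𝒱 i ∘ₗ LinearMap.mulLeft K (ι 𝒱 v) =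
      ksign K (i * j) • (LinearMap.mulLeft K (ι 𝒱 v) ∘ₗ sgn 𝒱 i) := by
    refine hom_ext_grading fun d x hx => ?_
    simp only [LinearMap.comp_apply, LinearMap.mulLeft_apply, LinearMap.smul_apply]
    rw [sgn_of_mem i (ι_mul_mem_grading hv hx), sgn_of_mem i hx, mul_smul_comm, smul_smul, mul_add,
      ksign_add]
  exact congr($h x)

theorem sgn_comm_of_hasDegree {F : Sym 𝒱 →ₗ[K] Sym 𝒲}
    (hF : HasDegree (grading 𝒱) (grading 𝒲) 0 F) (i : ℤ) : sgn 𝒲 i ∘ₗ F = F ∘ₗ sgn 𝒱 i := by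
  refine hom_ext_grading fun d x hx => ?_
  have h := hF d x hx
  rw [add_zero] at h
  simp only [LinearMap.comp_apply]
  rw [sgn_of_mem i hx, sgn_of_mem i h, map_smul]

theorem ι_mul_eq_mul_ι {i : ℤ} {v : V} (hv : v ∈ 𝒱 i) (x : Sym 𝒱) :
    ι 𝒱 v * x = sgn 𝒱 i x * ι 𝒱 v := by
  have h : LinearMap.mulLeft K (ι 𝒱 v) = LinearMap.mulRight K (ι 𝒱 v) ∘ₗ sgn 𝒱 i := by
    refine hom_ext (by simp [sgn_one]) fun j w hw x hx => ?_
    simp only [LinearMap.mulLeft_apply, LinearMap.comp_apply, LinearMap.mulRight_apply] at hx ⊢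
    rw [sgn_ι_mul i hw, ← mul_assoc, ι_mul_ι hv hw, smul_mul_assoc, smul_mul_assoc, mul_assoc,
      mul_assoc, hx]
  exact congr($h x)

/-- The coproduct as a morphism of algebras into the graded tensor product. -/
def gradedComul : Sym 𝒱 →ₐ[K] GradedTensorProduct K (grading 𝒱) (grading 𝒱) :=
  lift 𝒱 ((GradedTensorProduct.includeLeft (grading 𝒱) (grading 𝒱)).toLinearMap ∘ₗ ι 𝒱 +
      (GradedTensorProduct.includeRight (grading 𝒱) (grading 𝒱)).toLinearMap ∘ₗ ι 𝒱)
      (comul_aux 𝒱)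

theorem of_comul (x : Sym 𝒱) :
    GradedTensorProduct.of K (grading 𝒱) (grading 𝒱) (comul 𝒱 x) = gradedComul x := rfl

theorem gradedComul_ι (v : V) : gradedComul (ι 𝒱 v) =
    GradedTensorProduct.includeLeft (grading 𝒱) (grading 𝒱) (ι 𝒱 v) +
      GradedTensorProduct.includeRight (grading 𝒱) (grading 𝒱) (ι 𝒱 v) := by
  simp [gradedComul]

theorem comul_one : comul 𝒱 1 = 1 ⊗ₜ 1 := by
  apply (GradedTensorProduct.of K (grading 𝒱) (grading 𝒱)).injective
  rw [of_comul, map_one]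
  rfl

theorem includeLeft_mul (a : Sym 𝒱) (y : Sym 𝒱 ⊗[K] Sym 𝒱) :
    GradedTensorProduct.includeLeft (grading 𝒱) (grading 𝒱) a *
      GradedTensorProduct.of K (grading 𝒱) (grading 𝒱) y =
    GradedTensorProduct.of K (grading 𝒱) (grading 𝒱)
      (TensorProduct.map (LinearMap.mulLeft K a) LinearMap.id y) := by
  induction y with
  | zero => simp
  | add x y hx hy => simp only [map_add, mul_add, hx, hy]
  | tmul b c =>
    induction b using DirectSum.Decomposition.inductionOn (grading 𝒱) with
    | zero => simp
    | add x y hx hy => simp only [TensorProduct.add_tmul, map_add, mul_add, hx, hy]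
    | homogeneous b =>
      exact GradedTensorProduct.tmul_one_mul_coe_tmul (grading 𝒱) (grading 𝒱) a b c

theorem includeRight_mul {i : ℤ} {a : Sym 𝒱} (ha : a ∈ grading 𝒱 i) (y : Sym 𝒱 ⊗[K] Sym 𝒱) :
    GradedTensorProduct.includeRight (grading 𝒱) (grading 𝒱) a *
      GradedTensorProduct.of K (grading 𝒱) (grading 𝒱) y =
    GradedTensorProduct.of K (grading 𝒱) (grading 𝒱)
      (TensorProduct.map (sgn 𝒱 i) (LinearMap.mulLeft K a) y) := by
  induction y with
  | zero => simp
  | add x y hx hy => simp only [map_add, mul_add, hx, hy]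
  | tmul b c =>
    induction b using DirectSum.Decomposition.inductionOn (grading 𝒱) with
    | zero => simp
    | add x y hx hy => simp only [TensorProduct.add_tmul, map_add, mul_add, hx, hy]
    | @homogeneous d b =>
      have h := GradedTensorProduct.tmul_coe_mul_coe_tmul (R := K) (grading 𝒱) (grading 𝒱) 1
        ⟨a, ha⟩ b c
      rw [TensorProduct.map_tmul, sgn_of_mem i b.2, ← TensorProduct.smul_tmul', map_smul, ksign,
        Int.cast_smul_eq_zsmul]
      rw [one_mul] at h
      exact h

/-- `Δ` is an algebra morphism and `Δ v = v ⊗ 1 + 1 ⊗ v`; moving `v` past the left tensor factor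
produces `sgn`. With `hom_ext` this turns identities about the coproduct into inductions on word
length. -/
theorem comul_ι_mul {i : ℤ} {v : V} (hv : v ∈ 𝒱 i) (x : Sym 𝒱) :
    comul 𝒱 (ι 𝒱 v * x) =
      TensorProduct.map (LinearMap.mulLeft K (ι 𝒱 v)) LinearMap.id (comul 𝒱 x) +
      TensorProduct.map (sgn 𝒱 i) (LinearMap.mulLeft K (ι 𝒱 v)) (comul 𝒱 x) := by
  apply (GradedTensorProduct.of K (grading 𝒱) (grading 𝒱)).injective
  rw [of_comul, map_mul, gradedComul_ι, add_mul, ← of_comul, includeLeft_mul,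
    includeRight_mul (ι_mem_grading hv), map_add]

end Graded

end Sym

end LInfty

namespace LInfty

namespace Sym

variable {K V W : Type*} [Field K] [AddCommGroup V] [Module K V] [AddCommGroup W] [Module K W]
variable {𝒱 : ℤ → Submodule K V} {𝒲 : ℤ → Submodule K W}

/-! ### The weight grading by symmetric powers, its filtration, and the Euler operator. -/

section Weights

instance : SetLike.GradedMonoid (power 𝒱) :=
  inferInstanceAs (SetLike.GradedMonoid (fun n : ℕ => LinearMap.range (ι 𝒱) ^ n))

variable (𝒱) in
/-- The inclusion of `V` with values in the direct sum of the symmetric powers. -/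
def weightι : V →ₗ[K] ⨁ n, power 𝒱 n :=
  DirectSum.lof K ℕ (fun n => power 𝒱 n) 1 ∘ₗ (ι 𝒱).codRestrict _ ι_mem_power

theorem weightι_apply (v : V) :
    weightι 𝒱 v = DirectSum.of (fun n => power 𝒱 n) 1 ⟨ι 𝒱 v, ι_mem_power v⟩ := rfl

variable (𝒱) in
/-- The algebra morphism that splits an element of `S(V)` into its components in the symmetric
powers. -/
def weightSplit : Sym 𝒱 →ₐ[K] ⨁ n, power 𝒱 n :=
  lift 𝒱 (A := ⨁ n, power 𝒱 n) (weightι 𝒱) (by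
    intro i j x y hx hy
    change weightι 𝒱 x * weightι 𝒱 y = ksign K (i * j) • (weightι 𝒱 y * weightι 𝒱 x)
    rw [weightι_apply, weightι_apply, DirectSum.of_mul_of, DirectSum.of_mul_of,
      ← DirectSum.lof_eq_of K, ← DirectSum.lof_eq_of K, ← map_smul]
    exact DirectSum.of_eq_of_gradedMonoid_eq (Sigma.subtype_ext rfl (ι_mul_ι hx hy)))

instance : GradedAlgebra (power 𝒱) :=
  GradedAlgebra.ofAlgHom _ (weightSplit 𝒱)
    (by
      refine algHom_ext 𝒱 fun v => ?_
      change DirectSum.coeAlgHom (power 𝒱) (weightSplit 𝒱 (ι 𝒱 v)) = ι 𝒱 v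
      rw [weightSplit, lift_ι, weightι_apply, DirectSum.coeAlgHom_of])
    fun i x => by
    obtain ⟨x, hx⟩ := x
    dsimp only
    change x ∈ LinearMap.range (ι 𝒱) ^ i at hx
    induction hx using Submodule.pow_induction_on_left' with
    | algebraMap r =>
      rw [AlgHom.commutes, DirectSum.algebraMap_apply]; rfl
    | add x y i hx hy ihx ihy =>
      rw [map_add, ihx, ihy, ← map_add]
      rfl
    | mem_mul m hm i x hx ih =>
      obtain ⟨_, rfl⟩ := hm
      rw [map_mul, ih, weightSplit, lift_ι, weightι_apply, DirectSum.of_mul_of]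
      exact DirectSum.of_eq_of_gradedMonoid_eq (Sigma.subtype_ext (add_comm _ _) rfl)

variable {M : Type*} [AddCommGroup M] [Module K M]

/-- Linear maps out of `S(V)` that agree on the symmetric powers are equal. -/
theorem hom_ext_power {f g : Sym 𝒱 →ₗ[K] M} (h : ∀ (n : ℕ), ∀ x ∈ power 𝒱 n, f x = g x) :
    f = g := by
  ext x
  induction x using DirectSum.Decomposition.inductionOn (power 𝒱) with
  | zero => simp
  | @homogeneous i v => exact h i v v.2
  | add v w hv hw => rw [map_add, map_add, hv, hw]

/-- The linear map that is `f n` on `V^{⊙n}`. -/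
def ofWeights (f : ℕ → Sym 𝒱 →ₗ[K] M) : Sym 𝒱 →ₗ[K] M :=
  DirectSum.toModule K ℕ M (fun n => f n ∘ₗ (power 𝒱 n).subtype) ∘ₗ
    (DirectSum.decomposeLinearEquiv (power 𝒱)).toLinearMap

theorem ofWeights_of_mem (f : ℕ → Sym 𝒱 →ₗ[K] M) {n : ℕ} {x : Sym 𝒱} (hx : x ∈ power 𝒱 n) :
    ofWeights f x = f n x := by
  simp only [ofWeights, LinearMap.comp_apply, LinearEquiv.coe_coe,
    DirectSum.decomposeLinearEquiv_apply]
  rw [DirectSum.decompose_of_mem (power 𝒱) hx, ← DirectSum.lof_eq_of K, DirectSum.toModule_lof]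
  rfl

variable (𝒱) in
/-- The projection of `S(V)` onto `V^{⊙n}`. -/
def wproj (n : ℕ) : Sym 𝒱 →ₗ[K] Sym 𝒱 :=
  ofWeights fun m => if m = n then LinearMap.id else 0

theorem wproj_of_mem {m : ℕ} {x : Sym 𝒱} (hx : x ∈ power 𝒱 m) (n : ℕ) :
    wproj 𝒱 n x = if m = n then x else 0 := by
  rw [wproj, ofWeights_of_mem _ hx]
  split_ifs <;> rfl

theorem wproj_of_mem_same {n : ℕ} {x : Sym 𝒱} (hx : x ∈ power 𝒱 n) : wproj 𝒱 n x = x := by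
  rw [wproj_of_mem hx, if_pos rfl]

theorem wproj_of_mem_ne {m n : ℕ} {x : Sym 𝒱} (hx : x ∈ power 𝒱 m) (h : m ≠ n) :
    wproj 𝒱 n x = 0 := by
  rw [wproj_of_mem hx, if_neg h]

theorem wproj_eq_decompose (n : ℕ) (x : Sym 𝒱) :
    wproj 𝒱 n x = (DirectSum.decompose (power 𝒱) x n : Sym 𝒱) := by
  induction x using DirectSum.Decomposition.inductionOn (power 𝒱) with
  | zero => simp
  | @homogeneous i v =>
    rw [wproj_of_mem v.2]
    split_ifs with h
    · subst h
      rw [DirectSum.decompose_of_mem_same _ v.2]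
    · rw [DirectSum.decompose_of_mem_ne _ v.2 h]
  | add v w hv hw => simp [hv, hw]

theorem wproj_mem (n : ℕ) (x : Sym 𝒱) : wproj 𝒱 n x ∈ power 𝒱 n := by
  rw [wproj_eq_decompose]
  exact SetLike.coe_mem _

theorem ext_wproj {x y : Sym 𝒱} (h : ∀ n, wproj 𝒱 n x = wproj 𝒱 n y) : x = y := by
  apply (DirectSum.decompose (power 𝒱)).injective
  ext n
  simpa only [wproj_eq_decompose] using h n

theorem wproj_ι_mul (n : ℕ) (v : V) (x : Sym 𝒱) :
    wproj 𝒱 (n + 1) (ι 𝒱 v * x) = ι 𝒱 v * wproj 𝒱 n x := by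
  have h : wproj 𝒱 (n + 1) ∘ₗ LinearMap.mulLeft K (ι 𝒱 v) =
      LinearMap.mulLeft K (ι 𝒱 v) ∘ₗ wproj 𝒱 n :=
    hom_ext_power fun m x hx => by
      simp only [LinearMap.comp_apply, LinearMap.mulLeft_apply]
      rw [wproj_of_mem hx, wproj_of_mem (ι_mul_mem_power v hx)]
      by_cases h : m = n <;> simp [h]
  exact congr($h x)

variable (𝒱) in
/-- The sum of the symmetric powers `V^{⊙k}` with `k < n`. -/
def below (n : ℕ) : Submodule K (Sym 𝒱) := ⨅ k ≥ n, LinearMap.ker (wproj 𝒱 k)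

theorem mem_below {n : ℕ} {x : Sym 𝒱} : x ∈ below 𝒱 n ↔ ∀ k ≥ n, wproj 𝒱 k x = 0 := by
  simp [below]

theorem below_le {n : ℕ} {P : Submodule K (Sym 𝒱)} (h : ∀ k < n, power 𝒱 k ≤ P) :
    below 𝒱 n ≤ P := by
  classical
  intro x hx
  rw [mem_below] at hx
  rw [← DirectSum.sum_support_decompose (power 𝒱) x]
  refine Submodule.sum_mem _ fun k _ => ?_
  rw [← wproj_eq_decompose]
  by_cases hk : k < n
  · exact h k hk (wproj_mem k x)
  · rw [hx k (not_lt.mp hk)]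
    exact zero_mem _

theorem power_le_below {k n : ℕ} (h : k < n) : power 𝒱 k ≤ below 𝒱 n := fun x hx => by
  rw [mem_below]
  intro m hm
  exact wproj_of_mem_ne hx (by omega)

theorem below_mono {m n : ℕ} (h : m ≤ n) : below 𝒱 m ≤ below 𝒱 n :=
  below_le fun _ hk => power_le_below (hk.trans_le h)

theorem ι_mul_mem_below (v : V) {n : ℕ} {x : Sym 𝒱} (hx : x ∈ below 𝒱 n) :
    ι 𝒱 v * x ∈ below 𝒱 (n + 1) := by
  rw [mem_below] at hx ⊢
  intro k hk
  obtain ⟨k, rfl⟩ : ∃ m, k = m + 1 := ⟨k - 1, by omega⟩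
  rw [wproj_ι_mul, hx k (by omega), mul_zero]

theorem exists_mem_below (x : Sym 𝒱) : ∃ n, x ∈ below 𝒱 n := by
  induction x using DirectSum.Decomposition.inductionOn (power 𝒱) with
  | zero => exact ⟨0, zero_mem _⟩
  | @homogeneous i v => exact ⟨i + 1, power_le_below (Nat.lt_succ_self i) v.2⟩
  | add v w hv hw =>
    obtain ⟨m, hm⟩ := hv
    obtain ⟨n, hn⟩ := hw
    exact ⟨max m n, add_mem (below_mono (le_max_left _ _) hm) (below_mono (le_max_right _ _) hn)⟩

theorem below_zero : below 𝒱 0 = ⊥ := by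
  rw [eq_bot_iff]
  exact below_le fun k hk => absurd hk (Nat.not_lt_zero k)

theorem counit_of_mem_power {n : ℕ} (hn : n ≠ 0) {x : Sym 𝒱} (hx : x ∈ power 𝒱 n) :
    counit 𝒱 x = 0 := by
  obtain ⟨n, rfl⟩ := Nat.exists_eq_succ_of_ne_zero hn
  rw [Nat.succ_eq_add_one, power_succ] at hx
  induction hx using Submodule.mul_induction_on' with
  | mem_mul_mem v hv y _ =>
    obtain ⟨v, rfl⟩ := hv
    exact counit_ι_mul v y
  | add x _ y _ hx hy => rw [map_add, hx, hy, add_zero]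

theorem proj_of_mem_power [DirectSum.Decomposition 𝒱] {n : ℕ} (hn : n ≠ 1) {x : Sym 𝒱}
    (hx : x ∈ power 𝒱 n) : proj 𝒱 x = 0 := by
  match n with
  | 0 =>
    obtain ⟨c, rfl⟩ := mem_power_zero hx
    rw [map_smul, proj_one, smul_zero]
  | n + 1 =>
    rw [power_succ] at hx
    induction hx using Submodule.mul_induction_on' with
    | mem_mul_mem v hv y hy =>
      obtain ⟨v, rfl⟩ := hv
      rw [proj_ι_mul, counit_of_mem_power (by omega) hy, zero_smul]
    | add x _ y _ hx hy => rw [map_add, hx, hy, add_zero]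

theorem wproj_zero (x : Sym 𝒱) : wproj 𝒱 0 x = counit 𝒱 x • 1 := by
  have h : wproj 𝒱 0 = (counit 𝒱).smulRight 1 := hom_ext_power fun n x hx => by
    rcases eq_or_ne n 0 with rfl | hn
    · obtain ⟨c, rfl⟩ := mem_power_zero hx
      rw [wproj_of_mem_same hx]
      simp [counit_one]
    · rw [wproj_of_mem_ne hx hn, LinearMap.smulRight_apply, counit_of_mem_power hn hx, zero_smul]
  exact congr($h x)

theorem wproj_one [DirectSum.Decomposition 𝒱] (x : Sym 𝒱) : wproj 𝒱 1 x = ι 𝒱 (proj 𝒱 x) := by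
  have h : wproj 𝒱 1 = ι 𝒱 ∘ₗ proj 𝒱 := hom_ext_power fun n x hx => by
    rcases eq_or_ne n 1 with rfl | hn
    · obtain ⟨v, rfl⟩ := mem_power_one hx
      rw [wproj_of_mem_same hx, LinearMap.comp_apply, proj_ι]
    · rw [wproj_of_mem_ne hx hn, LinearMap.comp_apply, proj_of_mem_power hn hx, map_zero]
  exact congr($h x)

variable (𝒱) in
/-- The Euler coderivation, multiplication by `n` on `V^{⊙n}`. -/
def euler : Sym 𝒱 →ₗ[K] Sym 𝒱 := ofWeights fun n => (n : K) • LinearMap.id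

theorem euler_of_mem {n : ℕ} {x : Sym 𝒱} (hx : x ∈ power 𝒱 n) : euler 𝒱 x = (n : K) • x := by
  rw [euler, ofWeights_of_mem _ hx]
  rfl

theorem euler_one : euler 𝒱 1 = 0 := by simp [euler_of_mem one_mem_power]

theorem euler_ι (v : V) : euler 𝒱 (ι 𝒱 v) = ι 𝒱 v := by simp [euler_of_mem (ι_mem_power v)]

theorem euler_ι_mul (v : V) (x : Sym 𝒱) :
    euler 𝒱 (ι 𝒱 v * x) = ι 𝒱 v * x + ι 𝒱 v * euler 𝒱 x := by
  have h : euler 𝒱 ∘ₗ LinearMap.mulLeft K (ι 𝒱 v) =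
      LinearMap.mulLeft K (ι 𝒱 v) + LinearMap.mulLeft K (ι 𝒱 v) ∘ₗ euler 𝒱 :=
    hom_ext_power fun m x hx => by
      simp only [LinearMap.comp_apply, LinearMap.mulLeft_apply, LinearMap.add_apply]
      rw [euler_of_mem hx, euler_of_mem (ι_mul_mem_power v hx), mul_smul_comm]
      push_cast
      module
  exact congr($h x)

theorem wproj_euler (n : ℕ) (x : Sym 𝒱) : wproj 𝒱 n (euler 𝒱 x) = (n : K) • wproj 𝒱 n x := by
  have h : wproj 𝒱 n ∘ₗ euler 𝒱 = (n : K) • wproj 𝒱 n := hom_ext_power fun m x hx => by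
    rw [LinearMap.comp_apply, LinearMap.smul_apply, euler_of_mem hx, map_smul, wproj_of_mem hx]
    split_ifs with h
    · rw [h]
    · simp
  exact congr($h x)

variable [CharZero K]

/-- In characteristic zero the Euler operator is invertible in every positive weight, and the counit
sees weight zero. Statements about `x` can therefore be proved for `euler 𝒱 x`, where the coproduct
gives a recursion. -/
theorem eq_of_euler_eq {x y : Sym 𝒱} (h : euler 𝒱 x = euler 𝒱 y)
    (h0 : counit 𝒱 x = counit 𝒱 y) : x = y := by
  refine ext_wproj fun n => ?_
  rcases eq_or_ne n 0 with rfl | hn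
  · rw [wproj_zero, wproj_zero, h0]
  · have h' := congr(wproj 𝒱 n $h)
    rw [wproj_euler, wproj_euler] at h'
    exact smul_right_injective _ (Nat.cast_ne_zero.mpr hn) h'

theorem mem_below_of_euler_mem {n : ℕ} {x : Sym 𝒱} (h : euler 𝒱 x ∈ below 𝒱 n)
    (h0 : counit 𝒱 x = 0) : x ∈ below 𝒱 n := by
  rw [mem_below] at h ⊢
  intro k hk
  rcases eq_or_ne k 0 with rfl | hk0
  · rw [wproj_zero, h0, zero_smul]
  · have := h k hk
    rw [wproj_euler] at this
    exact (smul_eq_zero.mp this).resolve_left (Nat.cast_ne_zero.mpr hk0)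

theorem mem_power_of_euler_mem {n : ℕ} {x : Sym 𝒱} (h : euler 𝒱 x ∈ power 𝒱 n)
    (h0 : counit 𝒱 x = 0) : x ∈ power 𝒱 n := by
  have : x = wproj 𝒱 n x := by
    refine ext_wproj fun k => ?_
    rcases eq_or_ne k n with rfl | hk
    · rw [wproj_of_mem_same (wproj_mem _ _)]
    rw [wproj_of_mem_ne (wproj_mem n x) hk.symm]
    rcases eq_or_ne k 0 with rfl | hk0
    · rw [wproj_zero, h0, zero_smul]
    have h' := wproj_euler k x
    rw [wproj_of_mem_ne h hk.symm] at h'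
    exact (smul_eq_zero.mp h'.symm).resolve_left (Nat.cast_ne_zero.mpr hk0)
  rw [this]
  exact wproj_mem _ _

end Weights

/-! ### Coalgebra axioms, graded cocommutativity and convolution. -/

section Coalgebra

variable [DirectSum.Decomposition 𝒱] [DirectSum.Decomposition 𝒲]

theorem sgn_mem_power (i : ℤ) {n : ℕ} {x : Sym 𝒱} (hx : x ∈ power 𝒱 n) :
    sgn 𝒱 i x ∈ power 𝒱 n := by
  refine power_le (fun n => (power 𝒱 n).comap (sgn 𝒱 i)) ?_ (fun n j v hv x hx => ?_) n hx
  · rw [Submodule.mem_comap, sgn_one]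
    exact one_mem_power
  · rw [Submodule.mem_comap, sgn_ι_mul i hv]
    exact Submodule.smul_mem _ _ (ι_mul_mem_power v hx)

theorem comul_sgn (i : ℤ) :
    comul 𝒱 ∘ₗ sgn 𝒱 i = TensorProduct.map (sgn 𝒱 i) (sgn 𝒱 i) ∘ₗ comul 𝒱 := by
  refine hom_ext ?_ fun j v hv x hx => ?_
  · simp [sgn_one, comul_one]
  · simp only [LinearMap.comp_apply] at hx ⊢
    rw [sgn_ι_mul i hv, map_smul, comul_ι_mul hv, comul_ι_mul hv, hx, map_add, smul_add]
    generalize comul 𝒱 x = z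
    induction z with
    | zero => simp
    | add x y hx hy => simp only [map_add, smul_add] at hx hy ⊢; rw [add_add_add_comm, hx, hy]; abel
    | tmul a b =>
      have h : sgn 𝒱 i (sgn 𝒱 j a) = sgn 𝒱 j (sgn 𝒱 i a) := by
        have := sgn_comm_of_hasDegree (F := sgn 𝒱 j) (fun d x hx => by
          rw [sgn_of_mem j hx, add_zero]; exact Submodule.smul_mem _ _ hx) i
        exact congr($this a)
      simp [sgn_ι_mul i hv, h, TensorProduct.smul_tmul']

theorem counit_sgn (i : ℤ) (x : Sym 𝒱) : counit 𝒱 (sgn 𝒱 i x) = counit 𝒱 x := by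
  have h : counit 𝒱 ∘ₗ sgn 𝒱 i = counit 𝒱 := by
    refine hom_ext (by simp [sgn_one]) fun j v hv x hx => ?_
    rw [LinearMap.comp_apply, sgn_ι_mul i hv, map_smul, counit_ι_mul, counit_ι_mul, smul_zero]
  exact congr($h x)

theorem coassoc : (TensorProduct.assoc K (Sym 𝒱) (Sym 𝒱) (Sym 𝒱)).toLinearMap ∘ₗ
    (comul 𝒱).rTensor (Sym 𝒱) ∘ₗ comul 𝒱 = (comul 𝒱).lTensor (Sym 𝒱) ∘ₗ comul 𝒱 := by
  refine hom_ext ?_ fun i v hv x hx => ?_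
  · simp [comul_one]
  · simp only [LinearMap.comp_apply, LinearEquiv.coe_coe] at hx ⊢
    let L := LinearMap.mulLeft K (ι 𝒱 v)
    -- `T` is multiplication by `v ⊗ 1 ⊗ 1 + 1 ⊗ v ⊗ 1 + 1 ⊗ 1 ⊗ v` with Koszul signs. Both iterated
    -- coproducts turn multiplication by `v` into `T`.
    let T := TensorProduct.map L (LinearMap.id : Sym 𝒱 ⊗[K] Sym 𝒱 →ₗ[K] _) +
      TensorProduct.map (sgn 𝒱 i) (TensorProduct.map L LinearMap.id) +
      TensorProduct.map (sgn 𝒱 i) (TensorProduct.map (sgn 𝒱 i) L)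
    have h1 : ∀ z, (TensorProduct.assoc K (Sym 𝒱) (Sym 𝒱) (Sym 𝒱))
        ((comul 𝒱).rTensor (Sym 𝒱) (TensorProduct.map L LinearMap.id z +
          TensorProduct.map (sgn 𝒱 i) L z)) =
        T (TensorProduct.assoc K (Sym 𝒱) (Sym 𝒱) (Sym 𝒱) ((comul 𝒱).rTensor (Sym 𝒱) z)) := by
      intro z
      induction z with
      | zero => simp
      | add x y hx hy => simp only [map_add] at hx hy ⊢; rw [← hx, ← hy]; abel
      | tmul a b =>
        have hs : comul 𝒱 (sgn 𝒱 i a) = _ := congr($(comul_sgn i) a)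
        simp only [map_add, TensorProduct.map_tmul, LinearMap.rTensor_tmul, hs,
          LinearMap.comp_apply, LinearMap.id_apply]
        rw [show comul 𝒱 (L a) = _ from comul_ι_mul hv a]
        generalize comul 𝒱 a = z
        induction z with
        | zero => simp
        | add x y hx hy =>
          simp only [map_add, TensorProduct.add_tmul] at hx hy ⊢; rw [← hx, ← hy]; abel
        | tmul c d => simp [T, TensorProduct.add_tmul, L]
    have h2 : ∀ z, ((comul 𝒱).lTensor (Sym 𝒱) (TensorProduct.map L LinearMap.id z +
          TensorProduct.map (sgn 𝒱 i) L z)) = T ((comul 𝒱).lTensor (Sym 𝒱) z) := by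
      intro z
      induction z with
      | zero => simp
      | add x y hx hy => simp only [map_add] at hx hy ⊢; rw [← hx, ← hy]; abel
      | tmul a b =>
        simp only [map_add, TensorProduct.map_tmul, LinearMap.lTensor_tmul, LinearMap.id_apply]
        rw [show comul 𝒱 (L b) = _ from comul_ι_mul hv b, TensorProduct.tmul_add]
        simp [T, add_assoc, L]
    rw [comul_ι_mul hv, h1, h2, hx]

theorem rTensor_counit_comp_comul :
    (counit 𝒱).rTensor (Sym 𝒱) ∘ₗ comul 𝒱 = TensorProduct.mk K K (Sym 𝒱) 1 := by
  refine hom_ext ?_ fun i v hv x hx => ?_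
  · simp [comul_one, counit_one]
  · simp only [LinearMap.comp_apply, TensorProduct.mk_apply] at hx ⊢
    have h : ∀ z, (counit 𝒱).rTensor (Sym 𝒱) (TensorProduct.map (LinearMap.mulLeft K (ι 𝒱 v))
        LinearMap.id z + TensorProduct.map (sgn 𝒱 i) (LinearMap.mulLeft K (ι 𝒱 v)) z) =
        (LinearMap.mulLeft K (ι 𝒱 v)).lTensor K ((counit 𝒱).rTensor (Sym 𝒱) z) := by
      intro z
      induction z with
      | zero => simp
      | add x y hx hy => simp only [map_add] at hx hy ⊢; rw [← hx, ← hy]; abel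
      | tmul a b => simp [counit_ι_mul, counit_sgn]
    rw [comul_ι_mul hv, h, hx]
    simp

theorem lTensor_counit_comp_comul :
    (counit 𝒱).lTensor (Sym 𝒱) ∘ₗ comul 𝒱 = (TensorProduct.mk K (Sym 𝒱) K).flip 1 := by
  refine hom_ext ?_ fun i v hv x hx => ?_
  · simp [comul_one, counit_one]
  · simp only [LinearMap.comp_apply, LinearMap.flip_apply, TensorProduct.mk_apply] at hx ⊢
    have h : ∀ z, (counit 𝒱).lTensor (Sym 𝒱) (TensorProduct.map (LinearMap.mulLeft K (ι 𝒱 v))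
        LinearMap.id z + TensorProduct.map (sgn 𝒱 i) (LinearMap.mulLeft K (ι 𝒱 v)) z) =
        (LinearMap.mulLeft K (ι 𝒱 v)).rTensor K ((counit 𝒱).lTensor (Sym 𝒱) z) := by
      intro z
      induction z with
      | zero => simp
      | add x y hx hy => simp only [map_add] at hx hy ⊢; rw [← hx, ← hy]; abel
      | tmul a b => simp [counit_ι_mul]
    rw [comul_ι_mul hv, h, hx]
    simp

instance : Coalgebra K (Sym 𝒱) where
  comul := comul 𝒱
  counit := counit 𝒱
  coassoc := coassoc
  rTensor_counit_comp_comul := rTensor_counit_comp_comul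
  lTensor_counit_comp_comul := lTensor_counit_comp_comul

theorem comm_includeLeft_ι (v : V) :
    GradedTensorProduct.comm (grading 𝒱) (grading 𝒱)
      (GradedTensorProduct.includeLeft (grading 𝒱) (grading 𝒱) (ι 𝒱 v)) =
    GradedTensorProduct.includeRight (grading 𝒱) (grading 𝒱) (ι 𝒱 v) := by
  induction v using DirectSum.Decomposition.inductionOn 𝒱 with
  | zero => simp only [map_zero]
  | add v w hv hw => simp only [map_add, hv, hw]
  | @homogeneous i v =>
    have h := GradedTensorProduct.comm_coe_tmul_coe (R := K) (grading 𝒱) (grading 𝒱)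
      ⟨ι 𝒱 v, ι_mem_grading v.2⟩ ⟨1, one_mem_grading⟩
    rw [zero_mul, uzpow_zero, one_smul] at h
    exact h

theorem comm_includeRight_ι (v : V) :
    GradedTensorProduct.comm (grading 𝒱) (grading 𝒱)
      (GradedTensorProduct.includeRight (grading 𝒱) (grading 𝒱) (ι 𝒱 v)) =
    GradedTensorProduct.includeLeft (grading 𝒱) (grading 𝒱) (ι 𝒱 v) := by
  induction v using DirectSum.Decomposition.inductionOn 𝒱 with
  | zero => simp only [map_zero]
  | add v w hv hw => simp only [map_add, hv, hw]
  | @homogeneous i v =>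
    have h := GradedTensorProduct.comm_coe_tmul_coe (R := K) (grading 𝒱) (grading 𝒱)
      ⟨1, one_mem_grading⟩ ⟨ι 𝒱 v, ι_mem_grading v.2⟩
    rw [mul_zero, uzpow_zero, one_smul] at h
    exact h

/-- Graded cocommutativity. -/
theorem comm_gradedComul (x : Sym 𝒱) :
    GradedTensorProduct.comm (grading 𝒱) (grading 𝒱) (gradedComul x) = gradedComul x := by
  have h : (GradedTensorProduct.comm (R := K) (grading 𝒱) (grading 𝒱)).toAlgHom.comp gradedComul =
      gradedComul (𝒱 := 𝒱) := by
    refine algHom_ext 𝒱 fun v => ?_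
    rw [AlgHom.comp_apply, gradedComul_ι, map_add]
    exact (congrArg₂ _ (comm_includeLeft_ι v) (comm_includeRight_ι v)).trans (add_comm _ _)
  exact congr($h x)

/-- Unshuffling preserves total weight, so the weight operator is a coderivation. -/
theorem comul_euler : comul 𝒱 ∘ₗ euler 𝒱 =
    (TensorProduct.map (euler 𝒱) LinearMap.id + TensorProduct.map LinearMap.id (euler 𝒱)) ∘ₗ
      comul 𝒱 := by
  refine hom_ext ?_ fun i v hv x hx => ?_
  · simp [comul_one, euler_one]
  · simp only [LinearMap.comp_apply] at hx ⊢
    rw [euler_ι_mul, map_add, comul_ι_mul hv, comul_ι_mul hv, hx]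
    generalize comul 𝒱 x = z
    induction z with
    | zero => simp
    | add x y hx hy => simp only [map_add] at hx hy ⊢; convert congrArg₂ (· + ·) hx hy using 1 <;> abel
    | tmul a b =>
      have h : euler 𝒱 (sgn 𝒱 i a) = sgn 𝒱 i (euler 𝒱 a) := by
        have : euler 𝒱 ∘ₗ sgn 𝒱 i = sgn 𝒱 i ∘ₗ euler 𝒱 := hom_ext_power fun n x hx => by
          rw [LinearMap.comp_apply, LinearMap.comp_apply, euler_of_mem hx,
            euler_of_mem (sgn_mem_power i hx), map_smul]
        exact congr($this a)
      simp only [TensorProduct.map_tmul, LinearMap.add_apply, LinearMap.id_apply, map_add,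
        LinearMap.mulLeft_apply, euler_ι_mul, h, TensorProduct.add_tmul, TensorProduct.tmul_add]
      abel

/-- The convolution product of linear maps. -/
def conv {A : Type*} [Ring A] [Algebra K A] (f g : Sym 𝒱 →ₗ[K] A) : Sym 𝒱 →ₗ[K] A :=
  LinearMap.mul' K A ∘ₗ TensorProduct.map f g ∘ₗ comul 𝒱

theorem conv_apply {A : Type*} [Ring A] [Algebra K A] (f g : Sym 𝒱 →ₗ[K] A) (x : Sym 𝒱) :
    conv f g x = LinearMap.mul' K A (TensorProduct.map f g (comul 𝒱 x)) := rfl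

theorem lid_map_counit {M : Type*} [AddCommGroup M] [Module K M] (f : Sym 𝒱 →ₗ[K] M)
    (x : Sym 𝒱) : TensorProduct.lid K M (TensorProduct.map (counit 𝒱) f (comul 𝒱 x)) = f x := by
  have h := congr(TensorProduct.lid K M (f.lTensor K ($(rTensor_counit_comp_comul) x)))
  simp only [LinearMap.comp_apply, TensorProduct.mk_apply, LinearMap.lTensor_tmul,
    TensorProduct.lid_tmul, one_smul] at h
  rw [← h, ← LinearMap.comp_apply (f.lTensor K), LinearMap.lTensor_comp_rTensor]

theorem rid_map_counit {M : Type*} [AddCommGroup M] [Module K M] (f : Sym 𝒱 →ₗ[K] M)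
    (x : Sym 𝒱) : TensorProduct.rid K M (TensorProduct.map f (counit 𝒱) (comul 𝒱 x)) = f x := by
  have h := congr(TensorProduct.rid K M (f.rTensor K ($(lTensor_counit_comp_comul) x)))
  simp only [LinearMap.comp_apply, LinearMap.flip_apply, TensorProduct.mk_apply,
    LinearMap.rTensor_tmul, TensorProduct.rid_tmul, one_smul] at h
  rw [← h, ← LinearMap.comp_apply (f.rTensor K), LinearMap.rTensor_comp_lTensor]

/-- Splitting one vector off a product of `n` vectors and multiplying it back gives the same
product, with the sign undone, once for each of the `n` choices. This identity is what lets a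
morphism or a coderivation be reconstructed from its Taylor coefficients. -/
theorem conv_proj_id : conv (ι 𝒱 ∘ₗ proj 𝒱) LinearMap.id = euler 𝒱 := by
  refine hom_ext ?_ fun i v hv x hx => ?_
  · simp [conv, comul_one, euler_one, proj_one]
  · rw [euler_ι_mul, ← hx, conv_apply, conv_apply, comul_ι_mul hv]
    have h : ∀ z, LinearMap.mul' K (Sym 𝒱) (TensorProduct.map (ι 𝒱 ∘ₗ proj 𝒱) LinearMap.id
        (TensorProduct.map (LinearMap.mulLeft K (ι 𝒱 v)) LinearMap.id z +
          TensorProduct.map (sgn 𝒱 i) (LinearMap.mulLeft K (ι 𝒱 v)) z)) =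
        ι 𝒱 v * TensorProduct.lid K _ (TensorProduct.map (counit 𝒱) LinearMap.id z) +
        ι 𝒱 v * LinearMap.mul' K (Sym 𝒱) (TensorProduct.map (ι 𝒱 ∘ₗ proj 𝒱) LinearMap.id z) := by
      intro z
      induction z with
      | zero => simp
      | add x y hx hy => simp only [map_add, mul_add] at hx hy ⊢; convert congrArg₂ (· + ·) hx hy using 1 <;> abel
      | tmul a b =>
        have hs : ι 𝒱 (proj 𝒱 (sgn 𝒱 i a)) = sgn 𝒱 i (ι 𝒱 (proj 𝒱 a)) := by
          rw [← wproj_one, ← wproj_one]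
          have : wproj 𝒱 1 ∘ₗ sgn 𝒱 i = sgn 𝒱 i ∘ₗ wproj 𝒱 1 := hom_ext_power fun n x hx => by
            rw [LinearMap.comp_apply, LinearMap.comp_apply, wproj_of_mem hx,
              wproj_of_mem (sgn_mem_power i hx)]
            split_ifs <;> simp
          exact congr($this a)
        simp only [map_add, TensorProduct.map_tmul, LinearMap.mul'_apply, LinearMap.comp_apply,
          LinearMap.mulLeft_apply, LinearMap.id_apply, proj_ι_mul, map_smul, hs,
          TensorProduct.lid_tmul, smul_mul_assoc, mul_smul_comm]
        -- Graded commutativity absorbs the sign operator when `v` is moved back to the front.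
        rw [← mul_assoc, ← ι_mul_eq_mul_ι hv, mul_assoc]
    rw [h, lid_map_counit, LinearMap.id_apply]

end Coalgebra

end Sym

end LInfty

namespace LInfty

namespace Sym

variable {K V W U : Type*} [Field K] [AddCommGroup V] [Module K V] [AddCommGroup W] [Module K W]
  [AddCommGroup U] [Module K U]
variable {𝒱 : ℤ → Submodule K V} {𝒲 : ℤ → Submodule K W} {𝒰 : ℤ → Submodule K U}
variable [DirectSum.Decomposition 𝒱] [DirectSum.Decomposition 𝒲] [DirectSum.Decomposition 𝒰]

/-! ### The coproduct respects weight and degree. -/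

section Support

variable {M : Type*} [AddCommGroup M] [Module K M]

/-- By the recursion for the coproduct, `Δ x` is a sum of tensors whose weights add up to that of
`x`, so only such tensors need testing. -/
theorem comul_mem_of_power {P : Submodule K M} (B : Sym 𝒱 ⊗[K] Sym 𝒱 →ₗ[K] M) {n : ℕ}
    (h : ∀ i j : ℕ, i + j = n → ∀ a ∈ power 𝒱 i, ∀ b ∈ power 𝒱 j, B (a ⊗ₜ b) ∈ P)
    {x : Sym 𝒱} (hx : x ∈ power 𝒱 n) : B (comul 𝒱 x) ∈ P := by
  let S : ℕ → Set (Sym 𝒱 ⊗[K] Sym 𝒱) := fun n =>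
    {z | ∃ i j : ℕ, i + j = n ∧ ∃ a ∈ power 𝒱 i, ∃ b ∈ power 𝒱 j, a ⊗ₜ b = z}
  have key : x ∈ (Submodule.span K (S n)).comap (comul 𝒱) := by
    refine power_le (fun n => (Submodule.span K (S n)).comap (comul 𝒱)) ?_
      (fun n k v hv x hx => ?_) n hx
    · rw [Submodule.mem_comap, comul_one]
      exact Submodule.subset_span ⟨0, 0, rfl, 1, one_mem_power, 1, one_mem_power, rfl⟩
    · rw [Submodule.mem_comap] at hx ⊢
      rw [comul_ι_mul hv]
      refine add_mem ?_ ?_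
      · refine (Submodule.map_span_le _ _ _).mpr ?_ (Submodule.mem_map_of_mem hx)
        rintro _ ⟨i, j, rfl, a, ha, b, hb, rfl⟩
        exact Submodule.subset_span ⟨i + 1, j, by omega, _, ι_mul_mem_power v ha, b, hb, rfl⟩
      · refine (Submodule.map_span_le _ _ _).mpr ?_ (Submodule.mem_map_of_mem hx)
        rintro _ ⟨i, j, rfl, a, ha, b, hb, rfl⟩
        exact Submodule.subset_span
          ⟨i, j + 1, by omega, _, sgn_mem_power k ha, _, ι_mul_mem_power v hb, rfl⟩
  refine (Submodule.map_span_le _ _ _).mpr ?_ (Submodule.mem_map_of_mem key)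
  rintro _ ⟨i, j, hij, a, ha, b, hb, rfl⟩
  exact h i j hij a ha b hb

/-- The coproduct of `V^{⊙n}` lies in the sum of the `V^{⊙i} ⊗ V^{⊙j}` with `i + j = n`. -/
theorem comul_eq_of_power {B B' : Sym 𝒱 ⊗[K] Sym 𝒱 →ₗ[K] M} {n : ℕ}
    (h : ∀ i j : ℕ, i + j = n → ∀ a ∈ power 𝒱 i, ∀ b ∈ power 𝒱 j, B (a ⊗ₜ b) = B' (a ⊗ₜ b))
    {x : Sym 𝒱} (hx : x ∈ power 𝒱 n) : B (comul 𝒱 x) = B' (comul 𝒱 x) := by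
  have := comul_mem_of_power (P := ⊥) (B - B') (fun i j hij a ha b hb => by
    rw [Submodule.mem_bot, LinearMap.sub_apply, h i j hij a ha b hb, sub_self]) hx
  rwa [Submodule.mem_bot, LinearMap.sub_apply, sub_eq_zero] at this

theorem comul_mem_of_grading {P : Submodule K M} (B : Sym 𝒱 ⊗[K] Sym 𝒱 →ₗ[K] M) {d : ℤ}
    (h : ∀ i j : ℤ, i + j = d → ∀ a ∈ grading 𝒱 i, ∀ b ∈ grading 𝒱 j, B (a ⊗ₜ b) ∈ P)
    {x : Sym 𝒱} (hx : x ∈ grading 𝒱 d) : B (comul 𝒱 x) ∈ P := by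
  let S : ℤ → Set (Sym 𝒱 ⊗[K] Sym 𝒱) := fun n =>
    {z | ∃ i j : ℤ, i + j = n ∧ ∃ a ∈ grading 𝒱 i, ∃ b ∈ grading 𝒱 j, a ⊗ₜ b = z}
  have key : x ∈ (Submodule.span K (S d)).comap (comul 𝒱) := by
    refine grading_le (fun n => (Submodule.span K (S n)).comap (comul 𝒱)) ?_
      (fun d k v hv x hx => ?_) d hx
    · rw [Submodule.mem_comap, comul_one]
      exact Submodule.subset_span ⟨0, 0, rfl, 1, one_mem_grading, 1, one_mem_grading, rfl⟩
    · rw [Submodule.mem_comap] at hx ⊢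
      rw [comul_ι_mul hv]
      refine add_mem ?_ ?_
      · refine (Submodule.map_span_le _ _ _).mpr ?_ (Submodule.mem_map_of_mem hx)
        rintro _ ⟨i, j, rfl, a, ha, b, hb, rfl⟩
        exact Submodule.subset_span ⟨k + i, j, by omega, _, ι_mul_mem_grading hv ha, b, hb, rfl⟩
      · refine (Submodule.map_span_le _ _ _).mpr ?_ (Submodule.mem_map_of_mem hx)
        rintro _ ⟨i, j, rfl, a, ha, b, hb, rfl⟩
        refine Submodule.subset_span
          ⟨i, k + j, by omega, _, ?_, _, ι_mul_mem_grading hv hb, rfl⟩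
        rw [sgn_of_mem k ha]
        exact Submodule.smul_mem _ _ ha
  refine (Submodule.map_span_le _ _ _).mpr ?_ (Submodule.mem_map_of_mem key)
  rintro _ ⟨i, j, hij, a, ha, b, hb, rfl⟩
  exact h i j hij a ha b hb

end Support

/-! ### Coalgebra morphisms, coderivations along them, and their determination by Taylor
coefficients. -/

section CoalgHom

theorem IsCoalgHom.comp {F : Sym 𝒱 →ₗ[K] Sym 𝒲} {F' : Sym 𝒲 →ₗ[K] Sym 𝒰}
    (hF' : IsCoalgHom 𝒲 𝒰 F') (hF : IsCoalgHom 𝒱 𝒲 F) : IsCoalgHom 𝒱 𝒰 (F' ∘ₗ F) where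
  degree d x hx := by
    have h := hF'.degree _ _ (hF.degree d x hx)
    rwa [add_zero] at h
  comul_comp := by
    rw [← LinearMap.comp_assoc, hF'.comul_comp, LinearMap.comp_assoc, hF.comul_comp,
      ← LinearMap.comp_assoc, ← TensorProduct.map_comp]
  counit_comp := by rw [← LinearMap.comp_assoc, hF'.counit_comp, hF.counit_comp]
  map_one := by rw [LinearMap.comp_apply, hF.map_one, hF'.map_one]

theorem isCoalgHom_map (f : V →ₗ[K] W) (hf : HasDegree 𝒱 𝒲 0 f) :
    IsCoalgHom 𝒱 𝒲 (map f hf).toLinearMap where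
  degree := map_hasDegree f hf
  comul_comp := by
    refine hom_ext ?_ fun i v hv x hx => ?_
    · simp [comul_one]
    · have hv' := hf i v hv
      rw [add_zero] at hv'
      simp only [LinearMap.comp_apply, AlgHom.toLinearMap_apply] at hx ⊢
      rw [map_mul, map_ι, comul_ι_mul hv', comul_ι_mul hv, hx]
      generalize comul 𝒱 x = z
      induction z with
      | zero => simp
      | add x y hx hy =>
        simp only [map_add] at hx hy ⊢; convert congrArg₂ (· + ·) hx hy using 1 <;> abel
      | tmul a b =>
        have hs := congr($(sgn_comm_of_hasDegree (map_hasDegree f hf) i) a)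
        simp only [LinearMap.comp_apply, AlgHom.toLinearMap_apply] at hs
        simp [hs]
  counit_comp := by
    refine hom_ext (by simp [counit_one]) fun i v hv x hx => ?_
    simp [counit_ι_mul]
  map_one := by simp

/-- Composing `conv_proj_id` with `F` and replacing `Δ F` by `B Δ` gives a recursion: the left
tensor factor enters only through a Taylor coefficient, the right one through values in smaller or
equal weight. -/
theorem euler_comp_of_comul {F : Sym 𝒱 →ₗ[K] Sym 𝒲} {B : Sym 𝒱 ⊗[K] Sym 𝒱 →ₗ[K] Sym 𝒲 ⊗[K] Sym 𝒲}
    (h : comul 𝒲 ∘ₗ F = B ∘ₗ comul 𝒱) : euler 𝒲 ∘ₗ F =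
      LinearMap.mul' K (Sym 𝒲) ∘ₗ (TensorProduct.map (ι 𝒲 ∘ₗ proj 𝒲) LinearMap.id ∘ₗ B) ∘ₗ
        comul 𝒱 := by
  rw [← conv_proj_id, conv, LinearMap.comp_assoc, LinearMap.comp_assoc, h, LinearMap.comp_assoc]

theorem IsCoalgHom.euler_comp {F : Sym 𝒱 →ₗ[K] Sym 𝒲} (hF : IsCoalgHom 𝒱 𝒲 F) :
    euler 𝒲 ∘ₗ F = conv (ι 𝒲 ∘ₗ proj 𝒲 ∘ₗ F) F := by
  rw [euler_comp_of_comul hF.comul_comp, ← TensorProduct.map_comp]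
  rfl

theorem IsCoalgHom.proj_one {F : Sym 𝒱 →ₗ[K] Sym 𝒲} (hF : IsCoalgHom 𝒱 𝒲 F) :
    proj 𝒲 (F 1) = 0 := by rw [hF.map_one, Sym.proj_one]

/-- A coderivation along the pair `(F, F')`: `Δ D = (D ⊗ F + F' ⊗ D) Δ`. -/
def IsCoderAlong (F F' D : Sym 𝒱 →ₗ[K] Sym 𝒲) : Prop :=
  comul 𝒲 ∘ₗ D = (TensorProduct.map D F + TensorProduct.map F' D) ∘ₗ comul 𝒱

namespace IsCoderAlong

variable {F F' D : Sym 𝒱 →ₗ[K] Sym 𝒲}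

theorem euler_comp (hD : IsCoderAlong F F' D) : euler 𝒲 ∘ₗ D =
    conv (ι 𝒲 ∘ₗ proj 𝒲 ∘ₗ D) F + conv (ι 𝒲 ∘ₗ proj 𝒲 ∘ₗ F') D := by
  rw [euler_comp_of_comul hD, LinearMap.comp_add, ← TensorProduct.map_comp,
    ← TensorProduct.map_comp, LinearMap.add_comp, LinearMap.comp_add]
  rfl

/-- Applying `ε ⊗ ε` to the coderivation rule gives `ε D = ε D + ε D`. -/
theorem counit_comp (hD : IsCoderAlong F F' D) (hF : counit 𝒲 ∘ₗ F = counit 𝒱)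
    (hF' : counit 𝒲 ∘ₗ F' = counit 𝒱) (x : Sym 𝒱) : counit 𝒲 (D x) = 0 := by
  have h := lid_map_counit (counit 𝒲) (D x)
  rw [← LinearMap.comp_apply (comul 𝒲), hD, LinearMap.comp_apply, LinearMap.add_apply, map_add,
    map_add, TensorProduct.map_map, TensorProduct.map_map, hF, hF', lid_map_counit] at h
  have h' := rid_map_counit (counit 𝒲 ∘ₗ D) x
  rw [← LinearMap.comp_apply (counit 𝒲) D, ← h']
  have hlr : (TensorProduct.rid K K : K ⊗[K] K ≃ₗ[K] K) = TensorProduct.lid K K :=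
    LinearEquiv.toLinearMap_injective (TensorProduct.ext' fun a b => by simp [mul_comm])
  rw [hlr]
  simpa using h

theorem sub {D' : Sym 𝒱 →ₗ[K] Sym 𝒲} (hD : IsCoderAlong F F' D) (hD' : IsCoderAlong F F' D') :
    IsCoderAlong F F' (D - D') := by
  unfold IsCoderAlong at *
  rw [LinearMap.comp_sub, hD, hD', ← LinearMap.sub_comp]
  congr 1
  rw [sub_eq_add_neg D, TensorProduct.map_add_left, TensorProduct.map_add_right,
    ← neg_one_smul K D', TensorProduct.map_smul_left, TensorProduct.map_smul_right]
  module

variable [CharZero K]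

/-- If `D` vanishes in lower weights, then of all splittings in the recursion for `euler ∘ D` only
`D x ⊗ 1` survives; `1 ⊗ D x` drops out because `F'` fixes `1` and `proj 𝒲 1 = 0`. The first nonzero
value of a coderivation is thus its Taylor coefficient. -/
theorem eq_ι_proj (hD : IsCoderAlong F F' D) (hF : counit 𝒲 ∘ₗ F = counit 𝒱)
    (hF' : counit 𝒲 ∘ₗ F' = counit 𝒱) (hF1 : F 1 = 1) (hF1' : F' 1 = 1) {n : ℕ}
    (h : ∀ k < n, ∀ x ∈ power 𝒱 k, D x = 0) {x : Sym 𝒱} (hx : x ∈ power 𝒱 n) :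
    D x = ι 𝒲 (proj 𝒲 (D x)) := by
  refine eq_of_euler_eq ?_ (by rw [hD.counit_comp hF hF', counit_ι])
  rw [euler_ι, ← LinearMap.comp_apply (euler 𝒲), hD.euler_comp]
  have h' := rid_map_counit (ι 𝒲 ∘ₗ proj 𝒲 ∘ₗ D) x
  refine Eq.trans ?_ h'
  simp only [LinearMap.add_apply, conv_apply]
  refine comul_eq_of_power
    (B := LinearMap.mul' K (Sym 𝒲) ∘ₗ TensorProduct.map (ι 𝒲 ∘ₗ proj 𝒲 ∘ₗ D) F +
      LinearMap.mul' K (Sym 𝒲) ∘ₗ TensorProduct.map (ι 𝒲 ∘ₗ proj 𝒲 ∘ₗ F') D)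
    (B' := (TensorProduct.rid K (Sym 𝒲)).toLinearMap ∘ₗ
      TensorProduct.map (ι 𝒲 ∘ₗ proj 𝒲 ∘ₗ D) (counit 𝒱)) (fun i j hij a ha b hb => ?_) hx
  simp only [LinearMap.add_apply, LinearMap.comp_apply, TensorProduct.map_tmul,
    LinearMap.mul'_apply, LinearEquiv.coe_coe, TensorProduct.rid_tmul]
  have h2 : ι 𝒲 (proj 𝒲 (F' a)) * D b = 0 := by
    rcases eq_or_ne i 0 with rfl | hi
    · obtain ⟨c, rfl⟩ := mem_power_zero ha
      rw [map_smul, hF1', map_smul, Sym.proj_one, smul_zero, map_zero, zero_mul]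
    · rw [h j (by omega) b hb, mul_zero]
  rw [h2, add_zero]
  rcases eq_or_ne j 0 with rfl | hj
  · obtain ⟨c, rfl⟩ := mem_power_zero hb
    simp [hF1, counit_one]
  · rw [h i (by omega) a ha]
    simp

theorem eq_zero (hD : IsCoderAlong F F' D) (hF : counit 𝒲 ∘ₗ F = counit 𝒱)
    (hF' : counit 𝒲 ∘ₗ F' = counit 𝒱) (hF1 : F 1 = 1) (hF1' : F' 1 = 1) {n : ℕ}
    (h : ∀ k < n, ∀ x ∈ power 𝒱 k, proj 𝒲 (D x) = 0) : ∀ k < n, ∀ x ∈ power 𝒱 k, D x = 0 := by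
  intro k
  induction k using Nat.strong_induction_on with
  | _ k ih =>
    intro hk x hx
    rw [hD.eq_ι_proj hF hF' hF1 hF1' (fun m hm => ih m hm (hm.trans hk)) hx, h k hk x hx, map_zero]

theorem eq_zero_of_proj (hD : IsCoderAlong F F' D) (hF : counit 𝒲 ∘ₗ F = counit 𝒱)
    (hF' : counit 𝒲 ∘ₗ F' = counit 𝒱) (hF1 : F 1 = 1) (hF1' : F' 1 = 1)
    (h : proj 𝒲 ∘ₗ D = 0) : D = 0 :=
  hom_ext_power fun n x hx => hD.eq_zero hF hF' hF1 hF1' (n := n + 1)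
    (fun _ _ x _ => congr($h x)) n (Nat.lt_succ_self n) x hx

/-- A coderivation whose Taylor coefficients of order `0` and `1` vanish lowers the weight. -/
theorem mem_below (hD : IsCoderAlong F F' D) (hF : counit 𝒲 ∘ₗ F = counit 𝒱)
    (hF' : counit 𝒲 ∘ₗ F' = counit 𝒱) (hF1' : F' 1 = 1)
    (hFb : ∀ n, ∀ x ∈ power 𝒱 n, F x ∈ below 𝒲 (n + 1))
    (h : ∀ k < 2, ∀ x ∈ power 𝒱 k, proj 𝒲 (D x) = 0) {n : ℕ} {x : Sym 𝒱} (hx : x ∈ power 𝒱 n) :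
    D x ∈ below 𝒲 n := by
  induction n using Nat.strong_induction_on generalizing x with
  | _ n ih =>
    refine mem_below_of_euler_mem ?_ (hD.counit_comp hF hF' x)
    rw [← LinearMap.comp_apply (euler 𝒲), hD.euler_comp]
    refine comul_mem_of_power
      (LinearMap.mul' K (Sym 𝒲) ∘ₗ TensorProduct.map (ι 𝒲 ∘ₗ proj 𝒲 ∘ₗ D) F +
        LinearMap.mul' K (Sym 𝒲) ∘ₗ TensorProduct.map (ι 𝒲 ∘ₗ proj 𝒲 ∘ₗ F') D)
      (fun i j hij a ha b hb => ?_) hx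
    simp only [LinearMap.add_apply, LinearMap.comp_apply, TensorProduct.map_tmul,
      LinearMap.mul'_apply]
    refine add_mem ?_ ?_
    -- A Taylor coefficient of order at least two consumes two or more vectors and returns one,
    -- which is where weight is lost.
    · by_cases hi : i < 2
      · rw [h i hi a ha, map_zero, zero_mul]
        exact zero_mem _
      · exact below_mono (by omega) (ι_mul_mem_below _ (hFb j b hb))
    · rcases eq_or_ne i 0 with rfl | hi
      · obtain ⟨c, rfl⟩ := mem_power_zero ha
        rw [map_smul, hF1', map_smul, Sym.proj_one, smul_zero, map_zero, zero_mul]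
        exact zero_mem _
      · exact below_mono (by omega) (ι_mul_mem_below _ (ih j (by omega) hb))

end IsCoderAlong

namespace IsCoalgHom

variable {F F' : Sym 𝒱 →ₗ[K] Sym 𝒲}

/-- `F' ⊗ F' - F ⊗ F = (F' - F) ⊗ F' + F ⊗ (F' - F)`. Everything proved for coderivations along a
pair thereby applies to differences of morphisms. -/
theorem isCoderAlong_sub (hF' : IsCoalgHom 𝒱 𝒲 F') (hF : IsCoalgHom 𝒱 𝒲 F) :
    IsCoderAlong F' F (F' - F) := by
  rw [IsCoderAlong, LinearMap.comp_sub, hF.comul_comp, hF'.comul_comp, ← LinearMap.sub_comp]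
  congr 1
  rw [sub_eq_add_neg F', TensorProduct.map_add_left, TensorProduct.map_add_right,
    ← neg_one_smul K F, TensorProduct.map_smul_left, TensorProduct.map_smul_right]
  module

variable [CharZero K]

theorem ext_proj (hF' : IsCoalgHom 𝒱 𝒲 F') (hF : IsCoalgHom 𝒱 𝒲 F)
    (h : proj 𝒲 ∘ₗ F' = proj 𝒲 ∘ₗ F) : F' = F := by
  rw [← sub_eq_zero]
  refine (hF'.isCoderAlong_sub hF).eq_zero_of_proj hF'.counit_comp hF.counit_comp hF'.map_one
    hF.map_one ?_
  rw [LinearMap.comp_sub, h, sub_self]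

theorem map_mem_below (hF : IsCoalgHom 𝒱 𝒲 F) {n : ℕ} {x : Sym 𝒱} (hx : x ∈ power 𝒱 n) :
    F x ∈ below 𝒲 (n + 1) := by
  induction n using Nat.strong_induction_on generalizing x with
  | _ n ih =>
    rcases eq_or_ne n 0 with rfl | hn
    · obtain ⟨c, rfl⟩ := mem_power_zero hx
      rw [map_smul, hF.map_one]
      exact Submodule.smul_mem _ _ (power_le_below (Nat.lt_succ_self 0) one_mem_power)
    refine mem_below_of_euler_mem ?_ ?_
    · rw [← LinearMap.comp_apply (euler 𝒲), hF.euler_comp]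
      refine comul_mem_of_power
        (LinearMap.mul' K (Sym 𝒲) ∘ₗ TensorProduct.map (ι 𝒲 ∘ₗ proj 𝒲 ∘ₗ F) F)
        (fun i j hij a ha b hb => ?_) hx
      simp only [LinearMap.comp_apply, TensorProduct.map_tmul, LinearMap.mul'_apply]
      rcases eq_or_ne i 0 with rfl | hi
      · obtain ⟨c, rfl⟩ := mem_power_zero ha
        rw [map_smul, hF.map_one, map_smul, Sym.proj_one, smul_zero, map_zero, zero_mul]
        exact zero_mem _
      · exact below_mono (by omega) (ι_mul_mem_below _ (ih j (by omega) hb))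
    · rw [← LinearMap.comp_apply, hF.counit_comp, counit_of_mem_power hn hx]

theorem map_ι (hF : IsCoalgHom 𝒱 𝒲 F) (v : V) : F (ι 𝒱 v) = ι 𝒲 (proj 𝒲 (F (ι 𝒱 v))) := by
  -- The morphism induced by the zero map serves as reference: it agrees with `F` in weight zero and
  -- vanishes in weight one, so `eq_ι_proj` applied to the difference computes `F` on `V`.
  have h0 : HasDegree 𝒱 𝒲 0 (0 : V →ₗ[K] W) := fun i v _ => zero_mem _
  have h := (hF.isCoderAlong_sub (isCoalgHom_map _ h0)).eq_ι_proj hF.counit_comp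
    (isCoalgHom_map _ h0).counit_comp hF.map_one (isCoalgHom_map _ h0).map_one (n := 1)
    (fun k hk x hx => by
      obtain rfl : k = 0 := by omega
      obtain ⟨c, rfl⟩ := mem_power_zero hx
      rw [LinearMap.map_smul, LinearMap.sub_apply, hF.map_one, (isCoalgHom_map _ h0).map_one,
        sub_self, smul_zero]) (ι_mem_power v)
  simpa using h

end IsCoalgHom

end CoalgHom

end Sym

end LInfty

namespace LInfty

namespace Sym

variable {K V W : Type*} [Field K] [AddCommGroup V] [Module K V] [AddCommGroup W] [Module K W]
variable {𝒱 : ℤ → Submodule K V} {𝒲 : ℤ → Submodule K W}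
variable [DirectSum.Decomposition 𝒱] [DirectSum.Decomposition 𝒲]

/-! ### Convolution powers of a Taylor coefficient and their coproduct. -/

section ConvolutionPowers

instance : SMulCommClass K (GradedTensorProduct K (grading 𝒲) (grading 𝒲))
    (GradedTensorProduct K (grading 𝒲) (grading 𝒲)) :=
  Algebra.to_smulCommClass

instance : IsScalarTower K (GradedTensorProduct K (grading 𝒲) (grading 𝒲))
    (GradedTensorProduct K (grading 𝒲) (grading 𝒲)) :=
  IsScalarTower.right

theorem comp_conv_pow {A B : Type*} [Ring A] [Algebra K A] [Ring B] [Algebra K B] (h : A →ₐ[K] B)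
    (f : Sym 𝒱 →ₗ[K] A) (k : ℕ) :
    h.toLinearMap ∘ₗ (WithConv.toConv f ^ k).ofConv =
      (WithConv.toConv (h.toLinearMap ∘ₗ f) ^ k).ofConv := by
  induction k with
  | zero =>
    ext x
    simp [LinearMap.convOne_def]
  | succ k ih =>
    rw [pow_succ, LinearMap.algHom_comp_convMul_distrib, ih, pow_succ]

theorem conv_pow_succ_apply {A : Type*} [Ring A] [Algebra K A] (f : Sym 𝒱 →ₗ[K] A) (k : ℕ)
    (x : Sym 𝒱) : (WithConv.toConv f ^ (k + 1)).ofConv x =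
      (LinearMap.mul' K A ∘ₗ TensorProduct.map f (WithConv.toConv f ^ k).ofConv) (comul 𝒱 x) := by
  rw [pow_succ']
  rfl

theorem conv_pow_zero_apply {A : Type*} [Ring A] [Algebra K A] (f : Sym 𝒱 →ₗ[K] A)
    (x : Sym 𝒱) : (WithConv.toConv f ^ 0).ofConv x = counit 𝒱 x • 1 := by
  rw [pow_zero, ← Algebra.algebraMap_eq_smul_one]
  rfl

variable {f : Sym 𝒱 →ₗ[K] W}

theorem conv_pow_mem_grading (hf : HasDegree (grading 𝒱) 𝒲 0 f) (k : ℕ) {d : ℤ} {x : Sym 𝒱}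
    (hx : x ∈ grading 𝒱 d) : (WithConv.toConv (ι 𝒲 ∘ₗ f) ^ k).ofConv x ∈ grading 𝒲 d := by
  induction k generalizing d x with
  | zero =>
    rw [conv_pow_zero_apply]
    have h : grading 𝒱 d ≤ (grading 𝒲 d).comap ((counit 𝒱).smulRight 1) := by
      refine grading_le (fun d => (grading 𝒲 d).comap ((counit 𝒱).smulRight 1)) ?_
        (fun d i v hv x _ => ?_) d
      · simpa [counit_one] using one_mem_grading
      · simp [counit_ι_mul]
    exact h hx
  | succ k ih =>
    rw [conv_pow_succ_apply]
    refine comul_mem_of_grading _ (fun i j hij a ha b hb => ?_) hx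
    have h := hf i a ha
    rw [add_zero] at h
    rw [← hij]
    exact ι_mul_mem_grading h (ih hb)

theorem conv_pow_mem_power (k : ℕ) (x : Sym 𝒱) :
    (WithConv.toConv (ι 𝒲 ∘ₗ f) ^ k).ofConv x ∈ power 𝒲 k := by
  induction k generalizing x with
  | zero =>
    rw [conv_pow_zero_apply]
    exact Submodule.smul_mem _ _ one_mem_power
  | succ k ih =>
    rw [conv_pow_succ_apply]
    generalize comul 𝒱 x = z
    induction z with
    | zero => simp
    | add x y hx hy => rw [map_add]; exact add_mem hx hy
    | tmul a b => exact ι_mul_mem_power _ (ih b)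

/-- Each of the `k` factors must receive at least one vector, since `f` kills `1`. -/
theorem conv_pow_eq_zero (hf : f 1 = 0) {k n : ℕ} (h : n < k) {x : Sym 𝒱} (hx : x ∈ power 𝒱 n) :
    (WithConv.toConv (ι 𝒲 ∘ₗ f) ^ k).ofConv x = 0 := by
  induction k generalizing n x with
  | zero => omega
  | succ k ih =>
    rw [conv_pow_succ_apply, ← Submodule.mem_bot K]
    refine comul_mem_of_power _ (fun i j hij a ha b hb => ?_) hx
    rw [Submodule.mem_bot, LinearMap.comp_apply, TensorProduct.map_tmul, LinearMap.mul'_apply]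
    rcases eq_or_ne i 0 with rfl | hi
    · obtain ⟨c, rfl⟩ := mem_power_zero ha
      rw [map_smul, LinearMap.comp_apply, hf, map_zero, smul_zero, zero_mul]
    · rw [ih (by omega) hb, mul_zero]

/-- In the graded tensor product `f a ⊗ 1` and `1 ⊗ f b` commute up to a Koszul sign. Graded
cocommutativity of `Δ` produces the same sign when the arguments are swapped, because `f` has degree
`0`, so the two convolution elements commute exactly. -/
theorem commute_includeLeft_includeRight (hf : HasDegree (grading 𝒱) 𝒲 0 f) :
    Commute
      (WithConv.toConv ((GradedTensorProduct.includeLeft (grading 𝒲) (grading 𝒲)).toLinearMap ∘ₗ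
        ι 𝒲 ∘ₗ f) : WithConv (Sym 𝒱 →ₗ[K] GradedTensorProduct K (grading 𝒲) (grading 𝒲)))
      (WithConv.toConv ((GradedTensorProduct.includeRight (grading 𝒲) (grading 𝒲)).toLinearMap ∘ₗ
        ι 𝒲 ∘ₗ f)) := by
  let L := (GradedTensorProduct.includeLeft (R := K) (grading 𝒲) (grading 𝒲)).toLinearMap ∘ₗ
    ι 𝒲 ∘ₗ f
  let R := (GradedTensorProduct.includeRight (R := K) (grading 𝒲) (grading 𝒲)).toLinearMap ∘ₗ
    ι 𝒲 ∘ₗ f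
  let B : Sym 𝒱 ⊗[K] Sym 𝒱 →ₗ[K] GradedTensorProduct K (grading 𝒲) (grading 𝒲) :=
    LinearMap.mul' K _ ∘ₗ TensorProduct.map L R ∘ₗ
    (GradedTensorProduct.of K (grading 𝒱) (grading 𝒱)).symm.toLinearMap ∘ₗ
    (GradedTensorProduct.comm (R := K) (grading 𝒱) (grading 𝒱)).toLinearMap ∘ₗ
    (GradedTensorProduct.of K (grading 𝒱) (grading 𝒱)).toLinearMap
  let B' : Sym 𝒱 ⊗[K] Sym 𝒱 →ₗ[K] GradedTensorProduct K (grading 𝒲) (grading 𝒲) :=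
    LinearMap.mul' K _ ∘ₗ TensorProduct.map R L
  have key : B ∘ₗ comul 𝒱 = B' ∘ₗ comul 𝒱 := by
    refine hom_ext_grading fun d x hx => ?_
    rw [← sub_eq_zero, ← Submodule.mem_bot K]
    refine comul_mem_of_grading (B - B') (fun i j hij a ha b hb => ?_) hx
    rw [Submodule.mem_bot, LinearMap.sub_apply, sub_eq_zero]
    have ha' := ι_mem_grading (hf i a ha)
    have hb' := ι_mem_grading (hf j b hb)
    rw [add_zero] at ha' hb'
    have h1 := GradedTensorProduct.comm_coe_tmul_coe (R := K) (grading 𝒱) (grading 𝒱)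
      ⟨a, ha⟩ ⟨b, hb⟩
    have h2 := GradedTensorProduct.tmul_coe_mul_coe_tmul (R := K) (grading 𝒲) (grading 𝒲) 1
      ⟨_, ha'⟩ ⟨_, hb'⟩ 1
    have h3 := GradedTensorProduct.tmul_one_mul_one_tmul (R := K) (grading 𝒲) (grading 𝒲)
      (ι 𝒲 (f b)) (ι 𝒲 (f a))
    have h4 : B (a ⊗ₜ b) = LinearMap.mul' K _ (TensorProduct.map L R
        ((GradedTensorProduct.of K (grading 𝒱) (grading 𝒱)).symm
        ((GradedTensorProduct.comm (R := K) (grading 𝒱) (grading 𝒱))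
          (GradedTensorProduct.tmul K a b)))) := rfl
    rw [h4, h1, Units.smul_def, map_zsmul, map_zsmul, map_zsmul,
      GradedTensorProduct.of_symm_of, TensorProduct.map_tmul, LinearMap.mul'_apply]
    rw [one_mul, mul_one, mul_comm] at h2
    refine Eq.trans ?_ h2.symm
    rw [← h3]
    rfl
  refine WithConv.ofConv_injective (LinearMap.ext fun x => ?_)
  have h1 := congr($key x)
  have h2 : (B ∘ₗ comul 𝒱) x = LinearMap.mul' K _ (TensorProduct.map L R (comul 𝒱 x)) := by
    change LinearMap.mul' K _ (TensorProduct.map L R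
      ((GradedTensorProduct.of K (grading 𝒱) (grading 𝒱)).symm
        (GradedTensorProduct.comm (R := K) (grading 𝒱) (grading 𝒱) (gradedComul x)))) = _
    rw [comm_gradedComul]
    rfl
  rw [h2] at h1
  exact h1

/-- `Δ` is an algebra morphism and so commutes with convolution powers. As `Δ ∘ ι ∘ f` is a sum of
two commuting elements, the binomial theorem applies. -/
theorem comul_conv_pow (hf : HasDegree (grading 𝒱) 𝒲 0 f) (k : ℕ) (x : Sym 𝒱) :
    comul 𝒲 ((WithConv.toConv (ι 𝒲 ∘ₗ f) ^ k).ofConv x) =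
      ∑ m ∈ Finset.HasAntidiagonal.antidiagonal k, k.choose m.1 •
        TensorProduct.map (WithConv.toConv (ι 𝒲 ∘ₗ f) ^ m.1).ofConv
          (WithConv.toConv (ι 𝒲 ∘ₗ f) ^ m.2).ofConv (comul 𝒱 x) := by
  apply (GradedTensorProduct.of K (grading 𝒲) (grading 𝒲)).injective
  have h := congr($(comp_conv_pow (gradedComul (𝒱 := 𝒲)) (ι 𝒲 ∘ₗ f) k) x)
  have hs : (gradedComul (𝒱 := 𝒲)).toLinearMap ∘ₗ ι 𝒲 ∘ₗ f =
      (GradedTensorProduct.includeLeft (grading 𝒲) (grading 𝒲)).toLinearMap ∘ₗ ι 𝒲 ∘ₗ f +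
      (GradedTensorProduct.includeRight (grading 𝒲) (grading 𝒲)).toLinearMap ∘ₗ ι 𝒲 ∘ₗ f := by
    ext x
    exact gradedComul_ι (f x)
  rw [hs, WithConv.toConv_add, (commute_includeLeft_includeRight hf).add_pow'] at h
  rw [of_comul]
  refine Eq.trans h ?_
  rw [map_sum, WithConv.ofConv_sum, LinearMap.sum_apply]
  refine Finset.sum_congr rfl fun m _ => ?_
  rw [map_nsmul, WithConv.ofConv_smul, LinearMap.smul_apply]
  congr 1
  rw [LinearMap.convMul_def, ← comp_conv_pow, ← comp_conv_pow]
  change LinearMap.mul' K _ (TensorProduct.map _ _ (comul 𝒱 x)) = _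
  generalize comul 𝒱 x = z
  induction z with
  | zero => simp
  | add x y hx hy => simp only [map_add, hx, hy]
  | tmul a b => exact GradedTensorProduct.tmul_one_mul_one_tmul (R := K) (grading 𝒲) (grading 𝒲) _ _

end ConvolutionPowers

/-! ### The coalgebra morphism with prescribed Taylor coefficients, as a convolution exponential. -/

section Exponential

variable (f : Sym 𝒱 →ₗ[K] W)

variable (𝒲) in
/-- The component with values in `W^{⊙k}` of the coalgebra morphism with Taylor coefficients `f`. -/
def expComponent (k : ℕ) : Sym 𝒱 →ₗ[K] Sym 𝒲 :=
  (k.factorial : K)⁻¹ • (WithConv.toConv (ι 𝒲 ∘ₗ f) ^ k).ofConv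

variable (𝒲) in
/-- The coalgebra morphism with Taylor coefficients `f`. -/
def coexp : Sym 𝒱 →ₗ[K] Sym 𝒲 :=
  ofWeights fun n => ∑ k ∈ Finset.range (n + 1), expComponent 𝒲 f k

variable {f}

theorem expComponent_eq_zero (hf : f 1 = 0) {k n : ℕ} (h : n < k) {x : Sym 𝒱}
    (hx : x ∈ power 𝒱 n) : expComponent 𝒲 f k x = 0 := by
  rw [expComponent, LinearMap.smul_apply, conv_pow_eq_zero hf h hx, smul_zero]

/-- Components beyond the weight of `x` vanish, so one truncation bound can serve all tensor factors
of a coproduct at once. -/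
theorem coexp_of_mem (hf : f 1 = 0) {n N : ℕ} (h : n ≤ N) {x : Sym 𝒱} (hx : x ∈ power 𝒱 n) :
    coexp 𝒲 f x = ∑ k ∈ Finset.range (N + 1), expComponent 𝒲 f k x := by
  rw [coexp, ofWeights_of_mem _ hx, LinearMap.sum_apply]
  refine Finset.sum_subset (Finset.range_mono (by omega)) fun k _ hk => ?_
  rw [Finset.mem_range, not_lt] at hk
  exact expComponent_eq_zero hf (by omega) hx

theorem expComponent_one (x : Sym 𝒱) : expComponent 𝒲 f 1 x = ι 𝒲 (f x) := by
  simp [expComponent]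

theorem expComponent_zero (x : Sym 𝒱) : expComponent 𝒲 f 0 x = counit 𝒱 x • 1 := by
  rw [expComponent, LinearMap.smul_apply, conv_pow_zero_apply]
  simp

variable [CharZero K]

/-- The factor `1 / k!` turns the binomial coefficients into divided powers; this is why an
exponential is group-like. -/
theorem comul_expComponent (hf : HasDegree (grading 𝒱) 𝒲 0 f) (k : ℕ) (x : Sym 𝒱) :
    comul 𝒲 (expComponent 𝒲 f k x) = ∑ m ∈ Finset.HasAntidiagonal.antidiagonal k,
      TensorProduct.map (expComponent 𝒲 f m.1) (expComponent 𝒲 f m.2) (comul 𝒱 x) := by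
  rw [expComponent, LinearMap.smul_apply, map_smul, comul_conv_pow hf, Finset.smul_sum]
  refine Finset.sum_congr rfl fun m hm => ?_
  rw [Finset.HasAntidiagonal.mem_antidiagonal] at hm
  rw [expComponent, expComponent, TensorProduct.map_smul_left, TensorProduct.map_smul_right,
    LinearMap.smul_apply, LinearMap.smul_apply, smul_smul, ← Nat.cast_smul_eq_nsmul K, smul_smul]
  congr 1
  have h := Nat.add_choose_mul_factorial_mul_factorial m.1 m.2
  rw [hm] at h
  have h1 : (k.factorial : K) ≠ 0 := Nat.cast_ne_zero.mpr k.factorial_ne_zero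
  have h2 : (m.1.factorial : K) ≠ 0 := Nat.cast_ne_zero.mpr m.1.factorial_ne_zero
  have h3 : (m.2.factorial : K) ≠ 0 := Nat.cast_ne_zero.mpr m.2.factorial_ne_zero
  field_simp
  rw [← h, Nat.choose_symm_of_eq_add hm.symm]
  push_cast
  ring

theorem isCoalgHom_coexp (hf1 : f 1 = 0) (hf : HasDegree (grading 𝒱) 𝒲 0 f) :
    IsCoalgHom 𝒱 𝒲 (coexp 𝒲 f) where
  degree := by
    intro d x hx
    rw [add_zero]
    obtain ⟨N, hN⟩ : ∃ N, coexp 𝒲 f x = ∑ k ∈ Finset.range (N + 1), expComponent 𝒲 f k x := by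
      obtain ⟨N, hN⟩ := exists_mem_below x
      refine ⟨N, ?_⟩
      have h : below 𝒱 N ≤ LinearMap.eqLocus (coexp 𝒲 f)
          (∑ k ∈ Finset.range (N + 1), expComponent 𝒲 f k) := below_le fun k hk x hx => by
        rw [LinearMap.mem_eqLocus, coexp_of_mem hf1 hk.le hx, LinearMap.sum_apply]
      rw [h hN, LinearMap.sum_apply]
    rw [hN]
    exact Submodule.sum_mem _ fun k _ => Submodule.smul_mem _ _ (conv_pow_mem_grading hf k hx)
  comul_comp := by
    refine hom_ext_power fun n x hx => ?_
    rw [LinearMap.comp_apply, LinearMap.comp_apply, coexp_of_mem hf1 le_rfl hx, map_sum]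
    let T : ℕ × ℕ → Sym 𝒲 ⊗[K] Sym 𝒲 := fun m =>
      TensorProduct.map (expComponent 𝒲 f m.1) (expComponent 𝒲 f m.2) (comul 𝒱 x)
    -- When `m.1 + m.2` exceeds the weight, one side has more factors than vectors. The square of
    -- indices may therefore be cut down to a triangle, which is then regrouped along antidiagonals.
    have hT : ∀ m : ℕ × ℕ, n < m.1 + m.2 → T m = 0 := by
      intro m hm
      have := comul_mem_of_power (P := ⊥)
        (TensorProduct.map (expComponent 𝒲 f m.1) (expComponent 𝒲 f m.2))
        (fun i j hij a ha b hb => by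
          rw [Submodule.mem_bot, TensorProduct.map_tmul]
          by_cases hi : i < m.1
          · rw [expComponent_eq_zero hf1 hi ha, TensorProduct.zero_tmul]
          · rw [expComponent_eq_zero hf1 (by omega : j < m.2) hb, TensorProduct.tmul_zero]) hx
      simpa using this
    have h1 : TensorProduct.map (coexp 𝒲 f) (coexp 𝒲 f) (comul 𝒱 x) =
        ∑ m ∈ Finset.range (n + 1) ×ˢ Finset.range (n + 1), T m := by
      have := comul_eq_of_power (B := TensorProduct.map (coexp 𝒲 f) (coexp 𝒲 f))
        (B' := ∑ m ∈ Finset.range (n + 1) ×ˢ Finset.range (n + 1),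
          TensorProduct.map (expComponent 𝒲 f m.1) (expComponent 𝒲 f m.2))
        (fun i j hij a ha b hb => by
          rw [TensorProduct.map_tmul, coexp_of_mem hf1 (by omega : i ≤ n) ha,
            coexp_of_mem hf1 (by omega : j ≤ n) hb, TensorProduct.sum_tmul, LinearMap.sum_apply,
            Finset.sum_product]
          simp only [TensorProduct.tmul_sum, TensorProduct.map_tmul]) hx
      rw [this, LinearMap.sum_apply]
    have h2 : ∑ m ∈ Finset.range (n + 1) ×ˢ Finset.range (n + 1), T m =
        ∑ m ∈ (Finset.range (n + 1) ×ˢ Finset.range (n + 1)).filter (fun m => m.1 + m.2 ≤ n),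
          T m := by
      rw [Finset.sum_filter_of_ne]
      intro m _ hm
      by_contra h
      exact hm (hT m (not_le.mp h))
    rw [h1, h2, ← Finset.sum_fiberwise_of_maps_to (t := Finset.range (n + 1))
      (g := fun m : ℕ × ℕ => m.1 + m.2)
      (fun m hm => by simp only [Finset.mem_filter, Finset.mem_range] at hm ⊢; omega)]
    refine Finset.sum_congr rfl fun k hk => ?_
    rw [comul_expComponent hf]
    refine Finset.sum_congr ?_ fun _ _ => rfl
    ext m
    simp only [Finset.HasAntidiagonal.mem_antidiagonal, Finset.mem_filter, Finset.mem_product, Finset.mem_range]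
      at hk ⊢
    omega
  counit_comp := by
    refine hom_ext_power fun n x hx => ?_
    rw [LinearMap.comp_apply, coexp_of_mem hf1 le_rfl hx, map_sum,
      Finset.sum_eq_single_of_mem 0 (by simp) fun k _ hk => ?_]
    · rw [expComponent_zero, map_smul, counit_one, smul_eq_mul, mul_one]
    · exact counit_of_mem_power hk (Submodule.smul_mem _ _ (conv_pow_mem_power k x))
  map_one := by
    rw [coexp_of_mem hf1 le_rfl one_mem_power]
    simp [expComponent_zero, counit_one]

theorem proj_coexp (hf1 : f 1 = 0) (x : Sym 𝒱) : proj 𝒲 (coexp 𝒲 f x) = f x := by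
  have h : proj 𝒲 ∘ₗ coexp 𝒲 f = f := by
    refine hom_ext_power fun n x hx => ?_
    rw [LinearMap.comp_apply, coexp_of_mem hf1 (Nat.le_succ n) hx, map_sum,
      Finset.sum_eq_single_of_mem 1 (by simp) fun k _ hk => ?_]
    · rw [expComponent_one, proj_ι]
    · exact proj_of_mem_power hk (Submodule.smul_mem _ _ (conv_pow_mem_power k x))
  exact congr($h x)

end Exponential

end Sym

end LInfty

namespace LInfty

/-! ### Inverses of degree zero maps, and invertibility of coalgebra morphisms. -/

section Degree

variable {K V W : Type*} [Field K] [AddCommGroup V] [Module K V] [AddCommGroup W] [Module K W]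
variable {𝒱 : ℤ → Submodule K V} {𝒲 : ℤ → Submodule K W}
variable [DirectSum.Decomposition 𝒱] [DirectSum.Decomposition 𝒲]

theorem component_mem (i : ℤ) (v : V) : component 𝒱 i v ∈ 𝒱 i := SetLike.coe_mem _

theorem component_comm_of_hasDegree {f : V →ₗ[K] W} (hf : HasDegree 𝒱 𝒲 0 f) (i : ℤ) (v : V) :
    f (component 𝒱 i v) = component 𝒲 i (f v) := by
  induction v using DirectSum.Decomposition.inductionOn 𝒱 with
  | zero => simp
  | @homogeneous j v =>
    have h := hf j v v.2
    rw [add_zero] at h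
    rw [component_apply, component_apply]
    by_cases hij : j = i
    · subst hij
      rw [DirectSum.decompose_of_mem_same 𝒱 v.2, DirectSum.decompose_of_mem_same 𝒲 h]
    · rw [DirectSum.decompose_of_mem_ne 𝒱 v.2 hij, DirectSum.decompose_of_mem_ne 𝒲 h hij,
        map_zero]
  | add v w hv hw => simp only [map_add, hv, hw]

theorem hasDegree_symm (f : V ≃ₗ[K] W) (hf : HasDegree 𝒱 𝒲 0 f.toLinearMap) :
    HasDegree 𝒲 𝒱 0 f.symm.toLinearMap := by
  intro i w hw
  rw [add_zero]
  have h : component 𝒱 i (f.symm w) = f.symm w := by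
    apply f.injective
    have := component_comm_of_hasDegree hf i (f.symm w)
    simp only [LinearEquiv.coe_coe, LinearEquiv.apply_symm_apply] at this ⊢
    rw [this, component_apply, DirectSum.decompose_of_mem_same 𝒲 hw]
  rw [LinearEquiv.coe_coe, ← h]
  exact component_mem i _

end Degree

namespace Sym

variable {K V W : Type*} [Field K] [AddCommGroup V] [Module K V] [AddCommGroup W] [Module K W]
variable {𝒱 : ℤ → Submodule K V} {𝒲 : ℤ → Submodule K W}

/-- A linear map which is the identity up to terms of lower weight is bijective. -/
theorem bijective_of_sub_mem_below (T : Sym 𝒱 →ₗ[K] Sym 𝒱)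
    (h : ∀ n, ∀ x ∈ power 𝒱 n, T x - x ∈ below 𝒱 n) : Function.Bijective T := by
  constructor
  · rw [injective_iff_map_eq_zero]
    intro x hx
    obtain ⟨N, hN⟩ := exists_mem_below x
    -- An element of the kernel satisfies `x = -(T x - x) + T x` with `T x = 0`; since `T - id`
    -- lowers weight, `x` sinks through the whole filtration.
    have key : ∀ n, x ∈ below 𝒱 n → x = 0 := by
      intro n
      induction n with
      | zero => intro h; rwa [below_zero, Submodule.mem_bot] at h
      | succ n ih =>
        intro hn
        apply ih
        have hle : below 𝒱 (n + 1) ≤ (below 𝒱 n).comap (T - LinearMap.id) :=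
          below_le fun k hk y hy => below_mono (by omega) (h k y hy)
        have := hle hn
        rw [Submodule.mem_comap, LinearMap.sub_apply, hx, zero_sub, neg_mem_iff] at this
        exact this
    exact key N hN
  · rw [← LinearMap.range_eq_top, eq_top_iff]
    have key : ∀ n, power 𝒱 n ≤ LinearMap.range T := by
      intro n
      induction n using Nat.strong_induction_on with
      | _ n ih =>
        intro x hx
        have := below_le ih (h n x hx)
        rw [← sub_sub_cancel (T x) x]
        exact sub_mem ⟨x, rfl⟩ this
    intro x _
    obtain ⟨N, hN⟩ := exists_mem_below x
    exact below_le (fun k _ => key k) hN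

variable [DirectSum.Decomposition 𝒱] [DirectSum.Decomposition 𝒲]

theorem map_comp_symm (γ : V ≃ₗ[K] W) (hγ : HasDegree 𝒱 𝒲 0 γ.toLinearMap) (x : Sym 𝒲) :
    map γ.toLinearMap hγ (map γ.symm.toLinearMap (hasDegree_symm γ hγ) x) = x := by
  have h : (map γ.toLinearMap hγ).comp (map γ.symm.toLinearMap (hasDegree_symm γ hγ)) =
      AlgHom.id K (Sym 𝒲) := algHom_ext 𝒲 fun v => by simp
  exact congr($h x)

theorem map_symm_comp (γ : V ≃ₗ[K] W) (hγ : HasDegree 𝒱 𝒲 0 γ.toLinearMap) (x : Sym 𝒱) :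
    map γ.symm.toLinearMap (hasDegree_symm γ hγ) (map γ.toLinearMap hγ x) = x := by
  have h : (map γ.symm.toLinearMap (hasDegree_symm γ hγ)).comp (map γ.toLinearMap hγ) =
      AlgHom.id K (Sym 𝒱) := algHom_ext 𝒱 fun v => by simp
  exact congr($h x)

/-- A coalgebra morphism whose linear part is bijective is bijective. -/
theorem IsCoalgHom.bijective [CharZero K] {F : Sym 𝒱 →ₗ[K] Sym 𝒲} (hF : IsCoalgHom 𝒱 𝒲 F)
    (γ : V ≃ₗ[K] W) (hγ : ∀ v, proj 𝒲 (F (ι 𝒱 v)) = γ v) : Function.Bijective F := by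
  have hdeg : HasDegree 𝒱 𝒲 0 γ.toLinearMap := by
    intro i v hv
    have h := proj_hasDegree _ _ (hF.degree i _ (ι_mem_grading hv))
    rw [add_zero, hγ] at h
    exact h
  have hS := isCoalgHom_map γ.toLinearMap hdeg
  -- Undoing the linear part makes `F` unipotent for the weight filtration: `F` and the morphism
  -- induced by `γ` share their Taylor coefficients of order at most one, so their difference lowers
  -- weight.
  let T := (map γ.symm.toLinearMap (hasDegree_symm γ hdeg)).toLinearMap ∘ₗ F
  have hT : Function.Bijective T := by
    refine bijective_of_sub_mem_below T fun n x hx => ?_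
    have hN := (hF.isCoderAlong_sub hS).mem_below hF.counit_comp hS.counit_comp hS.map_one
      (fun n x hx => hF.map_mem_below hx) (fun k hk x hx => by
        interval_cases k
        · obtain ⟨c, rfl⟩ := mem_power_zero hx
          rw [map_smul, LinearMap.sub_apply, hF.map_one, hS.map_one, sub_self, smul_zero, map_zero]
        · obtain ⟨v, rfl⟩ := mem_power_one hx
          rw [LinearMap.sub_apply, map_sub, hγ, AlgHom.toLinearMap_apply, Sym.map_ι, proj_ι]
          exact sub_self _) hx
    have h1 : T x - x = map γ.symm.toLinearMap (hasDegree_symm γ hdeg)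
        ((F - (map γ.toLinearMap hdeg).toLinearMap) x) := by
      rw [LinearMap.sub_apply, map_sub, AlgHom.toLinearMap_apply, map_symm_comp]
      rfl
    rw [h1]
    have h2 : below 𝒲 n ≤ (below 𝒱 n).comap
        (map γ.symm.toLinearMap (hasDegree_symm γ hdeg)).toLinearMap :=
      below_le fun k hk y hy => power_le_below hk (map_mem_power _ _ k hy)
    exact h2 hN
  have hFT : F = (map γ.toLinearMap hdeg).toLinearMap ∘ₗ T := by
    ext x
    exact (map_comp_symm γ hdeg (F x)).symm
  rw [hFT, LinearMap.coe_comp]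
  refine Function.Bijective.comp ⟨?_, ?_⟩ hT
  · exact Function.LeftInverse.injective (map_symm_comp γ hdeg)
  · exact Function.RightInverse.surjective (map_comp_symm γ hdeg)

theorem prod_apply (n : ℕ) (v : Fin n → V) :
    prod 𝒱 n v = (List.ofFn fun k => ι 𝒱 (v k)).prod := by
  simp [prod]

theorem power_le_of_prod_mem (n : ℕ) {P : Submodule K (Sym 𝒱)} (h : ∀ v, prod 𝒱 n v ∈ P) :
    power 𝒱 n ≤ P := by
  refine le_trans (power_le (fun n => Submodule.span K (Set.range (prod 𝒱 n))) ?_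
    (fun n i v hv x hx => ?_) n) (Submodule.span_le.mpr (Set.range_subset_iff.mpr h))
  · exact Submodule.subset_span ⟨fun _ => 0, by rw [prod_apply]; simp⟩
  · refine (Submodule.map_span_le (LinearMap.mulLeft K (ι 𝒱 v)) _ _).mpr ?_
      (Submodule.mem_map_of_mem hx)
    rintro _ ⟨w, rfl⟩
    refine Submodule.subset_span ⟨Fin.cons v w, ?_⟩
    rw [prod_apply, prod_apply, List.ofFn_succ, List.prod_cons]
    simp

theorem map_prod (f : V →ₗ[K] W) (hf : HasDegree 𝒱 𝒲 0 f) (n : ℕ) (v : Fin n → V) :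
    map f hf (prod 𝒱 n v) = prod 𝒲 n fun k => f (v k) := by
  rw [prod_apply, prod_apply, map_list_prod, List.map_ofFn]
  simp [Function.comp_def]

end Sym

/-! ### Codifferentials, and structures with only a quadratic bracket. -/

namespace LInftyStr

open LInfty.Sym

variable {K V W : Type*} [Field K] [CharZero K] [AddCommGroup V] [Module K V] [AddCommGroup W]
  [Module K W] {𝒱 : ℤ → Submodule K V} [DirectSum.Decomposition 𝒱]
  {𝒲 : ℤ → Submodule K W} [DirectSum.Decomposition 𝒲]

/-- The Koszul sign in the rule for a degree one coderivation is stored in the second map of the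
pair, so the results for pairs cover codifferentials. -/
theorem isCoderAlong (A : LInftyStr 𝒱) : IsCoderAlong LinearMap.id (signMap 𝒱) A.Q :=
  A.isCoderivation.comul_comp

theorem counit_comp_signMap : counit 𝒱 ∘ₗ signMap 𝒱 = counit 𝒱 := by
  rw [signMap_eq_sgn]
  ext x
  exact counit_sgn 1 x

theorem signMap_one : signMap 𝒱 1 = 1 := by
  rw [signMap_eq_sgn, sgn_one]

theorem counit_Q (A : LInftyStr 𝒱) (x : Sym 𝒱) : counit 𝒱 (A.Q x) = 0 :=
  A.isCoderAlong.counit_comp (LinearMap.comp_id _) counit_comp_signMap x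

theorem Q_one (A : LInftyStr 𝒱) : A.Q 1 = 0 := by
  rw [A.isCoderAlong.eq_ι_proj (LinearMap.comp_id _) counit_comp_signMap rfl signMap_one
    (n := 0) (fun k hk => absurd hk (Nat.not_lt_zero k)) one_mem_power, A.proj_Q_one, map_zero]

theorem Q_ι (A : LInftyStr 𝒱) (v : V) : A.Q (ι 𝒱 v) = ι 𝒱 (A.q₁ v) := by
  refine A.isCoderAlong.eq_ι_proj (LinearMap.comp_id _) counit_comp_signMap rfl signMap_one
    (n := 1) (fun k hk x hx => ?_) (ι_mem_power v)
  obtain rfl : k = 0 := by omega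
  obtain ⟨c, rfl⟩ := mem_power_zero hx
  rw [map_smul, A.Q_one, smul_zero]

/-- The only nonzero Taylor coefficient is the one of order `2`. -/
def IsQuadratic (A : LInftyStr 𝒱) : Prop := ∀ n ≠ 2, ∀ x ∈ power 𝒱 n, proj 𝒱 (A.Q x) = 0

theorem isQuadratic_of_q_eq_zero {A : LInftyStr 𝒱} (h : ∀ n ≠ 2, A.q n = 0) : A.IsQuadratic := by
  intro n hn x hx
  refine power_le_of_prod_mem n (P := LinearMap.ker (proj 𝒱 ∘ₗ A.Q)) (fun v => ?_) hx
  exact congr($(h n hn) v)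

namespace IsQuadratic

variable {A : LInftyStr 𝒱}

/-- In the recursion for `euler ∘ Q`, either two vectors are merged into one, or one vector is set
aside and `Q` acts on the others; both lose exactly one unit of weight. -/
theorem Q_mem_power (hA : A.IsQuadratic) {n : ℕ} {x : Sym 𝒱} (hx : x ∈ power 𝒱 (n + 1)) :
    A.Q x ∈ power 𝒱 n := by
  induction n using Nat.strong_induction_on generalizing x with
  | _ n ih =>
    refine mem_power_of_euler_mem ?_ (A.counit_Q x)
    rw [← LinearMap.comp_apply (euler 𝒱), A.isCoderAlong.euler_comp]
    refine comul_mem_of_power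
      (LinearMap.mul' K (Sym 𝒱) ∘ₗ TensorProduct.map (ι 𝒱 ∘ₗ proj 𝒱 ∘ₗ A.Q) LinearMap.id +
        LinearMap.mul' K (Sym 𝒱) ∘ₗ TensorProduct.map (ι 𝒱 ∘ₗ proj 𝒱 ∘ₗ signMap 𝒱) A.Q)
      (fun i j hij a ha b hb => ?_) hx
    simp only [LinearMap.add_apply, LinearMap.comp_apply, TensorProduct.map_tmul,
      LinearMap.mul'_apply, LinearMap.id_apply]
    refine add_mem ?_ ?_
    · rcases eq_or_ne i 2 with rfl | hi
      · obtain rfl : n = j + 1 := by omega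
        exact ι_mul_mem_power _ hb
      · rw [hA i hi a ha, map_zero, zero_mul]
        exact zero_mem _
    · rcases eq_or_ne i 1 with rfl | hi
      · obtain rfl : n = j := by omega
        cases n with
        | zero =>
          obtain ⟨c, rfl⟩ := mem_power_zero hb
          rw [map_smul, A.Q_one, smul_zero, mul_zero]
          exact zero_mem _
        | succ n => exact ι_mul_mem_power _ (ih n (Nat.lt_succ_self n) hb)
      · rw [signMap_eq_sgn, proj_of_mem_power hi (sgn_mem_power 1 ha), map_zero, zero_mul]
        exact zero_mem _

theorem proj_Q (hA : A.IsQuadratic) (x : Sym 𝒱) : proj 𝒱 (A.Q x) = proj 𝒱 (A.Q (wproj 𝒱 2 x)) := by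
  have h : proj 𝒱 ∘ₗ A.Q = proj 𝒱 ∘ₗ A.Q ∘ₗ wproj 𝒱 2 := hom_ext_power fun n x hx => by
    simp only [LinearMap.comp_apply]
    rcases eq_or_ne n 2 with rfl | hn
    · rw [wproj_of_mem_same hx]
    · rw [wproj_of_mem_ne hx hn, hA n hn x hx, map_zero, map_zero]
  exact congr($h x)

/-- A quadratic codifferential lowers weight by exactly one. Conjugating this commutator identity is
the whole mechanism of `exists_primitive`. -/
theorem euler_Q (hA : A.IsQuadratic) (x : Sym 𝒱) : euler 𝒱 (A.Q x) - A.Q (euler 𝒱 x) = - A.Q x := by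
  have h : euler 𝒱 ∘ₗ A.Q - A.Q ∘ₗ euler 𝒱 = - A.Q := hom_ext_power fun n x hx => by
    simp only [LinearMap.comp_apply, LinearMap.sub_apply, LinearMap.neg_apply]
    cases n with
    | zero =>
      obtain ⟨c, rfl⟩ := mem_power_zero hx
      simp [A.Q_one, euler_one]
    | succ n =>
      rw [euler_of_mem hx, euler_of_mem (hA.Q_mem_power hx), map_smul]
      push_cast
      module
  exact congr($h x)

end IsQuadratic

end LInftyStr

end LInfty

namespace LInfty

namespace Sym

variable {K V : Type*} [Field K] [AddCommGroup V] [Module K V] {𝒱 : ℤ → Submodule K V}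

theorem wproj_mem_grading (n : ℕ) {d : ℤ} {x : Sym 𝒱} (hx : x ∈ grading 𝒱 d) :
    wproj 𝒱 n x ∈ grading 𝒱 d := by
  have h := grading_le (fun d => ⨅ n, (grading 𝒱 d).comap (wproj 𝒱 n)) ?_
    (fun d i v hv x hx => ?_) d hx
  · exact Submodule.mem_iInf _ |>.mp h n
  · refine (Submodule.mem_iInf _).mpr fun n => ?_
    rw [Submodule.mem_comap, wproj_of_mem one_mem_power]
    split_ifs
    · exact one_mem_grading
    · exact zero_mem _
  · rw [Submodule.mem_iInf] at hx ⊢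
    intro n
    rw [Submodule.mem_comap]
    cases n with
    | zero =>
      rw [wproj_zero, counit_ι_mul, zero_smul]
      exact zero_mem _
    | succ n =>
      rw [wproj_ι_mul]
      exact ι_mul_mem_grading hv (hx n)

theorem euler_mem_grading {d : ℤ} {x : Sym 𝒱} (hx : x ∈ grading 𝒱 d) :
    euler 𝒱 x ∈ grading 𝒱 d := by
  refine (grading_le (fun d => grading 𝒱 d ⊓ (grading 𝒱 d).comap (euler 𝒱)) ?_
    (fun d i v hv x hx => ?_) d hx).2
  · refine ⟨one_mem_grading, ?_⟩
    rw [Submodule.comap_coe, Set.mem_preimage, euler_one]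
    exact zero_mem _
  · refine ⟨ι_mul_mem_grading hv hx.1, ?_⟩
    rw [Submodule.comap_coe, Set.mem_preimage, euler_ι_mul]
    exact add_mem (ι_mul_mem_grading hv hx.1) (ι_mul_mem_grading hv hx.2)

end Sym

/-! ### The Euler coderivation and the leading obstruction. -/

namespace LInftyStr

open LInfty.Sym

variable {K V H : Type*} [Field K] [CharZero K] [AddCommGroup V] [Module K V] [AddCommGroup H]
  [Module K H] {𝒱 : ℤ → Submodule K V} [DirectSum.Decomposition 𝒱]
  {ℋ : ℤ → Submodule K H} [DirectSum.Decomposition ℋ]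

/-- The symmetrized product `x ↦ φ(x') ⊙ f(x'') + f(x') ⊙ φ(x'')`, where `f` is linear and `φ` is a
Taylor coefficient. It is twice the quadratic part of the coderivation given by `φ` along the
morphism given by `f`. -/
def symProd (f : H →ₗ[K] V) (φ : Sym ℋ →ₗ[K] V) : Sym ℋ →ₗ[K] Sym 𝒱 :=
  conv (ι 𝒱 ∘ₗ φ) (ι 𝒱 ∘ₗ f ∘ₗ proj ℋ) + conv (ι 𝒱 ∘ₗ f ∘ₗ proj ℋ) (ι 𝒱 ∘ₗ φ)

theorem symProd_mem_power (f : H →ₗ[K] V) (φ : Sym ℋ →ₗ[K] V) (x : Sym ℋ) :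
    symProd (𝒱 := 𝒱) f φ x ∈ power 𝒱 2 := by
  have h : ∀ g g' : Sym ℋ →ₗ[K] V, conv (ι 𝒱 ∘ₗ g) (ι 𝒱 ∘ₗ g') x ∈ power 𝒱 2 := by
    intro g g'
    rw [conv_apply]
    generalize comul ℋ x = z
    induction z with
    | zero => simp
    | add x y hx hy => rw [map_add, map_add]; exact add_mem hx hy
    | tmul a b => exact ι_mul_mem_power _ (ι_mem_power _)
  exact add_mem (h _ _) (h _ _)

/-- Since `proj ℋ` sees only weight one, in weight `n + 1` only the splittings `(n, 1)` and `(1, n)`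
contribute. -/
theorem symProd_congr (f : H →ₗ[K] V) {φ φ' : Sym ℋ →ₗ[K] V} {n : ℕ}
    (h : ∀ x ∈ power ℋ n, φ x = φ' x) {x : Sym ℋ} (hx : x ∈ power ℋ (n + 1)) :
    symProd (𝒱 := 𝒱) f φ x = symProd f φ' x := by
  refine comul_eq_of_power
    (B := LinearMap.mul' K (Sym 𝒱) ∘ₗ TensorProduct.map (ι 𝒱 ∘ₗ φ) (ι 𝒱 ∘ₗ f ∘ₗ proj ℋ) +
      LinearMap.mul' K (Sym 𝒱) ∘ₗ TensorProduct.map (ι 𝒱 ∘ₗ f ∘ₗ proj ℋ) (ι 𝒱 ∘ₗ φ))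
    (B' := LinearMap.mul' K (Sym 𝒱) ∘ₗ TensorProduct.map (ι 𝒱 ∘ₗ φ') (ι 𝒱 ∘ₗ f ∘ₗ proj ℋ) +
      LinearMap.mul' K (Sym 𝒱) ∘ₗ TensorProduct.map (ι 𝒱 ∘ₗ f ∘ₗ proj ℋ) (ι 𝒱 ∘ₗ φ'))
    (fun i j hij a ha b hb => ?_) hx
  simp only [LinearMap.add_apply, LinearMap.comp_apply, TensorProduct.map_tmul,
    LinearMap.mul'_apply]
  congr 1
  · rcases eq_or_ne j 1 with rfl | hj
    · obtain rfl : i = n := by omega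
      rw [h a ha]
    · simp [proj_of_mem_power hj hb]
  · rcases eq_or_ne i 1 with rfl | hi
    · obtain rfl : j = n := by omega
      rw [h b hb]
    · simp [proj_of_mem_power hi ha]

section EulerClass

/-- The commutator of the Euler coderivation, transported along an almost-morphism `Φ`, with a
quadratic structure exhibits the leading obstruction of `Φ` as a coboundary. -/
theorem exists_primitive {R : LInftyStr ℋ} (hR : R.IsQuadratic) {Φ : Sym ℋ →ₗ[K] Sym ℋ}
    (hΦ : IsCoalgHom ℋ ℋ Φ) (γ : H ≃ₗ[K] H) (hγ : ∀ v, proj ℋ (Φ (ι ℋ v)) = γ v) {n : ℕ}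
    (hn : 2 < n) (ω : Sym ℋ → H)
    (h0 : ∀ k < n, ∀ x ∈ power ℋ k, R.Q (Φ x) - Φ (R.Q x) = 0)
    (hω : ∀ x ∈ power ℋ n, R.Q (Φ x) - Φ (R.Q x) = ι ℋ (γ (ω x))) :
    ∃ ψ : Sym ℋ →ₗ[K] H, HasDegree (grading ℋ) ℋ 0 ψ ∧ ∀ x ∈ power ℋ n,
      (2⁻¹ : K) • proj ℋ (R.Q (symProd LinearMap.id ψ x)) - ψ (R.Q x) = (2 - n : K) • ω x := by
  let Ψ : Sym ℋ ≃ₗ[K] Sym ℋ := LinearEquiv.ofBijective Φ (hΦ.bijective γ hγ)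
  have hΨ : ∀ x, Ψ x = Φ x := fun x => rfl
  have hΨl : Ψ.toLinearMap = Φ := rfl
  -- The Euler coderivation conjugated by `Φ`. Its linear part is the identity whatever `γ` is, and
  -- its Taylor coefficients will supply the primitive.
  let E : Sym ℋ →ₗ[K] Sym ℋ := Ψ.symm.toLinearMap ∘ₗ euler ℋ ∘ₗ Φ
  have hE : ∀ x, E x = Ψ.symm (euler ℋ (Φ x)) := fun x => rfl
  have hΦE : Φ ∘ₗ E = euler ℋ ∘ₗ Φ := by
    ext x
    exact Ψ.apply_symm_apply _
  have hEdeg : HasDegree (grading ℋ) (grading ℋ) 0 E := by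
    intro d x hx
    have h1 := hΦ.degree d x hx
    have h2 := euler_mem_grading h1
    have h3 := hasDegree_symm Ψ hΦ.degree _ _ h2
    rw [add_zero] at h3
    exact h3
  have hEι : ∀ v, E (ι ℋ v) = ι ℋ v := by
    intro v
    rw [hE, hΦ.map_ι, euler_ι, ← hΦ.map_ι, ← hΨ, Ψ.symm_apply_apply]
  have hE1 : E 1 = 0 := by rw [hE, hΦ.map_one, euler_one, map_zero]
  have hEcoder : IsCoderAlong LinearMap.id LinearMap.id E := by
    have hinj : Function.Injective (TensorProduct.map Φ Φ) := by
      rw [← hΨl]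
      exact (TensorProduct.congr Ψ Ψ).injective
    refine LinearMap.ext fun x => hinj ?_
    have e1 := congr($hΦ.comul_comp (E x))
    have e2 := congr($hΦ.comul_comp x)
    have e3 := congr($(comul_euler (𝒱 := ℋ)) (Φ x))
    have e4 := congr($hΦE x)
    simp only [LinearMap.comp_apply] at e1 e2 e3 e4 ⊢
    rw [← e1, e4, e3, e2, LinearMap.add_apply, LinearMap.add_apply, map_add,
      TensorProduct.map_map, TensorProduct.map_map, TensorProduct.map_map, TensorProduct.map_map,
      hΦE]
    rfl
  -- `E` and `euler` are coderivations with the same Taylor coefficients of orders zero and one, so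
  -- they differ by terms of lower weight.
  have hEe : ∀ {k : ℕ} {x : Sym ℋ}, x ∈ power ℋ k → E x - (k : K) • x ∈ below ℋ k := by
    intro k x hx
    have heuler : IsCoderAlong LinearMap.id LinearMap.id (euler ℋ) := comul_euler
    have := (hEcoder.sub heuler).mem_below (LinearMap.comp_id _) (LinearMap.comp_id _) rfl
      (fun m y hy => power_le_below (Nat.lt_succ_self m) hy) (fun m hm y hy => by
        interval_cases m
        · obtain ⟨c, rfl⟩ := mem_power_zero hy
          rw [map_smul, LinearMap.sub_apply, hE1, euler_one, sub_self, smul_zero, map_zero]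
        · obtain ⟨v, rfl⟩ := mem_power_one hy
          rw [LinearMap.sub_apply, hEι, euler_ι, sub_self, map_zero]) hx
    rwa [LinearMap.sub_apply, euler_of_mem hx] at this
  -- `R.Q + X` is the codifferential conjugated by `Φ`; `X` begins in weight `n` with coefficient
  -- `ω`.
  let X : Sym ℋ →ₗ[K] Sym ℋ := Ψ.symm.toLinearMap ∘ₗ (R.Q ∘ₗ Φ - Φ ∘ₗ R.Q)
  have hX : ∀ x, X x = Ψ.symm (R.Q (Φ x)) - R.Q x := by
    intro x
    change Ψ.symm (R.Q (Φ x) - Φ (R.Q x)) = _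
    rw [map_sub, ← hΨ (R.Q x), Ψ.symm_apply_apply]
  have hX0 : ∀ k < n, ∀ x ∈ power ℋ k, X x = 0 := by
    intro k hk x hx
    change Ψ.symm (R.Q (Φ x) - Φ (R.Q x)) = _
    rw [h0 k hk x hx, map_zero]
  have hXn : ∀ x ∈ power ℋ n, X x = ι ℋ (ω x) := by
    intro x hx
    change Ψ.symm (R.Q (Φ x) - Φ (R.Q x)) = _
    rw [hω x hx, ← hγ, ← hΦ.map_ι, ← hΨ, Ψ.symm_apply_apply]
  have hcomm : ∀ x, E (R.Q x + X x) - (R.Q (E x) + X (E x)) = - (R.Q x + X x) := by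
    intro x
    have hEs : Φ (E x) = euler ℋ (Φ x) := congr($hΦE x)
    rw [hX, hX, add_sub_cancel, add_sub_cancel, hE, ← hΨ (Ψ.symm _), Ψ.apply_symm_apply,
      hEs, ← map_sub, hR.euler_Q, map_neg]
  clear_value E X
  refine ⟨proj ℋ ∘ₗ E, ?_, fun x hx => ?_⟩
  · intro d x hx
    have := proj_hasDegree _ _ (hEdeg d x hx)
    rwa [add_zero] at this
  -- `euler` is multiplication by two on the quadratic part, and its recursion for `E` leaves
  -- exactly the two products of a linear factor with a Taylor coefficient of `E`.
  · have h1 : (2 : K) • wproj ℋ 2 (E x) = symProd LinearMap.id (proj ℋ ∘ₗ E) x := by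
      rw [show (2 : K) = ((2 : ℕ) : K) by norm_num, ← wproj_euler,
        ← LinearMap.comp_apply (euler ℋ), hEcoder.euler_comp]
      simp only [symProd, LinearMap.add_apply, conv_apply, map_add]
      generalize comul ℋ x = z
      have hw : ∀ v y, wproj ℋ 2 (ι ℋ v * y) = ι ℋ v * ι ℋ (proj ℋ y) := fun v y => by
        rw [wproj_ι_mul, wproj_one]
      induction z with
      | zero => simp
      | add x y hx hy =>
        simp only [map_add] at hx hy ⊢; convert congrArg₂ (· + ·) hx hy using 1 <;> abel
      | tmul a b => simp [hw]
    have h2 : (2⁻¹ : K) • proj ℋ (R.Q (symProd LinearMap.id (proj ℋ ∘ₗ E) x)) =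
        proj ℋ (R.Q (E x)) := by
      rw [← h1, map_smul, map_smul, smul_smul, inv_mul_cancel₀ two_ne_zero, one_smul, ← hR.proj_Q]
    -- `E x` is `n x` plus lower weight, where `X` vanishes.
    have h3 : X (E x) = (n : K) • ι ℋ (ω x) := by
      have := below_le (P := LinearMap.ker X) (fun k hk y hy => hX0 k hk y hy) (hEe hx)
      rw [LinearMap.mem_ker, map_sub, map_smul, hXn x hx, sub_eq_zero] at this
      exact this
    -- The linear part of the commutator reads `ψ (R x) + ω x - proj (R (E x)) - n ω x = -ω x`; the
    -- linear part of `R x` is absent because `n ≠ 2`. Solving for the coboundary leaves the factor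
    -- `2 - n`.
    have h4 := congr(proj ℋ $(hcomm x))
    rw [hXn x hx, h3, map_add E, hEι, map_sub, map_add, map_add, map_neg, map_add, proj_ι,
      map_smul, proj_ι, hR n (by omega) x hx, zero_add] at h4
    rw [h2, LinearMap.comp_apply, sub_smul, two_smul]
    linear_combination (norm := abel) -h4

end EulerClass

end LInftyStr

end LInfty

namespace LInfty

/-! ### Degrees, naturality of convolution, and equivariance of whole maps from equivariance of
coefficients. -/

section Degree

variable {K V W U : Type*} [Field K] [AddCommGroup V] [Module K V] [AddCommGroup W] [Module K W]
  [AddCommGroup U] [Module K U]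
variable {𝒱 : ℤ → Submodule K V} {𝒲 : ℤ → Submodule K W} {𝒰 : ℤ → Submodule K U}

theorem HasDegree.comp {j k l : ℤ} {f : V →ₗ[K] W} {g : W →ₗ[K] U} (hg : HasDegree 𝒲 𝒰 k g)
    (hf : HasDegree 𝒱 𝒲 j f) (h : j + k = l) : HasDegree 𝒱 𝒰 l (g ∘ₗ f) := by
  intro i v hv
  rw [← h, ← add_assoc]
  exact hg _ _ (hf i v hv)

theorem HasDegree.add {j : ℤ} {f g : V →ₗ[K] W} (hf : HasDegree 𝒱 𝒲 j f)
    (hg : HasDegree 𝒱 𝒲 j g) : HasDegree 𝒱 𝒲 j (f + g) :=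
  fun i v hv => add_mem (hf i v hv) (hg i v hv)

theorem HasDegree.sub {j : ℤ} {f g : V →ₗ[K] W} (hf : HasDegree 𝒱 𝒲 j f)
    (hg : HasDegree 𝒱 𝒲 j g) : HasDegree 𝒱 𝒲 j (f - g) :=
  fun i v hv => sub_mem (hf i v hv) (hg i v hv)

theorem HasDegree.neg {j : ℤ} {f : V →ₗ[K] W} (hf : HasDegree 𝒱 𝒲 j f) :
    HasDegree 𝒱 𝒲 j (-f) :=
  fun i v hv => neg_mem (hf i v hv)

theorem HasDegree.smul {j : ℤ} {f : V →ₗ[K] W} (c : K) (hf : HasDegree 𝒱 𝒲 j f) :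
    HasDegree 𝒱 𝒲 j (c • f) :=
  fun i v hv => Submodule.smul_mem _ c (hf i v hv)

theorem Sym.ι_hasDegree : HasDegree 𝒱 (Sym.grading 𝒱) 0 (Sym.ι 𝒱) := fun i v hv => by
  rw [add_zero]
  exact Sym.ι_mem_grading hv

theorem Sym.wproj_hasDegree (n : ℕ) : HasDegree (Sym.grading 𝒱) (Sym.grading 𝒱) 0 (Sym.wproj 𝒱 n) :=
  fun i v hv => by
    rw [add_zero]
    exact Sym.wproj_mem_grading n hv

theorem Sym.conv_hasDegree [DirectSum.Decomposition 𝒱] [DirectSum.Decomposition 𝒲]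
    {f g : Sym 𝒱 →ₗ[K] Sym 𝒲} (hf : HasDegree (Sym.grading 𝒱) (Sym.grading 𝒲) 0 f)
    (hg : HasDegree (Sym.grading 𝒱) (Sym.grading 𝒲) 0 g) :
    HasDegree (Sym.grading 𝒱) (Sym.grading 𝒲) 0 (Sym.conv f g) := by
  intro d x hx
  refine Sym.comul_mem_of_grading (LinearMap.mul' K _ ∘ₗ TensorProduct.map f g)
    (fun i j hij a ha b hb => ?_) hx
  have h1 := hf i a ha
  have h2 := hg j b hb
  rw [add_zero] at h1 h2 ⊢
  rw [← hij]
  exact SetLike.GradedMul.mul_mem h1 h2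

end Degree

namespace Sym

variable {K V W U : Type*} [Field K] [AddCommGroup V] [Module K V] [AddCommGroup W] [Module K W]
  [AddCommGroup U] [Module K U]
variable {𝒱 : ℤ → Submodule K V} {𝒲 : ℤ → Submodule K W} {𝒰 : ℤ → Submodule K U}
variable [DirectSum.Decomposition 𝒱] [DirectSum.Decomposition 𝒲] [DirectSum.Decomposition 𝒰]

theorem conv_comp_apply {A : Type*} [Ring A] [Algebra K A] (f g : Sym 𝒲 →ₗ[K] A)
    {F : Sym 𝒱 →ₗ[K] Sym 𝒲} (hF : IsCoalgHom 𝒱 𝒲 F) (x : Sym 𝒱) :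
    conv f g (F x) = conv (f ∘ₗ F) (g ∘ₗ F) x := by
  rw [conv_apply, conv_apply, ← LinearMap.comp_apply (comul 𝒲), hF.comul_comp,
    LinearMap.comp_apply, TensorProduct.map_map]

theorem algHom_conv_apply {A B : Type*} [Ring A] [Algebra K A] [Ring B] [Algebra K B]
    (h : A →ₐ[K] B) (f g : Sym 𝒱 →ₗ[K] A) (x : Sym 𝒱) :
    h (conv f g x) = conv (h.toLinearMap ∘ₗ f) (h.toLinearMap ∘ₗ g) x := by
  rw [conv_apply, conv_apply]
  generalize comul 𝒱 x = z
  induction z with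
  | zero => simp
  | add x y hx hy => simp only [map_add, hx, hy]
  | tmul a b => simp

theorem proj_map (f : V →ₗ[K] W) (hf : HasDegree 𝒱 𝒲 0 f) (x : Sym 𝒱) :
    proj 𝒲 (map f hf x) = f (proj 𝒱 x) := by
  have h : proj 𝒲 ∘ₗ (map f hf).toLinearMap = f ∘ₗ proj 𝒱 := by
    refine hom_ext (by simp [proj_one]) fun i v _ x _ => ?_
    have hc : counit 𝒲 (map f hf x) = counit 𝒱 x := congr($((isCoalgHom_map f hf).counit_comp) x)
    simp [proj_ι_mul, hc]
  exact congr($h x)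

theorem wproj_map (f : V →ₗ[K] W) (hf : HasDegree 𝒱 𝒲 0 f) (n : ℕ) (x : Sym 𝒱) :
    wproj 𝒲 n (map f hf x) = map f hf (wproj 𝒱 n x) := by
  have h : wproj 𝒲 n ∘ₗ (map f hf).toLinearMap = (map f hf).toLinearMap ∘ₗ wproj 𝒱 n :=
    hom_ext_power fun m x hx => by
      simp only [LinearMap.comp_apply, AlgHom.toLinearMap_apply]
      rw [wproj_of_mem hx, wproj_of_mem (map_mem_power f hf m hx)]
      split_ifs <;> simp
  exact congr($h x)

/-- Both sides are coalgebra morphisms with equal Taylor coefficients, so compatibility of the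
coefficients passes to the entire map. -/
theorem IsCoalgHom.map_comm [CharZero K] {F : Sym 𝒱 →ₗ[K] Sym 𝒲} (hF : IsCoalgHom 𝒱 𝒲 F)
    {a : V →ₗ[K] V} (ha : HasDegree 𝒱 𝒱 0 a) {b : W →ₗ[K] W} (hb : HasDegree 𝒲 𝒲 0 b)
    (h : ∀ x, b (proj 𝒲 (F x)) = proj 𝒲 (F (map a ha x))) (x : Sym 𝒱) :
    map b hb (F x) = F (map a ha x) := by
  have := ((isCoalgHom_map b hb).comp hF).ext_proj (hF.comp (isCoalgHom_map a ha))
    (LinearMap.ext fun x => by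
      simp only [LinearMap.comp_apply, AlgHom.toLinearMap_apply]
      rw [proj_map, h])
  exact congr($this x)

end Sym

namespace LInftyStr

open LInfty.Sym

variable {K V H : Type*} [Field K] [CharZero K] [AddCommGroup V] [Module K V] [AddCommGroup H]
  [Module K H] {𝒱 : ℤ → Submodule K V} [DirectSum.Decomposition 𝒱]
  {ℋ : ℤ → Submodule K H} [DirectSum.Decomposition ℋ]

theorem Q_map_comm (A : LInftyStr 𝒱) {a : V →ₗ[K] V} (ha : HasDegree 𝒱 𝒱 0 a)
    (h : ∀ x, a (proj 𝒱 (A.Q x)) = proj 𝒱 (A.Q (map a ha x))) (x : Sym 𝒱) :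
    map a ha (A.Q x) = A.Q (map a ha x) := by
  have hS := isCoalgHom_map a ha
  let S := (map a ha).toLinearMap
  have hσ : ∀ y, signMap 𝒱 (S y) = S (signMap 𝒱 y) := fun y => by
    rw [signMap_eq_sgn]
    exact congr($(sgn_comm_of_hasDegree hS.degree 1) y)
  have h1 : IsCoderAlong S (signMap 𝒱 ∘ₗ S) (S ∘ₗ A.Q) := by
    have e := hS.comul_comp
    refine LinearMap.ext fun x => ?_
    have e1 := congr($e (A.Q x))
    have e2 := congr($(A.isCoderivation.comul_comp) x)
    simp only [LinearMap.comp_apply] at e1 e2 ⊢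
    refine e1.trans ?_
    rw [e2, LinearMap.add_apply, LinearMap.add_apply, map_add, TensorProduct.map_map,
      TensorProduct.map_map, show signMap 𝒱 ∘ₗ S = S ∘ₗ signMap 𝒱 from LinearMap.ext hσ]
    rfl
  have h2 : IsCoderAlong S (signMap 𝒱 ∘ₗ S) (A.Q ∘ₗ S) := by
    have e := hS.comul_comp
    refine LinearMap.ext fun x => ?_
    have e1 := congr($e x)
    have e2 := congr($(A.isCoderivation.comul_comp) (S x))
    simp only [LinearMap.comp_apply] at e1 e2 ⊢
    rw [e2, e1, LinearMap.add_apply, LinearMap.add_apply, TensorProduct.map_map,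
      TensorProduct.map_map]
    rfl
  have hc : counit 𝒱 ∘ₗ signMap 𝒱 ∘ₗ S = counit 𝒱 := by
    rw [← LinearMap.comp_assoc, counit_comp_signMap, hS.counit_comp]
  have h3 := (h1.sub h2).eq_zero_of_proj hS.counit_comp hc hS.map_one
    (by rw [LinearMap.comp_apply, hS.map_one, signMap_one]) (LinearMap.ext fun x => by
      have := proj_map a ha (A.Q x)
      simp only [LinearMap.comp_apply, LinearMap.sub_apply, map_sub]
      rw [LinearMap.zero_apply, sub_eq_zero]
      exact this.trans (h x))
  exact sub_eq_zero.mp congr($h3 x)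

/-- The failure of a coalgebra morphism to be compatible with the codifferentials. -/
def defect (R : LInftyStr ℋ) (A : LInftyStr 𝒱) (F : Sym ℋ →ₗ[K] Sym 𝒱) : Sym ℋ →ₗ[K] Sym 𝒱 :=
  A.Q ∘ₗ F - F ∘ₗ R.Q

/-! ### The defect of a coalgebra morphism and its behaviour under perturbation. -/

section Defect

variable {R : LInftyStr ℋ} {A : LInftyStr 𝒱} {F : Sym ℋ →ₗ[K] Sym 𝒱}

theorem defect_apply (x : Sym ℋ) : defect R A F x = A.Q (F x) - F (R.Q x) := rfl

/-- `A.Q ∘ F` and `F ∘ R.Q` are coderivations along the same pair; for the latter the sign operator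
passes through `F`, which has degree `0`. The defect is therefore governed by its Taylor
coefficients. -/
theorem isCoderAlong_defect (hF : IsCoalgHom ℋ 𝒱 F) :
    IsCoderAlong F (signMap 𝒱 ∘ₗ F) (defect R A F) := by
  have hσ : signMap 𝒱 ∘ₗ F = F ∘ₗ signMap ℋ := by
    rw [signMap_eq_sgn, signMap_eq_sgn, sgn_comm_of_hasDegree hF.degree]
  refine IsCoderAlong.sub (D := A.Q ∘ₗ F) (D' := F ∘ₗ R.Q) ?_ ?_
  · refine LinearMap.ext fun x => ?_
    have e1 := congr($(hF.comul_comp) x)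
    have e2 := congr($(A.isCoderivation.comul_comp) (F x))
    simp only [LinearMap.comp_apply] at e1 e2 ⊢
    rw [e2, e1, LinearMap.add_apply, LinearMap.add_apply, TensorProduct.map_map,
      TensorProduct.map_map]
    rfl
  · refine LinearMap.ext fun x => ?_
    have e1 := congr($(hF.comul_comp) (R.Q x))
    have e2 := congr($(R.isCoderivation.comul_comp) x)
    simp only [LinearMap.comp_apply] at e1 e2 ⊢
    rw [e1, e2, LinearMap.add_apply, LinearMap.add_apply, map_add, TensorProduct.map_map,
      TensorProduct.map_map, hσ]
    rfl

theorem counit_comp_signMap_comp (hF : IsCoalgHom ℋ 𝒱 F) :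
    counit 𝒱 ∘ₗ signMap 𝒱 ∘ₗ F = counit ℋ := by
  rw [← LinearMap.comp_assoc, counit_comp_signMap, hF.counit_comp]

theorem signMap_comp_one (hF : IsCoalgHom ℋ 𝒱 F) : (signMap 𝒱 ∘ₗ F) 1 = 1 := by
  rw [LinearMap.comp_apply, hF.map_one, signMap_one]

theorem defect_eq_zero (hF : IsCoalgHom ℋ 𝒱 F) {n : ℕ}
    (h : ∀ k < n, ∀ x ∈ power ℋ k, proj 𝒱 (defect R A F x) = 0) :
    ∀ k < n, ∀ x ∈ power ℋ k, defect R A F x = 0 :=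
  (isCoderAlong_defect hF).eq_zero hF.counit_comp (counit_comp_signMap_comp hF) hF.map_one
    (signMap_comp_one hF) h

theorem defect_eq_ι (hF : IsCoalgHom ℋ 𝒱 F) {n : ℕ}
    (h : ∀ k < n, ∀ x ∈ power ℋ k, proj 𝒱 (defect R A F x) = 0) {x : Sym ℋ}
    (hx : x ∈ power ℋ n) : defect R A F x = ι 𝒱 (proj 𝒱 (defect R A F x)) :=
  (isCoderAlong_defect hF).eq_ι_proj hF.counit_comp (counit_comp_signMap_comp hF) hF.map_one
    (signMap_comp_one hF) (defect_eq_zero hF h) hx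

/-- From `Q² = 0` on both sides, `A.Q ∘ defect = -defect ∘ R.Q`. As `R.Q` drops the weight into the
range where the defect vanishes, the leading coefficient is a cocycle. -/
theorem q₁_proj_defect (hR : R.IsQuadratic) (hF : IsCoalgHom ℋ 𝒱 F) {n : ℕ}
    (h : ∀ k < n + 1, ∀ x ∈ power ℋ k, proj 𝒱 (defect R A F x) = 0) {x : Sym ℋ}
    (hx : x ∈ power ℋ (n + 1)) : A.q₁ (proj 𝒱 (defect R A F x)) = 0 := by
  have h1 : A.Q (defect R A F x) = - defect R A F (R.Q x) := by
    have e1 : A.Q (A.Q (F x)) = 0 := congr($(A.Q_comp_Q) (F x))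
    have e2 : R.Q (R.Q x) = 0 := congr($(R.Q_comp_Q) x)
    rw [defect_apply, defect_apply, map_sub, e1, e2, map_zero, zero_sub, sub_zero]
  rw [defect_eq_zero hF h n (Nat.lt_succ_self n) _ (hR.Q_mem_power hx), defect_eq_ι hF h hx,
    A.Q_ι, neg_zero] at h1
  have h2 := congr(proj 𝒱 $h1)
  rwa [proj_ι, map_zero] at h2

/-- The difference of two coalgebra morphisms whose Taylor coefficients differ by `α` in weight `m`
and by `β` in weight `m + 1`. -/
theorem perturbation {F' : Sym ℋ →ₗ[K] Sym 𝒱} (hF : IsCoalgHom ℋ 𝒱 F) (hF' : IsCoalgHom ℋ 𝒱 F')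
    {i : H →ₗ[K] V} (hi : ∀ v, proj 𝒱 (F (ι ℋ v)) = i v) {m : ℕ} {α β : Sym ℋ →ₗ[K] V}
    (hα : ∀ k ≠ m, ∀ x ∈ power ℋ k, α x = 0) (hαι : ∀ v, α (ι ℋ v) = 0)
    (hβ : ∀ k ≠ m + 1, ∀ x ∈ power ℋ k, β x = 0)
    (h : ∀ x, proj 𝒱 (F' x) = proj 𝒱 (F x) + α x + β x) (hm : m ≠ 0) :
    (∀ k < m, ∀ x ∈ power ℋ k, (F' - F) x = 0) ∧ (∀ x ∈ power ℋ m, (F' - F) x = ι 𝒱 (α x)) ∧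
      ∀ x ∈ power ℋ (m + 1), (F' - F) x = ι 𝒱 (β x) + (2⁻¹ : K) • symProd i α x := by
  have hN := hF'.isCoderAlong_sub hF
  have hp : ∀ x, proj 𝒱 ((F' - F) x) = α x + β x := fun x => by
    rw [LinearMap.sub_apply, map_sub, h]
    abel
  have h1 : ∀ k < m, ∀ x ∈ power ℋ k, (F' - F) x = 0 :=
    hN.eq_zero hF'.counit_comp hF.counit_comp hF'.map_one hF.map_one fun k hk x hx => by
      rw [hp, hα k hk.ne x hx, hβ k (by omega) x hx, add_zero]
  have h2 : ∀ x ∈ power ℋ m, (F' - F) x = ι 𝒱 (α x) := fun x hx => by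
    rw [hN.eq_ι_proj hF'.counit_comp hF.counit_comp hF'.map_one hF.map_one h1 hx, hp,
      hβ m (by omega) x hx, add_zero]
  refine ⟨h1, h2, fun x hx => ?_⟩
  have hF'ι : ∀ v, F' (ι ℋ v) = ι 𝒱 (i v) := fun v => by
    rw [hF'.map_ι, h, hαι, hβ 1 (by omega) _ (ι_mem_power v), hi, add_zero, add_zero]
  refine eq_of_euler_eq ?_ ?_
  -- After applying `euler`, which doubles the symmetrized product, the terms are matched by
  -- splitting: `(m + 1, 0)` gives `β`, while `(m, 1)` and `(1, m)` give the two products with `α`.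
  · rw [map_add, euler_ι, map_smul, euler_of_mem (symProd_mem_power i α x), smul_smul,
      Nat.cast_ofNat, inv_mul_cancel₀ two_ne_zero, one_smul, ← LinearMap.comp_apply (euler 𝒱),
      hN.euler_comp]
    have hb := rid_map_counit (ι 𝒱 ∘ₗ β) x
    rw [← LinearMap.comp_apply (ι 𝒱) β, ← hb]
    refine comul_eq_of_power
      (B := LinearMap.mul' K (Sym 𝒱) ∘ₗ TensorProduct.map (ι 𝒱 ∘ₗ proj 𝒱 ∘ₗ (F' - F)) F' +
        LinearMap.mul' K (Sym 𝒱) ∘ₗ TensorProduct.map (ι 𝒱 ∘ₗ proj 𝒱 ∘ₗ F) (F' - F))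
      (B' := (TensorProduct.rid K (Sym 𝒱)).toLinearMap ∘ₗ
          TensorProduct.map (ι 𝒱 ∘ₗ β) (counit ℋ) +
        (LinearMap.mul' K (Sym 𝒱) ∘ₗ TensorProduct.map (ι 𝒱 ∘ₗ α) (ι 𝒱 ∘ₗ i ∘ₗ proj ℋ) +
          LinearMap.mul' K (Sym 𝒱) ∘ₗ TensorProduct.map (ι 𝒱 ∘ₗ i ∘ₗ proj ℋ) (ι 𝒱 ∘ₗ α)))
      (fun k l hkl a ha b hb => ?_) hx
    simp only [LinearMap.add_apply, LinearMap.comp_apply, TensorProduct.map_tmul,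
      LinearMap.mul'_apply, LinearEquiv.coe_coe, TensorProduct.rid_tmul, hp]
    rw [← add_assoc]
    congr 1
    · rcases eq_or_ne l 0 with rfl | hl
      · obtain rfl : k = m + 1 := by omega
        obtain ⟨c, rfl⟩ := mem_power_zero hb
        simp [hα (m + 1) (by omega) a ha, hF'.map_one, counit_one, proj_one]
      · rw [hβ k (by omega) a ha, counit_of_mem_power hl hb, add_zero, map_zero, smul_zero,
          zero_add]
        rcases eq_or_ne l 1 with rfl | hl1
        · obtain ⟨v, rfl⟩ := mem_power_one hb
          rw [hF'ι, proj_ι]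
        · rw [hα k (by omega) a ha, map_zero, zero_mul, zero_mul]
    · rcases eq_or_ne k 0 with rfl | hk
      · obtain ⟨c, rfl⟩ := mem_power_zero ha
        simp [hF.map_one, proj_one]
      · rcases eq_or_ne k 1 with rfl | hk1
        · obtain rfl : l = m := by omega
          obtain ⟨v, rfl⟩ := mem_power_one ha
          rw [h2 b hb, hi, proj_ι]
        · rw [h1 l (by omega) b hb, hα l (by omega) b hb, map_zero, mul_zero, mul_zero]
  · rw [hN.counit_comp hF'.counit_comp hF.counit_comp, map_add, counit_ι, map_smul,
      counit_of_mem_power two_ne_zero (symProd_mem_power i α x), smul_zero, add_zero]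

/-- The new defect is the old one plus `A.Q ∘ (F' - F) - (F' - F) ∘ R.Q`. In weight `m` the change
is `q₁ α`, which vanishes; in weight `m + 1` it is the twisted differential of `α` plus `q₁ β`, as
`R.Q` lowers weight by one. -/
theorem proj_defect_perturbation {F' : Sym ℋ →ₗ[K] Sym 𝒱} (hR : R.IsQuadratic)
    (hF : IsCoalgHom ℋ 𝒱 F) (hF' : IsCoalgHom ℋ 𝒱 F')
    {i : H →ₗ[K] V} (hi : ∀ v, proj 𝒱 (F (ι ℋ v)) = i v) {m : ℕ} {α β : Sym ℋ →ₗ[K] V}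
    (hα : ∀ k ≠ m, ∀ x ∈ power ℋ k, α x = 0) (hαι : ∀ v, α (ι ℋ v) = 0)
    (hαq : ∀ x, A.q₁ (α x) = 0) (hβ : ∀ k ≠ m + 1, ∀ x ∈ power ℋ k, β x = 0)
    (h : ∀ x, proj 𝒱 (F' x) = proj 𝒱 (F x) + α x + β x) (hm : m ≠ 0)
    (hD : ∀ k < m + 1, ∀ x ∈ power ℋ k, proj 𝒱 (defect R A F x) = 0) :
    (∀ k < m + 1, ∀ x ∈ power ℋ k, proj 𝒱 (defect R A F' x) = 0) ∧
      ∀ x ∈ power ℋ (m + 1), proj 𝒱 (defect R A F' x) = proj 𝒱 (defect R A F x) +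
        (2⁻¹ : K) • proj 𝒱 (A.Q (symProd i α x)) - α (R.Q x) + A.q₁ (β x) := by
  obtain ⟨h1, h2, h3⟩ := perturbation hF hF' hi hα hαι hβ h hm
  have hdiff : ∀ x, defect R A F' x = defect R A F x + A.Q ((F' - F) x) - (F' - F) (R.Q x) := by
    intro x
    simp only [defect_apply, LinearMap.sub_apply, map_sub]
    abel
  constructor
  · intro k hk x hx
    have hRx : (F' - F) (R.Q x) = 0 := by
      cases k with
      | zero =>
        obtain ⟨c, rfl⟩ := mem_power_zero hx
        rw [map_smul, R.Q_one, smul_zero, map_zero]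
      | succ k => exact h1 k (by omega) _ (hR.Q_mem_power hx)
    have hQ : A.Q ((F' - F) x) = 0 := by
      rcases eq_or_ne k m with rfl | hkm
      · rw [h2 x hx, A.Q_ι, hαq, map_zero]
      · rw [h1 k (by omega) x hx, map_zero]
    rw [hdiff, hRx, hQ, add_zero, sub_zero, hD k hk x hx]
  · intro x hx
    rw [hdiff, h3 x hx, h2 _ (hR.Q_mem_power hx), map_sub, map_add, map_add, A.Q_ι, map_add,
      proj_ι, proj_ι, map_smul, map_smul]
    abel

end Defect

end LInftyStr

end LInfty

namespace LInfty

/-! ### Invariant solutions and equivariant generalized inverses from semisimplicity. -/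

section Semisimple

variable {K G X Y : Type*} [Field K] [Group G] [AddCommGroup X] [Module K X] [AddCommGroup Y]
  [Module K Y]

/-- In a semisimple representation, an equivariant affine condition that has a solution has an
invariant solution. -/
theorem exists_invariant (τ : Representation K G X) (hτ : τ.IsSemisimpleRepresentation)
    (δ : X →ₗ[K] Y) (hker : ∀ g x, δ x = 0 → δ (τ g x) = 0) (x : X)
    (hx : ∀ g, δ (τ g x) = δ x) : ∃ y, δ y = δ x ∧ ∀ g, τ g y = y := by
  let N : Subrepresentation τ := ⟨LinearMap.ker δ, fun g x hx => hker g x hx⟩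
  -- The component `y` of the given solution in an invariant complement of the kernel is again a
  -- solution, and it is fixed: `τ g y - y` lies both in the kernel and in the complement.
  obtain ⟨C, hC⟩ := hτ.exists_isCompl N
  have hsup : x ∈ (N ⊔ C).toSubmodule := by
    rw [hC.sup_eq_top]
    exact Submodule.mem_top
  rw [Subrepresentation.toSubmodule_sup, Submodule.mem_sup] at hsup
  obtain ⟨k, hk, y, hy, rfl⟩ := hsup
  have hk' : δ k = 0 := hk
  have hδ : δ y = δ (k + y) := by rw [map_add, hk', zero_add]
  refine ⟨y, hδ, fun g => ?_⟩
  have h1 : τ g y - y ∈ (N ⊓ C).toSubmodule := by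
    refine ⟨?_, sub_mem (C.apply_mem_toSubmodule g hy) hy⟩
    have := hx g
    rw [map_add, map_add, hker g k hk', zero_add, ← hδ] at this
    exact LinearMap.mem_ker.mpr (by rw [map_sub, this, sub_self])
  rw [hC.inf_eq_bot] at h1
  exact sub_eq_zero.mp ((Submodule.mem_bot K).mp h1)

/-- An equivariant map between semisimple representations has an equivariant generalized inverse. -/
theorem exists_generalized_inverse (ρ : Representation K G X) (σ : Representation K G Y)
    (hρ : ρ.IsSemisimpleRepresentation) (hσ : σ.IsSemisimpleRepresentation) (d : X →ₗ[K] Y)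
    (hd : ∀ g x, d (ρ g x) = σ g (d x)) :
    ∃ h : Y →ₗ[K] X, (∀ g y, h (σ g y) = ρ g (h y)) ∧ ∀ x, d (h (d x)) = d x := by
  rw [Representation.isSemisimpleRepresentation_iff_isSemisimpleModule_asModule] at hρ hσ
  let D := Representation.IntertwiningMap.equivLinearMapAsModule ρ σ
    (d.intertwiningMap_of_isIntertwiningMap ρ σ hd)
  -- Semisimplicity of the source splits the surjection onto the image; semisimplicity of the target
  -- extends the splitting from the image to everything.
  obtain ⟨s, hs⟩ := IsSemisimpleModule.lifting_property D.rangeRestrict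
    D.surjective_rangeRestrict LinearMap.id
  obtain ⟨h, hh⟩ := IsSemisimpleModule.extension_property (LinearMap.range D).subtype
    Subtype.val_injective s
  let h' := (Representation.IntertwiningMap.equivLinearMapAsModule σ ρ).symm h
  refine ⟨h'.toLinearMap, fun g y => Representation.IntertwiningMap.isIntertwining σ ρ h' g y, fun x => ?_⟩
  have h1 : h (D x) = s ⟨D x, x, rfl⟩ := congr($hh ⟨D x, x, rfl⟩)
  have h2 : D (s ⟨D x, x, rfl⟩) = D x := congrArg Subtype.val congr($hs ⟨D x, x, rfl⟩)
  rw [← h1] at h2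
  exact h2

variable {V : Type*} [AddCommGroup V] [Module K V] {𝒱 : ℤ → Submodule K V}
  [DirectSum.Decomposition 𝒱]

theorem exists_homotopy (ρ : Representation K G V) (hρ : IsGradedRep 𝒱 ρ)
    (hV : ∀ i : ℤ, (gradedPiece ρ hρ i).toRepresentation.IsSemisimpleRepresentation)
    (d : V →ₗ[K] V) (hd : HasDegree 𝒱 𝒱 1 d) (hdρ : ∀ g v, ρ g (d v) = d (ρ g v)) :
    ∃ h : V →ₗ[K] V, HasDegree 𝒱 𝒱 (-1) h ∧ (∀ g v, ρ g (h v) = h (ρ g v)) ∧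
      ∀ v, d (h (d v)) = d v := by
  have hd' : ∀ i : ℤ, ∀ v ∈ 𝒱 (i - 1), d v ∈ 𝒱 i := fun i v hv => by
    have := hd _ v hv
    rwa [sub_add_cancel] at this
  have hg : ∀ (i : ℤ) g, ∀ v ∈ 𝒱 i, ρ g v ∈ 𝒱 i := fun i g v hv =>
    (gradedPiece ρ hρ i).apply_mem_toSubmodule g hv
  have key : ∀ i : ℤ, ∃ h : 𝒱 i →ₗ[K] 𝒱 (i - 1),
      (∀ g (v : 𝒱 i), (h ⟨ρ g v, hg i g v v.2⟩ : V) = ρ g (h v)) ∧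
      ∀ v : 𝒱 (i - 1), d (h ⟨d v, hd' i v v.2⟩) = d v := fun i => by
    obtain ⟨h, hh1, hh2⟩ := exists_generalized_inverse
      (gradedPiece ρ hρ (i - 1)).toRepresentation (gradedPiece ρ hρ i).toRepresentation
      (hV (i - 1)) (hV i) (d.restrict (hd' i)) (fun g v => Subtype.ext (hdρ g v).symm)
    exact ⟨h, fun g v => congrArg Subtype.val (hh1 g v), fun v => congrArg Subtype.val (hh2 v)⟩
  choose h hh1 hh2 using key
  let s : V →ₗ[K] V := DirectSum.toModule K ℤ V
    (fun i => (𝒱 (i - 1)).subtype ∘ₗ h i) ∘ₗ (DirectSum.decomposeLinearEquiv 𝒱).toLinearMap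
  have hs : ∀ (i : ℤ) (v : 𝒱 i), s v = (h i v : V) := by
    intro i v
    simp only [s, LinearMap.comp_apply, LinearEquiv.coe_coe, DirectSum.decomposeLinearEquiv_apply]
    rw [DirectSum.decompose_coe, ← DirectSum.lof_eq_of K, DirectSum.toModule_lof]
    rfl
  refine ⟨s, fun i v hv => ?_, fun g v => ?_, fun v => ?_⟩
  · rw [hs i ⟨v, hv⟩]
    exact (h i ⟨v, hv⟩).2
  · induction v using DirectSum.Decomposition.inductionOn 𝒱 with
    | zero => simp
    | @homogeneous i v =>
      rw [hs i v, hs i ⟨ρ g v, hg i g v v.2⟩, hh1]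
    | add v w hv hw => simp only [map_add, hv, hw]
  · induction v using DirectSum.Decomposition.inductionOn 𝒱 with
    | zero => simp
    | @homogeneous i v =>
      -- The inverses are indexed by the degree of their source, so a vector of degree `i` is
      -- handled by the one at `i + 1`.
      have hv : (v : V) ∈ 𝒱 (i + 1 - 1) := by rw [add_sub_cancel_right]; exact v.2
      have h1 := hh2 (i + 1) ⟨v, hv⟩
      have h2 := hs (i + 1) ⟨d v, hd i v v.2⟩
      dsimp only at h2
      rw [h2]
      exact h1
    | add v w hv hw => simp only [map_add, hv, hw]

end Semisimple

namespace Sym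

variable {K V W : Type*} [Field K] [AddCommGroup V] [Module K V] [AddCommGroup W] [Module K W]
  {𝒱 : ℤ → Submodule K V} {𝒲 : ℤ → Submodule K W}

theorem ofWeights_hasDegree {j : ℤ} {f : ℕ → Sym 𝒱 →ₗ[K] W}
    (hf : ∀ n, HasDegree (grading 𝒱) 𝒲 j (f n)) : HasDegree (grading 𝒱) 𝒲 j (ofWeights f) := by
  intro d x hx
  obtain ⟨N, hN⟩ := exists_mem_below x
  have h : below 𝒱 N ≤ LinearMap.eqLocus (ofWeights f)
      (∑ k ∈ Finset.range N, f k ∘ₗ wproj 𝒱 k) := below_le fun k hk x hx => by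
    rw [LinearMap.mem_eqLocus, ofWeights_of_mem _ hx, LinearMap.sum_apply,
      Finset.sum_eq_single_of_mem k (Finset.mem_range.mpr hk) fun l _ hl => by
        rw [LinearMap.comp_apply, wproj_of_mem_ne hx hl.symm, map_zero],
      LinearMap.comp_apply, wproj_of_mem_same hx]
  rw [h hN, LinearMap.sum_apply]
  exact Submodule.sum_mem _ fun k _ => hf k d _ (wproj_mem_grading k hx)

end Sym

namespace LInftyStr

open LInfty.Sym

variable {K G V H : Type*} [Field K] [CharZero K] [Group G] [AddCommGroup V] [Module K V]
  [AddCommGroup H] [Module K H] {𝒱 : ℤ → Submodule K V} [DirectSum.Decomposition 𝒱]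
  {ℋ : ℤ → Submodule K H} [DirectSum.Decomposition ℋ]
  {ρ : Representation K G V} {τ : Representation K G H}

theorem symProd_hasDegree {i : H →ₗ[K] V} (hi : HasDegree ℋ 𝒱 0 i) {φ : Sym ℋ →ₗ[K] V}
    (hφ : HasDegree (grading ℋ) 𝒱 0 φ) :
    HasDegree (grading ℋ) (grading 𝒱) 0 (symProd i φ) := by
  have h1 : HasDegree (grading ℋ) (grading 𝒱) 0 (ι 𝒱 ∘ₗ φ) := ι_hasDegree.comp hφ (add_zero 0)
  have h2 : HasDegree (grading ℋ) (grading 𝒱) 0 (ι 𝒱 ∘ₗ i ∘ₗ proj ℋ) :=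
    ι_hasDegree.comp (hi.comp proj_hasDegree (add_zero 0)) (add_zero 0)
  exact (conv_hasDegree h1 h2).add (conv_hasDegree h2 h1)

theorem map_symProd {H' V' : Type*} [AddCommGroup H'] [Module K H'] [AddCommGroup V'] [Module K V']
    {ℋ' : ℤ → Submodule K H'} [DirectSum.Decomposition ℋ'] {𝒱' : ℤ → Submodule K V'}
    [DirectSum.Decomposition 𝒱'] {i : H →ₗ[K] V} {i' : H' →ₗ[K] V'}
    {a : H →ₗ[K] H'} (ha : HasDegree ℋ ℋ' 0 a) {b : V →ₗ[K] V'} (hb : HasDegree 𝒱 𝒱' 0 b)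
    (hi : ∀ v, b (i v) = i' (a v)) {φ : Sym ℋ →ₗ[K] V} {φ' : Sym ℋ' →ₗ[K] V'}
    (hφ : ∀ x, b (φ x) = φ' (map a ha x)) (x : Sym ℋ) :
    map b hb (symProd i φ x) = symProd i' φ' (map a ha x) := by
  have h1 : (map b hb).toLinearMap ∘ₗ ι 𝒱 ∘ₗ φ = (ι 𝒱' ∘ₗ φ') ∘ₗ (map a ha).toLinearMap := by
    ext x
    simp [hφ]
  have h2 : (map b hb).toLinearMap ∘ₗ ι 𝒱 ∘ₗ i ∘ₗ proj ℋ =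
      (ι 𝒱' ∘ₗ i' ∘ₗ proj ℋ') ∘ₗ (map a ha).toLinearMap := by
    ext x
    simp [hi, proj_map]
  simp only [symProd, LinearMap.add_apply, map_add]
  rw [algHom_conv_apply, algHom_conv_apply, h1, h2]
  have h3 := fun f g => conv_comp_apply (A := Sym 𝒱') f g (isCoalgHom_map a ha) x
  simp only [AlgHom.toLinearMap_apply] at h3
  rw [h3, h3]

/-! ### Correcting an equivariant morphism in two consecutive weights, and the limit of the
corrections. -/

section Extension

variable {hρ : IsGradedRep 𝒱 ρ} {hτ : IsGradedRep ℋ τ} {R : LInftyStr ℋ} {A : LInftyStr 𝒱}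

theorem proj_defect_map_comm {F : Sym ℋ →ₗ[K] Sym 𝒱} (hF : IsCoalgHom ℋ 𝒱 F) {a : H →ₗ[K] H}
    (ha : HasDegree ℋ ℋ 0 a) {b : V →ₗ[K] V} (hb : HasDegree 𝒱 𝒱 0 b)
    (hA : ∀ x, b (proj 𝒱 (A.Q x)) = proj 𝒱 (A.Q (map b hb x)))
    (hR : ∀ x, a (proj ℋ (R.Q x)) = proj ℋ (R.Q (map a ha x)))
    (h : ∀ x, b (proj 𝒱 (F x)) = proj 𝒱 (F (map a ha x))) (x : Sym ℋ) :
    b (proj 𝒱 (defect R A F x)) = proj 𝒱 (defect R A F (map a ha x)) := by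
  rw [defect_apply, defect_apply, map_sub, map_sub, map_sub, hA, hF.map_comm ha hb h, h,
    R.Q_map_comm ha hR]

/-- An equivariant coalgebra morphism which is compatible with the codifferentials in weights at
most `m` can be corrected in the weights `m` and `m + 1` if its obstruction is killed by `α`. -/
theorem exists_extension (hR : R.IsQuadratic)
    (hAρ : ∀ g x, ρ g (proj 𝒱 (A.Q x)) = proj 𝒱 (A.Q (map (ρ g) (hρ g) x)))
    (hRτ : ∀ g x, τ g (proj ℋ (R.Q x)) = proj ℋ (R.Q (map (τ g) (hτ g) x)))
    {h : V →ₗ[K] V} (hh : HasDegree 𝒱 𝒱 (-1) h) (hhρ : ∀ g v, ρ g (h v) = h (ρ g v))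
    (hhq : ∀ v, A.q₁ (h (A.q₁ v)) = A.q₁ v)
    {i : H →ₗ[K] V} (hi : HasDegree ℋ 𝒱 0 i) (hiρ : ∀ g v, ρ g (i v) = i (τ g v))
    {F : Sym ℋ →ₗ[K] Sym 𝒱} (hF : IsCoalgHom ℋ 𝒱 F)
    (hFρ : ∀ g x, ρ g (proj 𝒱 (F x)) = proj 𝒱 (F (map (τ g) (hτ g) x)))
    (hFi : ∀ v, proj 𝒱 (F (ι ℋ v)) = i v) {m : ℕ} (hm : m ≠ 0)
    (hD : ∀ k < m + 1, ∀ x ∈ power ℋ k, proj 𝒱 (defect R A F x) = 0)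
    {α : Sym ℋ →ₗ[K] V} (hα : HasDegree (grading ℋ) 𝒱 0 α)
    (hαρ : ∀ g x, ρ g (α x) = α (map (τ g) (hτ g) x))
    (hαm : ∀ k ≠ m, ∀ x ∈ power ℋ k, α x = 0) (hαι : ∀ v, α (ι ℋ v) = 0)
    (hαq : ∀ x, A.q₁ (α x) = 0)
    (hex : ∀ x ∈ power ℋ (m + 1), proj 𝒱 (defect R A F x) +
      (2⁻¹ : K) • proj 𝒱 (A.Q (symProd i α x)) - α (R.Q x) ∈ LinearMap.range A.q₁) :
    ∃ F' : Sym ℋ →ₗ[K] Sym 𝒱, IsCoalgHom ℋ 𝒱 F' ∧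
      (∀ g x, ρ g (proj 𝒱 (F' x)) = proj 𝒱 (F' (map (τ g) (hτ g) x))) ∧
      (∀ v, proj 𝒱 (F' (ι ℋ v)) = i v) ∧
      (∀ k < m + 2, ∀ x ∈ power ℋ k, proj 𝒱 (defect R A F' x) = 0) ∧
      ∀ k < m, ∀ x ∈ power ℋ k, proj 𝒱 (F' x) = proj 𝒱 (F x) := by
  -- In weight `m + 1`, `o` is the defect coefficient that remains after the correction by `α`
  -- alone.
  let o : Sym ℋ →ₗ[K] V := proj 𝒱 ∘ₗ defect R A F +
    (2⁻¹ : K) • (proj 𝒱 ∘ₗ A.Q ∘ₗ symProd i α) - α ∘ₗ R.Q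
  have ho : HasDegree (grading ℋ) 𝒱 1 o := by
    have hAd := A.isCoderivation.degree
    have hRd := R.isCoderivation.degree
    refine HasDegree.sub (HasDegree.add ?_ (HasDegree.smul _ ?_)) (hα.comp hRd (add_zero 1))
    · exact proj_hasDegree.comp ((hAd.comp hF.degree (zero_add 1)).sub
        (hF.degree.comp hRd (add_zero 1))) (add_zero 1)
    · exact proj_hasDegree.comp (hAd.comp (symProd_hasDegree hi hα) (zero_add 1)) (add_zero 1)
  have hoρ : ∀ g x, ρ g (o x) = o (map (τ g) (hτ g) x) := by
    intro g x
    simp only [o, LinearMap.sub_apply, LinearMap.add_apply, LinearMap.smul_apply,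
      LinearMap.comp_apply, map_add, map_sub, map_smul]
    rw [proj_defect_map_comm hF (hτ g) (hρ g) (hAρ g) (hRτ g) (hFρ g), hAρ, hαρ,
      map_symProd (hτ g) (hρ g) (hiρ g) (hαρ g), R.Q_map_comm (hτ g) (hRτ g)]
  -- In weight `m + 1`, `o` takes values in coboundaries, on which `q₁ h` is the identity, so `q₁ β`
  -- cancels it. Equivariance of `h` and `o` makes `β` equivariant.
  let β : Sym ℋ →ₗ[K] V := -(h ∘ₗ o ∘ₗ wproj ℋ (m + 1))
  have hβ : HasDegree (grading ℋ) 𝒱 0 β :=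
    (hh.comp (ho.comp (wproj_hasDegree _) (zero_add 1)) (by norm_num)).neg
  have hβm : ∀ k ≠ m + 1, ∀ x ∈ power ℋ k, β x = 0 := by
    intro k hk x hx
    simp [β, wproj_of_mem_ne hx hk]
  let f : Sym ℋ →ₗ[K] V := proj 𝒱 ∘ₗ F + α + β
  have hf1 : f 1 = 0 := by
    simp only [f, LinearMap.add_apply, LinearMap.comp_apply]
    rw [hF.proj_one, hαm 0 hm.symm 1 one_mem_power, hβm 0 (by omega) 1 one_mem_power, add_zero,
      add_zero]
  have hfdeg : HasDegree (grading ℋ) 𝒱 0 f :=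
    ((proj_hasDegree.comp hF.degree (add_zero 0)).add hα).add hβ
  have hF' := isCoalgHom_coexp hf1 hfdeg
  have hF'p : ∀ x, proj 𝒱 (coexp 𝒱 f x) = proj 𝒱 (F x) + α x + β x := fun x => proj_coexp hf1 x
  obtain ⟨h1, h2⟩ := proj_defect_perturbation hR hF hF' hFi hαm hαι hαq hβm hF'p hm hD
  refine ⟨coexp 𝒱 f, hF', fun g x => ?_, fun v => ?_, fun k hk x hx => ?_, fun k hk x hx => ?_⟩
  · rw [hF'p, hF'p, map_add, map_add, hFρ, hαρ]
    congr 1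
    simp only [β, LinearMap.neg_apply, LinearMap.comp_apply, map_neg]
    rw [hhρ, hoρ, wproj_map]
  · rw [hF'p, hFi, hαι, hβm 1 (by omega) _ (ι_mem_power v), add_zero, add_zero]
  · rcases eq_or_ne k (m + 1) with rfl | hkm
    · rw [h2 x hx]
      obtain ⟨z, hz⟩ := hex x hx
      have hox : o x = A.q₁ z := hz.symm
      simp only [β, LinearMap.neg_apply, LinearMap.comp_apply, map_neg]
      rw [wproj_of_mem_same hx, hox, hhq, ← hox]
      simp [o]
    · exact h1 k (by omega) x hx
  · rw [hF'p, hαm k hk.ne x hx, hβm k (by omega) x hx, add_zero, add_zero]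

/-- The limit of a sequence of equivariant coalgebra morphisms that are compatible with the
codifferentials in more and more weights. -/
theorem exists_limit (hR : R.IsQuadratic) {i : H →ₗ[K] V} (F : ℕ → Sym ℋ →ₗ[K] Sym 𝒱)
    (hF : ∀ s, IsCoalgHom ℋ 𝒱 (F s))
    (hFρ : ∀ s g x, ρ g (proj 𝒱 (F s x)) = proj 𝒱 (F s (map (τ g) (hτ g) x)))
    (hFi : ∀ s v, proj 𝒱 (F s (ι ℋ v)) = i v)
    (hD : ∀ s, ∀ k < s + 2, ∀ x ∈ power ℋ k, proj 𝒱 (defect R A (F s) x) = 0)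
    (hs : ∀ s, ∀ k < s + 1, ∀ x ∈ power ℋ k, proj 𝒱 (F (s + 1) x) = proj 𝒱 (F s x)) :
    ∃ F' : Sym ℋ →ₗ[K] Sym 𝒱, IsMorphism R A F' ∧
      (∀ g x, ρ g (proj 𝒱 (F' x)) = proj 𝒱 (F' (map (τ g) (hτ g) x))) ∧
      ∀ v, proj 𝒱 (F' (ι ℋ v)) = i v := by
  have hst : ∀ k t, ∀ x ∈ power ℋ k, proj 𝒱 (F (k + t) x) = proj 𝒱 (F k x) := by
    intro k t x hx
    induction t with
    | zero => rfl
    | succ t ih => rw [← add_assoc, hs (k + t) k (by omega) x hx, ih]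
  -- In weight `k` the sequence is constant from stage `k` on, so stage `k` already gives the
  -- limiting coefficient.
  let f : Sym ℋ →ₗ[K] V := ofWeights fun k => proj 𝒱 ∘ₗ F k
  have hf : ∀ {k : ℕ} {x : Sym ℋ}, x ∈ power ℋ k → f x = proj 𝒱 (F k x) := fun hx =>
    ofWeights_of_mem _ hx
  have hf1 : f 1 = 0 := by rw [hf one_mem_power, (hF 0).proj_one]
  have hfdeg : HasDegree (grading ℋ) 𝒱 0 f :=
    ofWeights_hasDegree fun k => proj_hasDegree.comp (hF k).degree (add_zero 0)
  have hF' := isCoalgHom_coexp hf1 hfdeg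
  have hp : ∀ x, proj 𝒱 (coexp 𝒱 f x) = f x := proj_coexp hf1
  have heq : ∀ s, ∀ k < s + 1, ∀ x ∈ power ℋ k, coexp 𝒱 f x = F s x := by
    intro s k hk x hx
    refine sub_eq_zero.mp ((hF'.isCoderAlong_sub (hF s)).eq_zero hF'.counit_comp
      (hF s).counit_comp hF'.map_one (hF s).map_one (n := s + 1) (fun l hl y hy => ?_) k hk x hx)
    obtain ⟨t, rfl⟩ := Nat.exists_eq_add_of_le (Nat.lt_succ_iff.mp hl)
    rw [LinearMap.sub_apply, map_sub, hp, hf hy, hst l t y hy, sub_self]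
  refine ⟨coexp 𝒱 f, ⟨hF', ?_⟩, fun g x => ?_, fun v => ?_⟩
  · refine hom_ext_power fun k x hx => ?_
    have h0 := defect_eq_zero (hF k) (hD k) k (by omega) x hx
    rw [defect_apply, sub_eq_zero] at h0
    rw [LinearMap.comp_apply, LinearMap.comp_apply, heq k k (by omega) x hx, h0]
    cases k with
    | zero =>
      obtain ⟨c, rfl⟩ := mem_power_zero hx
      rw [map_smul, R.Q_one, smul_zero, map_zero, map_zero]
    | succ k => exact heq (k + 1) k (by omega) _ (hR.Q_mem_power hx)
  · have h : ρ g ∘ₗ f = f ∘ₗ (map (τ g) (hτ g)).toLinearMap := hom_ext_power fun k x hx => by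
      simp only [LinearMap.comp_apply, AlgHom.toLinearMap_apply]
      rw [hf hx, hf (map_mem_power _ _ k hx), hFρ]
    rw [hp, hp]
    exact congr($h x)
  · rw [hp, hf (ι_mem_power v), hFi]

end Extension

end LInftyStr

end LInfty

namespace LInfty

/-! ### Invariant primitives of the obstruction and the inductive step. -/

namespace LInftyStr

open LInfty.Sym

variable {K G V H : Type*} [Field K] [CharZero K] [Group G] [AddCommGroup V] [Module K V]
  [AddCommGroup H] [Module K H] {𝒱 : ℤ → Submodule K V} [DirectSum.Decomposition 𝒱]
  {ℋ : ℤ → Submodule K H} [DirectSum.Decomposition ℋ]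
  {ρ : Representation K G V} {τ : Representation K G H}
  {hρ : IsGradedRep 𝒱 ρ} {hτ : IsGradedRep ℋ τ} {R : LInftyStr ℋ} {A : LInftyStr 𝒱}

theorem symProd_add (f : H →ₗ[K] V) (φ ψ : Sym ℋ →ₗ[K] V) (x : Sym ℋ) :
    symProd (𝒱 := 𝒱) f (φ + ψ) x = symProd f φ x + symProd f ψ x := by
  simp only [symProd, LinearMap.add_apply, conv_apply, LinearMap.comp_add,
    TensorProduct.map_add_left, TensorProduct.map_add_right, map_add]
  abel

theorem symProd_smul (f : H →ₗ[K] V) (c : K) (φ : Sym ℋ →ₗ[K] V) (x : Sym ℋ) :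
    symProd (𝒱 := 𝒱) f (c • φ) x = c • symProd f φ x := by
  simp only [symProd, LinearMap.add_apply, conv_apply, LinearMap.comp_smul,
    TensorProduct.map_smul_left, TensorProduct.map_smul_right, LinearMap.smul_apply, map_smul,
    smul_add]

/-- The differential of `φ` in the complex of coderivations of `(S^c(H), R)`. -/
def bracketDiff (R : LInftyStr ℋ) : (Sym ℋ →ₗ[K] H) →ₗ[K] Sym ℋ →ₗ[K] H where
  toFun φ := (2⁻¹ : K) • (proj ℋ ∘ₗ R.Q ∘ₗ symProd LinearMap.id φ) - φ ∘ₗ R.Q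
  map_add' φ ψ := by
    ext x
    simp only [LinearMap.sub_apply, LinearMap.smul_apply, LinearMap.comp_apply,
      LinearMap.add_apply, symProd_add, map_add, smul_add]
    abel
  map_smul' c φ := by
    ext x
    simp only [LinearMap.sub_apply, LinearMap.smul_apply, LinearMap.comp_apply,
      symProd_smul, map_smul, smul_sub, RingHom.id_apply]
    rw [smul_comm]

theorem bracketDiff_apply (φ : Sym ℋ →ₗ[K] H) (x : Sym ℋ) : bracketDiff R φ x =
    (2⁻¹ : K) • proj ℋ (R.Q (symProd LinearMap.id φ x)) - φ (R.Q x) := rfl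

theorem bracketDiff_congr (hR : R.IsQuadratic) {φ φ' : Sym ℋ →ₗ[K] H} {n : ℕ}
    (h : ∀ x ∈ power ℋ n, φ x = φ' x) {x : Sym ℋ} (hx : x ∈ power ℋ (n + 1)) :
    bracketDiff R φ x = bracketDiff R φ' x := by
  rw [bracketDiff_apply, bracketDiff_apply, symProd_congr _ h hx, h _ (hR.Q_mem_power hx)]

theorem bracketDiff_map {a : H →ₗ[K] H} (ha : HasDegree ℋ ℋ 0 a)
    (hR : ∀ x, a (proj ℋ (R.Q x)) = proj ℋ (R.Q (map a ha x))) {φ φ' : Sym ℋ →ₗ[K] H}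
    (h : ∀ x, a (φ x) = φ' (map a ha x)) (x : Sym ℋ) :
    a (bracketDiff R φ x) = bracketDiff R φ' (map a ha x) := by
  rw [bracketDiff_apply, bracketDiff_apply, map_sub, map_smul, hR, h,
    map_symProd ha ha (i' := LinearMap.id) (fun _ => rfl) h, R.Q_map_comm ha hR]

/-- The extension by zero of a linear map on `V^{⊙m}`. -/
def extendPower (m : ℕ) : (power ℋ m →ₗ[K] H) →ₗ[K] Sym ℋ →ₗ[K] H :=
  LinearMap.lcomp K H ((wproj ℋ m).codRestrict (power ℋ m) fun x => wproj_mem m x)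

theorem map_map_inv (g : G) (x : Sym ℋ) : map (τ g) (hτ g) (map (τ g⁻¹) (hτ g⁻¹) x) = x := by
  have h : symRep τ hτ g (symRep τ hτ g⁻¹ x) = x := Representation.self_inv_apply _ g x
  exact h

theorem map_inv_map (g : G) (x : Sym ℋ) : map (τ g⁻¹) (hτ g⁻¹) (map (τ g) (hτ g) x) = x := by
  have h : symRep τ hτ g⁻¹ (symRep τ hτ g x) = x := Representation.inv_self_apply _ g x
  exact h

theorem extendPower_linHom (m : ℕ) (g : G) (φ : power ℋ m →ₗ[K] H) (x : Sym ℋ) :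
    extendPower m (Representation.linHom (powerRep τ hτ m).toRepresentation τ g φ)
      (map (τ g) (hτ g) x) = τ g (extendPower m φ x) := by
  change τ g (φ ⟨map (τ g⁻¹) (hτ g⁻¹) (wproj ℋ m (map (τ g) (hτ g) x)), _⟩) =
    τ g (φ ⟨wproj ℋ m x, _⟩)
  congr 3
  rw [wproj_map, map_inv_map]

/-- The bracket differential commutes with the action. An invariant target with any primitive thus
satisfies the assumptions of `exists_invariant` on the semisimple space of degree `0` coefficients.
-/
theorem exists_invariant_primitive (hR : R.IsQuadratic)
    (hRτ : ∀ g x, τ g (proj ℋ (R.Q x)) = proj ℋ (R.Q (map (τ g) (hτ g) x))) {m : ℕ}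
    (hHom : (homRep τ hτ 0 m).toRepresentation.IsSemisimpleRepresentation)
    {ω : Sym ℋ →ₗ[K] H} (hω : ∀ g x, τ g (ω x) = ω (map (τ g) (hτ g) x))
    {ψ : Sym ℋ →ₗ[K] H} (hψ : HasDegree (grading ℋ) ℋ 0 ψ)
    (h : ∀ x ∈ power ℋ (m + 1), bracketDiff R ψ x = ω x) :
    ∃ φ : Sym ℋ →ₗ[K] H, HasDegree (grading ℋ) ℋ 0 φ ∧
      (∀ g x, τ g (φ x) = φ (map (τ g) (hτ g) x)) ∧ (∀ k ≠ m, ∀ x ∈ power ℋ k, φ x = 0) ∧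
      ∀ x ∈ power ℋ (m + 1), bracketDiff R φ x = ω x := by
  -- Precomposition with the projection to weight `m + 1` makes agreement in that weight an equality
  -- of linear maps.
  let δ : (homRep τ hτ 0 m).toSubmodule →ₗ[K] Sym ℋ →ₗ[K] H :=
    LinearMap.lcomp K H (wproj ℋ (m + 1)) ∘ₗ bracketDiff R ∘ₗ extendPower m ∘ₗ
      (homRep τ hτ 0 m).toSubmodule.subtype
  have hδ : ∀ φ x, δ φ x = bracketDiff R (extendPower m φ.1) (wproj ℋ (m + 1) x) :=
    fun _ _ => rfl
  have hδg : ∀ g φ x, δ ((homRep τ hτ 0 m).toRepresentation g φ) (map (τ g) (hτ g) x) =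
      τ g (δ φ x) := fun g φ x => by
    rw [hδ, hδ, bracketDiff_map (hτ g) (hRτ g) fun x => (extendPower_linHom m g φ.1 x).symm,
      wproj_map]
    rfl
  let ψ' : (homRep τ hτ 0 m).toSubmodule :=
    ⟨ψ ∘ₗ (power ℋ m).subtype, fun i x hx => hψ i x hx⟩
  have hψ' : ∀ x, δ ψ' x = ω (wproj ℋ (m + 1) x) := fun x => by
    rw [hδ, ← h _ (wproj_mem _ x)]
    refine bracketDiff_congr hR (fun y hy => ?_) (wproj_mem _ x)
    change ψ (wproj ℋ m y) = ψ y
    rw [wproj_of_mem_same hy]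
  obtain ⟨φ, hφ, hφg⟩ := exists_invariant _ hHom δ
    (fun g φ hφ => LinearMap.ext fun x => by
      rw [← map_map_inv (hτ := hτ) g x, hδg, hφ]
      simp)
    ψ' (fun g => LinearMap.ext fun x => by
      rw [← map_map_inv (hτ := hτ) g x, hδg, hψ', hψ', hω, wproj_map, map_map_inv,
        map_map_inv])
  refine ⟨extendPower m φ.1, fun d x hx => ?_, fun g x => ?_, fun k hk x hx => ?_, fun x hx => ?_⟩
  · exact φ.2 d ⟨_, wproj_mem m x⟩ (wproj_mem_grading m hx)
  · exact (extendPower_linHom m g φ.1 x).symm.trans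
      congr(extendPower m $(congrArg Subtype.val (hφg g)) _)
  · change φ.1 ⟨wproj ℋ m x, wproj_mem m x⟩ = 0
    have : (⟨wproj ℋ m x, wproj_mem m x⟩ : power ℋ m) = 0 :=
      Subtype.ext (wproj_of_mem_ne hx hk)
    exact (congrArg φ.1 this).trans (map_zero φ.1)
  · have h1 := congr($hφ x)
    rwa [hδ, hψ', wproj_of_mem_same hx] at h1

theorem IsQuadratic.q₁_eq_zero (hR : R.IsQuadratic) (v : H) : R.q₁ v = 0 :=
  hR 1 (by norm_num) _ (ι_mem_power v)

theorem IsMorphism.linearPart_q₁ {F : Sym 𝒱 →ₗ[K] Sym ℋ} (hF : IsMorphism A R F) (v : V) :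
    linearPart F (A.q₁ v) = R.q₁ (linearPart F v) := by
  have h := congr(proj ℋ ($(hF.comp_Q) (ι 𝒱 v)))
  rw [LinearMap.comp_apply, LinearMap.comp_apply, A.Q_ι, hF.isCoalgHom.map_ι v, R.Q_ι,
    proj_ι] at h
  exact h

/-- One step of the construction of an equivariant morphism by obstruction theory. -/
theorem exists_next (hR : R.IsQuadratic)
    (hAρ : ∀ g x, ρ g (proj 𝒱 (A.Q x)) = proj 𝒱 (A.Q (map (ρ g) (hρ g) x)))
    (hRτ : ∀ g x, τ g (proj ℋ (R.Q x)) = proj ℋ (R.Q (map (τ g) (hτ g) x)))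
    (hHom : ∀ n, 2 ≤ n → (homRep τ hτ 0 n).toRepresentation.IsSemisimpleRepresentation)
    {h : V →ₗ[K] V} (hh : HasDegree 𝒱 𝒱 (-1) h) (hhρ : ∀ g v, ρ g (h v) = h (ρ g v))
    (hhq : ∀ v, A.q₁ (h (A.q₁ v)) = A.q₁ v)
    {i : H →ₗ[K] V} (hi : HasDegree ℋ 𝒱 0 i) (hiρ : ∀ g v, ρ g (i v) = i (τ g v))
    (hiq : ∀ v, A.q₁ (i v) = 0)
    (his : ∀ v, A.q₁ v = 0 → ∃ w, v - i w ∈ LinearMap.range A.q₁)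
    (hib : ∀ x ∈ power ℋ 2, proj 𝒱 (A.Q (map i hi x)) - i (proj ℋ (R.Q x)) ∈
      LinearMap.range A.q₁)
    {P : Sym 𝒱 →ₗ[K] Sym ℋ} (hP : IsMorphism A R P) (γ : H ≃ₗ[K] H)
    (hγ : ∀ v, linearPart P (i v) = γ v)
    {F : Sym ℋ →ₗ[K] Sym 𝒱} (hF : IsCoalgHom ℋ 𝒱 F)
    (hFρ : ∀ g x, ρ g (proj 𝒱 (F x)) = proj 𝒱 (F (map (τ g) (hτ g) x)))
    (hFi : ∀ v, proj 𝒱 (F (ι ℋ v)) = i v) {m : ℕ} (hm : 2 ≤ m)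
    (hD : ∀ k < m + 1, ∀ x ∈ power ℋ k, proj 𝒱 (defect R A F x) = 0) :
    ∃ F' : Sym ℋ →ₗ[K] Sym 𝒱, IsCoalgHom ℋ 𝒱 F' ∧
      (∀ g x, ρ g (proj 𝒱 (F' x)) = proj 𝒱 (F' (map (τ g) (hτ g) x))) ∧
      (∀ v, proj 𝒱 (F' (ι ℋ v)) = i v) ∧
      (∀ k < m + 2, ∀ x ∈ power ℋ k, proj 𝒱 (defect R A F' x) = 0) ∧
      ∀ k < m, ∀ x ∈ power ℋ k, proj 𝒱 (F' x) = proj 𝒱 (F x) := by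
  have hPq : ∀ v, linearPart P (A.q₁ v) = 0 := fun v => by
    rw [hP.linearPart_q₁, hR.q₁_eq_zero]
  -- `π` is a left inverse of `i` that kills coboundaries, so on cocycles it reads off the
  -- cohomology class, even though neither `P` nor `π` need be equivariant.
  let π : V →ₗ[K] H := γ.symm.toLinearMap ∘ₗ linearPart P
  have hπi : ∀ w, π (i w) = w := fun w => by
    change γ.symm (linearPart P (i w)) = w
    rw [hγ, LinearEquiv.symm_apply_apply]
  have hπq : ∀ v, π (A.q₁ v) = 0 := fun v => by
    change γ.symm (linearPart P (A.q₁ v)) = 0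
    rw [hPq, map_zero]
  have hπ : ∀ v, A.q₁ v = 0 → v - i (π v) ∈ LinearMap.range A.q₁ := fun v hv => by
    obtain ⟨w, y, hy⟩ := his v hv
    have : π v = w := by
      have := congrArg π hy
      rwa [hπq, map_sub, hπi, eq_comm, sub_eq_zero] at this
    rw [this]
    exact ⟨y, hy⟩
  let ω : Sym ℋ →ₗ[K] H := π ∘ₗ proj 𝒱 ∘ₗ defect R A F ∘ₗ wproj ℋ (m + 1)
  have hωx : ∀ {x}, x ∈ power ℋ (m + 1) → ω x = π (proj 𝒱 (defect R A F x)) := fun hx => by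
    simp only [ω, LinearMap.comp_apply]
    rw [wproj_of_mem_same hx]
  -- `ω x` is characterized by the leading defect differing from `i (ω x)` by a coboundary. This
  -- description involves only equivariant data, so `ω` is invariant.
  have hω : ∀ g x, τ g (ω x) = ω (map (τ g) (hτ g) x) := by
    intro g x
    have hx := wproj_mem (𝒱 := ℋ) (m + 1) x
    obtain ⟨y, hy⟩ := hπ _ (q₁_proj_defect hR hF hD hx)
    have hyg : ρ g (A.q₁ y) = A.q₁ (ρ g y) := by
      have := hAρ g (ι 𝒱 y)
      rw [map_ι] at this
      exact this
    have h1 := congr(π (ρ g $hy))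
    rw [hyg, hπq, map_sub, map_sub, hiρ, hπi, eq_comm, sub_eq_zero,
      proj_defect_map_comm hF (hτ g) (hρ g) (hAρ g) (hRτ g) (hFρ g), ← wproj_map] at h1
    exact h1.symm
  -- Since `P` is compatible with the codifferentials, the defect of `P ∘ F` is the image under `P`
  -- of that of `F`.
  have hΦ : IsCoalgHom ℋ ℋ (P ∘ₗ F) := hP.isCoalgHom.comp hF
  have hPD : ∀ x, R.Q ((P ∘ₗ F) x) - (P ∘ₗ F) (R.Q x) = P (defect R A F x) := fun x => by
    have := congr($(hP.comp_Q) (F x))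
    simp only [LinearMap.comp_apply] at this ⊢
    rw [defect_apply, map_sub, this]
  obtain ⟨ψ, hψ, hψω⟩ := exists_primitive hR hΦ γ
    (fun v => by
      rw [LinearMap.comp_apply, hF.map_ι, hFi]
      exact hγ v)
    (n := m + 1) (by omega) ω
    (fun k hk x hx => by rw [hPD, defect_eq_zero hF hD k hk x hx, map_zero])
    (fun x hx => by
      rw [hPD, defect_eq_ι hF hD hx, hP.isCoalgHom.map_ι, hωx hx]
      congr 1
      exact (γ.apply_symm_apply _).symm)
  -- This is where `m ≥ 2` matters: the Euler factor would vanish in weight two.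
  have hc : (2 - (m + 1 : ℕ) : K) ≠ 0 := by
    rw [sub_ne_zero]
    exact_mod_cast (by omega : 2 ≠ m + 1)
  obtain ⟨φ, hφd, hφτ, hφm, hφ⟩ := exists_invariant_primitive hR hRτ (hHom m hm) (ω := -ω)
    (fun g x => by rw [LinearMap.neg_apply, map_neg, hω, LinearMap.neg_apply])
    (hψ.smul (-(2 - (m + 1 : ℕ) : K)⁻¹))
    (fun x hx => by
      rw [map_smul, LinearMap.smul_apply, bracketDiff_apply, hψω x hx, smul_smul, neg_mul,
        inv_mul_cancel₀ hc, neg_one_smul, LinearMap.neg_apply])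
  refine exists_extension hR hAρ hRτ hh hhρ hhq hi hiρ hF hFρ hFi (by omega) hD
    (α := i ∘ₗ φ) (hi.comp hφd (add_zero 0))
    (fun g x => by rw [LinearMap.comp_apply, hiρ, hφτ]; rfl)
    (fun k hk x hx => by rw [LinearMap.comp_apply, hφm k hk x hx, map_zero])
    (fun v => by rw [LinearMap.comp_apply, hφm 1 (by omega) _ (ι_mem_power v), map_zero])
    (fun x => hiq _) (fun x hx => ?_)
  have h0 : HasDegree ℋ ℋ 0 (LinearMap.id : H →ₗ[K] H) := fun d v hv => by rwa [add_zero]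
  have hid : ∀ y, map LinearMap.id h0 y = y := fun y => by
    have : map LinearMap.id h0 = AlgHom.id K (Sym ℋ) := algHom_ext _ fun v => by simp
    rw [this]
    rfl
  have hsym : symProd i (i ∘ₗ φ) x = map i hi (symProd LinearMap.id φ x) := by
    rw [map_symProd (i := LinearMap.id) (i' := i) (φ' := i ∘ₗ φ) h0 hi (fun v => rfl)
      (fun y => by rw [hid]; rfl), hid]
  -- Modulo coboundaries, the defect is `i (ω x)` by `e1`, and `A.Q` on products of cocycles from
  -- `i` is `i` of the bracket by `e2`. By `e3` the differential of `φ` is `-ω`, so the total is a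
  -- coboundary.
  have e1 := hπ _ (q₁_proj_defect hR hF hD hx)
  have e2 := hib _ (symProd_mem_power LinearMap.id φ x)
  have e3 := hφ x hx
  rw [LinearMap.neg_apply, hωx hx, bracketDiff_apply] at e3
  have e4 := congrArg i e3
  rw [map_sub, map_smul, map_neg] at e4
  have e5 := add_mem e1 (Submodule.smul_mem _ (2⁻¹ : K) e2)
  rw [hsym, LinearMap.comp_apply]
  convert e5 using 1
  rw [smul_sub, ← sub_eq_zero]
  rw [← sub_eq_zero] at e4
  rw [← e4]
  abel

end LInftyStr

end LInfty

namespace LInfty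

/-! ### Construction of the equivariant morphism. -/

namespace LInftyStr

open LInfty.Sym

variable {K G V H : Type*} [Field K] [CharZero K] [Group G] [AddCommGroup V] [Module K V]
  [AddCommGroup H] [Module K H] {𝒱 : ℤ → Submodule K V} [DirectSum.Decomposition 𝒱]
  {ℋ : ℤ → Submodule K H} [DirectSum.Decomposition ℋ]
  {ρ : Representation K G V} {τ : Representation K G H}
  {hρ : IsGradedRep 𝒱 ρ} {hτ : IsGradedRep ℋ τ} {R : LInftyStr ℋ} {A : LInftyStr 𝒱}

/-- An equivariant embedding of the cohomology extends to an equivariant morphism if the algebra is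
formal and the representations involved are semisimple. -/
theorem exists_equivariant_morphism (hR : R.IsQuadratic)
    (hAρ : ∀ g x, ρ g (proj 𝒱 (A.Q x)) = proj 𝒱 (A.Q (map (ρ g) (hρ g) x)))
    (hRτ : ∀ g x, τ g (proj ℋ (R.Q x)) = proj ℋ (R.Q (map (τ g) (hτ g) x)))
    (hHom : ∀ n, 2 ≤ n → (homRep τ hτ 0 n).toRepresentation.IsSemisimpleRepresentation)
    {h : V →ₗ[K] V} (hh : HasDegree 𝒱 𝒱 (-1) h) (hhρ : ∀ g v, ρ g (h v) = h (ρ g v))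
    (hhq : ∀ v, A.q₁ (h (A.q₁ v)) = A.q₁ v)
    {i : H →ₗ[K] V} (hi : HasDegree ℋ 𝒱 0 i) (hiρ : ∀ g v, ρ g (i v) = i (τ g v))
    (hiq : ∀ v, A.q₁ (i v) = 0)
    (his : ∀ v, A.q₁ v = 0 → ∃ w, v - i w ∈ LinearMap.range A.q₁)
    (hib : ∀ x ∈ power ℋ 2, proj 𝒱 (A.Q (map i hi x)) - i (proj ℋ (R.Q x)) ∈
      LinearMap.range A.q₁)
    {P : Sym 𝒱 →ₗ[K] Sym ℋ} (hP : IsMorphism A R P) (γ : H ≃ₗ[K] H)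
    (hγ : ∀ v, linearPart P (i v) = γ v) :
    ∃ F : Sym ℋ →ₗ[K] Sym 𝒱, IsMorphism R A F ∧
      (∀ g x, ρ g (proj 𝒱 (F x)) = proj 𝒱 (F (map (τ g) (hτ g) x))) ∧
      ∀ v, proj 𝒱 (F (ι ℋ v)) = i v := by
  -- Stage `s` has no defect in weights up to `s + 2`; stage zero already accounts for the bracket,
  -- which the Euler argument cannot reach.
  let S : ℕ → Type _ := fun s => {F : Sym ℋ →ₗ[K] Sym 𝒱 // IsCoalgHom ℋ 𝒱 F ∧
    (∀ g x, ρ g (proj 𝒱 (F x)) = proj 𝒱 (F (map (τ g) (hτ g) x))) ∧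
    (∀ v, proj 𝒱 (F (ι ℋ v)) = i v) ∧
    ∀ k < s + 3, ∀ x ∈ power ℋ k, proj 𝒱 (defect R A F x) = 0}
  have hmap : ∀ x, proj 𝒱 (defect R A (map i hi).toLinearMap x) =
      proj 𝒱 (A.Q (map i hi x)) - i (proj ℋ (R.Q x)) := fun x => by
    rw [defect_apply, map_sub, AlgHom.toLinearMap_apply, AlgHom.toLinearMap_apply, proj_map]
  have hmapρ : ∀ g x, ρ g (proj 𝒱 ((map i hi).toLinearMap x)) =
      proj 𝒱 ((map i hi).toLinearMap (map (τ g) (hτ g) x)) := fun g x => by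
    rw [AlgHom.toLinearMap_apply, AlgHom.toLinearMap_apply, proj_map, proj_map, proj_map, hiρ]
  -- The morphism induced by `i` alone works in weights at most one, since `q₁` vanishes on the
  -- image of `i`. Its defect in weight two is a coboundary because the bracket on `H` is induced by
  -- `q₂`, so `exists_extension` applies with `α = 0` and `m = 1`.
  have hS0 : Nonempty (S 0) := by
    have hD : ∀ k < 1 + 1, ∀ x ∈ power ℋ k,
        proj 𝒱 (defect R A (map i hi).toLinearMap x) = 0 := fun k hk x hx => by
      rw [hmap, hR k (by omega) x hx, map_zero, sub_zero]
      match k with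
      | 0 =>
        obtain ⟨c, rfl⟩ := mem_power_zero hx
        rw [map_smul, map_one, map_smul, A.Q_one, smul_zero, map_zero]
      | 1 =>
        obtain ⟨v, rfl⟩ := mem_power_one hx
        rw [map_ι, A.Q_ι, hiq, map_zero, map_zero]
    have hex : ∀ x ∈ power ℋ (1 + 1), proj 𝒱 (defect R A (map i hi).toLinearMap x) +
        (2⁻¹ : K) • proj 𝒱 (A.Q (symProd i 0 x)) - (0 : Sym ℋ →ₗ[K] V) (R.Q x) ∈
          LinearMap.range A.q₁ := fun x hx => by
      have h0 : symProd (𝒱 := 𝒱) i (0 : Sym ℋ →ₗ[K] V) x = 0 := by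
        have := symProd_smul (𝒱 := 𝒱) i (0 : K) (0 : Sym ℋ →ₗ[K] V) x
        rwa [zero_smul, zero_smul] at this
      rw [hmap, h0, map_zero, map_zero, smul_zero, add_zero, LinearMap.zero_apply, sub_zero]
      exact hib x hx
    obtain ⟨F, h1, h2, h3, h4, -⟩ := exists_extension hR hAρ hRτ hh hhρ hhq hi hiρ
      (isCoalgHom_map i hi) hmapρ
      (fun v => by rw [AlgHom.toLinearMap_apply, map_ι, proj_ι]) one_ne_zero hD
      (fun _ _ _ => zero_mem _) (fun g x => by simp) (fun _ _ _ _ => rfl) (fun _ => rfl)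
      (fun _ => map_zero _) hex
    exact ⟨F, h1, h2, h3, h4⟩
  have hstep : ∀ s (F : S s), ∃ F' : S (s + 1), ∀ k < s + 2, ∀ x ∈ power ℋ k,
      proj 𝒱 (F'.1 x) = proj 𝒱 (F.1 x) := by
    rintro s ⟨F, h1, h2, h3, h4⟩
    obtain ⟨F', h1', h2', h3', h4', h5'⟩ := exists_next hR hAρ hRτ hHom hh hhρ hhq hi hiρ hiq his
      hib hP γ hγ h1 h2 h3 (m := s + 2) (by omega) h4
    exact ⟨⟨F', h1', h2', h3', h4'⟩, h5'⟩
  choose next hnext using hstep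
  let F : ∀ s, S s := fun s => Nat.rec hS0.some next s
  exact exists_limit hR (fun s => (F s).1) (fun s => (F s).2.1) (fun s => (F s).2.2.1)
    (fun s => (F s).2.2.2.1) (fun s k hk => (F s).2.2.2.2 k (by omega))
    fun s k hk => hnext s (F s) k (by omega)

/-! ### The equivariant cocycle section and the induced bracket. -/

section Cohomology

/-- Equivariance constrains only coefficients of order at least one, evaluated on products. Products
span each symmetric power, and the hypothesis on `F 1` settles order zero. -/
theorem proj_comm_of_isEquivariant {F : Sym 𝒱 →ₗ[K] Sym ℋ} (hF : LInfty.IsEquivariant ρ τ F)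
    (h1 : proj ℋ (F 1) = 0) (g : G) (x : Sym 𝒱) :
    τ g (proj ℋ (F x)) = proj ℋ (F (map (ρ g) (hρ g) x)) := by
  have h : τ g ∘ₗ proj ℋ ∘ₗ F = proj ℋ ∘ₗ F ∘ₗ (map (ρ g) (hρ g)).toLinearMap :=
    hom_ext_power fun n x hx => by
      cases n with
      | zero =>
        obtain ⟨c, rfl⟩ := mem_power_zero hx
        simp [h1]
      | succ n =>
        refine power_le_of_prod_mem (n + 1) (P := LinearMap.eqLocus (τ g ∘ₗ proj ℋ ∘ₗ F)
          (proj ℋ ∘ₗ F ∘ₗ (map (ρ g) (hρ g)).toLinearMap)) (fun v => ?_) hx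
        rw [LinearMap.mem_eqLocus]
        simp only [LinearMap.comp_apply, AlgHom.toLinearMap_apply]
        rw [Sym.map_prod]
        exact hF g (n + 1) (by omega) v
  exact congr($h x)

theorem q₁_comm (hA : A.IsEquivariant ρ) (g : G) (v : V) : ρ g (A.q₁ v) = A.q₁ (ρ g v) := by
  simpa only [taylor_one] using! hA g 1 le_rfl fun _ => v

/-- The embedding of the cohomology given by a generalized inverse of the differential. -/
def cocycleSection (A : LInftyStr 𝒱) (h : V →ₗ[K] V) (hhq : ∀ v, A.q₁ (h (A.q₁ v)) = A.q₁ v) :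
    A.H →ₗ[K] V :=
  Submodule.liftQ _ ((LinearMap.id - A.q₁ ∘ₗ h) ∘ₗ (LinearMap.ker A.q₁).subtype) (by
    rintro x ⟨y, hy⟩
    have hy' : A.q₁ y = x := hy
    rw [LinearMap.mem_ker]
    simp only [LinearMap.comp_apply, LinearMap.sub_apply, LinearMap.id_apply,
      Submodule.subtype_apply]
    rw [← hy', hhq, sub_self])

variable {h : V →ₗ[K] V} (hhq : ∀ v, A.q₁ (h (A.q₁ v)) = A.q₁ v)

theorem section_mk (z : LinearMap.ker A.q₁) :
    A.cocycleSection h hhq (Cohomology.mk A.q₁ z) = z - A.q₁ (h z) := rfl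

theorem q₁_q₁ (A : LInftyStr 𝒱) (v : V) : A.q₁ (A.q₁ v) = 0 := by
  have h := congr(proj 𝒱 ($(A.Q_comp_Q) (ι 𝒱 v)))
  rwa [LinearMap.comp_apply, A.Q_ι, A.Q_ι, proj_ι, LinearMap.zero_apply, map_zero] at h

theorem q₁_section (w : A.H) : A.q₁ (A.cocycleSection h hhq w) = 0 := by
  obtain ⟨z, rfl⟩ := Submodule.mkQ_surjective _ w
  have hz : A.q₁ z = 0 := z.2
  rw [section_mk, map_sub, hz, q₁_q₁, sub_zero]

theorem mk_section (w : A.H) :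
    Cohomology.mk A.q₁ ⟨A.cocycleSection h hhq w, q₁_section hhq w⟩ = w := by
  obtain ⟨z, rfl⟩ := Submodule.mkQ_surjective _ w
  rw [← sub_eq_zero, ← map_sub, Submodule.mkQ_apply, Submodule.Quotient.mk_eq_zero]
  refine ⟨-h z, ?_⟩
  change A.q₁ (-h z) = A.cocycleSection h hhq (Cohomology.mk A.q₁ z) - z
  rw [section_mk, map_neg]
  abel

theorem section_hasDegree (hh : HasDegree 𝒱 𝒱 (-1) h) :
    HasDegree A.gradingH 𝒱 0 (A.cocycleSection h hhq) := by
  rintro d _ ⟨z, hz, rfl⟩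
  have hz' : (z : V) ∈ 𝒱 d := hz
  rw [section_mk, add_zero]
  refine sub_mem hz' ?_
  have := A.q₁_hasDegree _ _ (hh d z hz')
  rwa [neg_add_cancel_right] at this

theorem section_comm (hA : A.IsEquivariant ρ) (hhρ : ∀ g v, ρ g (h v) = h (ρ g v)) (g : G)
    (w : A.H) : ρ g (A.cocycleSection h hhq w) = A.cocycleSection h hhq (A.repH hA g w) := by
  obtain ⟨z, rfl⟩ := Submodule.mkQ_surjective _ w
  have hz : A.q₁ (ρ g z) = 0 := by
    rw [← q₁_comm hA, LinearMap.mem_ker.mp z.2, map_zero]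
  have : A.repH hA g (Cohomology.mk A.q₁ z) = Cohomology.mk A.q₁ ⟨ρ g z, hz⟩ := rfl
  rw [this, section_mk, section_mk, map_sub, q₁_comm hA, hhρ]

theorem sub_section_mk_mem_range (z : LinearMap.ker A.q₁) :
    (z : V) - A.cocycleSection h hhq (Cohomology.mk A.q₁ z) ∈ LinearMap.range A.q₁ :=
  ⟨h z, by rw [section_mk, sub_sub_cancel]⟩

theorem section_bracket (hh : HasDegree 𝒱 𝒱 (-1) h) {R : LInftyStr A.gradingH}
    (hR : A.IsInducedBracket R) {x : Sym A.gradingH} (hx : x ∈ power A.gradingH 2) :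
    proj 𝒱 (A.Q (map (A.cocycleSection h hhq) (section_hasDegree hhq hh) x)) -
      A.cocycleSection h hhq (proj A.gradingH (R.Q x)) ∈ LinearMap.range A.q₁ := by
  refine power_le_of_prod_mem 2 (P := (LinearMap.range A.q₁).comap
    (proj 𝒱 ∘ₗ A.Q ∘ₗ (map (A.cocycleSection h hhq) (section_hasDegree hhq hh)).toLinearMap -
      A.cocycleSection h hhq ∘ₗ proj A.gradingH ∘ₗ R.Q)) (fun v => ?_) hx
  rw [Submodule.mem_comap]
  simp only [LinearMap.sub_apply, LinearMap.comp_apply, AlgHom.toLinearMap_apply]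
  rw [Sym.map_prod]
  obtain ⟨hc, h2⟩ := hR.two ⟨_, q₁_section hhq (v 0)⟩ ⟨_, q₁_section hhq (v 1)⟩
  rw [mk_section, mk_section, show ![v 0, v 1] = v by ext k; fin_cases k <;> rfl] at h2
  have h3 : proj A.gradingH (R.Q (prod A.gradingH 2 v)) = _ := h2
  rw [h3]
  have h4 := sub_section_mk_mem_range hhq ⟨_, hc⟩
  have h5 : (fun k => A.cocycleSection h hhq (v k)) =
      ![A.cocycleSection h hhq (v 0), A.cocycleSection h hhq (v 1)] := by
    ext k; fin_cases k <;> rfl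
  rw [h5]
  exact h4

theorem eq_zero_of_section_mem_range {w : A.H}
    (hw : A.cocycleSection h hhq w ∈ LinearMap.range A.q₁) : w = 0 := by
  rw [← mk_section hhq w]
  exact (Submodule.Quotient.mk_eq_zero _).mpr hw

/-- Acting by `g` on the relation of `section_bracket` at `x` and comparing with the one at `g x`
shows that the section of the difference is a coboundary; the section detects classes. -/
theorem bracket_comm (hhq : ∀ v, A.q₁ (h (A.q₁ v)) = A.q₁ v) (hρ : IsGradedRep 𝒱 ρ)
    (hA : A.IsEquivariant ρ) (hh : HasDegree 𝒱 𝒱 (-1) h)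
    (hhρ : ∀ g v, ρ g (h v) = h (ρ g v)) {R : LInftyStr A.gradingH} (hR : A.IsInducedBracket R)
    (g : G) (x : Sym A.gradingH) : A.repH hA g (proj A.gradingH (R.Q x)) =
      proj A.gradingH (R.Q (map (A.repH hA g) (A.repH_isGradedRep hA hρ g) x)) := by
  have hRq := isQuadratic_of_q_eq_zero hR.ne_two
  let T := map (A.repH hA g) (A.repH_isGradedRep hA hρ g)
  let I := map (A.cocycleSection h hhq) (section_hasDegree hhq hh)
  have hTI : ∀ x, map (ρ g) (hρ g) (I x) = I (T x) := fun x => by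
    have : (map (ρ g) (hρ g)).comp I = I.comp T := algHom_ext _ fun v => by
      simp [I, T, section_comm hhq hA hhρ]
    exact congr($this x)
  have key : A.repH hA g ∘ₗ proj A.gradingH ∘ₗ R.Q = proj A.gradingH ∘ₗ R.Q ∘ₗ T.toLinearMap :=
    hom_ext_power fun n x hx => by
      simp only [LinearMap.comp_apply, AlgHom.toLinearMap_apply]
      have hTx : T x ∈ power A.gradingH n := map_mem_power _ _ n hx
      rcases eq_or_ne n 2 with rfl | hn
      · refine (sub_eq_zero.mp (eq_zero_of_section_mem_range hhq ?_)).symm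
        obtain ⟨y, hy⟩ := section_bracket hhq hh hR hx
        obtain ⟨z, hz⟩ := section_bracket hhq hh hR hTx
        refine ⟨ρ g y - z, ?_⟩
        rw [map_sub, ← q₁_comm hA, hy, hz, map_sub, proj_comm_of_isEquivariant (hρ := hρ) hA
          A.proj_Q_one, hTI, section_comm hhq hA hhρ, map_sub]
        abel
      · rw [hRq n hn x hx, hRq n hn _ hTx, map_zero]
  exact congr($key x)

/-- The differential on the cohomology is zero, so that space is its own cohomology. Under this
identification the composite is the map that `P` induces in cohomology, since the section picks
representatives. -/
theorem bijective_linearPart_section {R : LInftyStr A.gradingH} (hR : R.IsQuadratic)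
    {P : Sym 𝒱 →ₗ[K] Sym A.gradingH} (hP : IsQuasiIso A.q₁ R.q₁ (linearPart P)) :
    Function.Bijective (linearPart P ∘ₗ A.cocycleSection h hhq) := by
  obtain ⟨e, hinj, hsurj⟩ := hP
  have hmk : ∀ w, Cohomology.map (linearPart P) e w =
      Cohomology.mk R.q₁ ⟨linearPart P (A.cocycleSection h hhq w), hR.q₁_eq_zero _⟩ := fun w => by
    conv_lhs => rw [← mk_section hhq w]
    rfl
  constructor
  · rw [injective_iff_map_eq_zero]
    intro w hw
    refine hinj ?_
    rw [map_zero, hmk]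
    exact (Submodule.Quotient.mk_eq_zero _).mpr ⟨0, by rw [map_zero]; exact hw.symm⟩
  · intro u
    obtain ⟨w, hw⟩ := hsurj (Cohomology.mk R.q₁ ⟨u, hR.q₁_eq_zero u⟩)
    rw [hmk] at hw
    obtain ⟨y, hy⟩ := (Submodule.Quotient.eq _).mp hw
    rw [hR.q₁_eq_zero] at hy
    exact ⟨w, sub_eq_zero.mp hy.symm⟩

theorem isQuasiIso_section {R : LInftyStr A.gradingH} (hR : R.IsQuadratic) :
    IsQuasiIso R.q₁ A.q₁ (A.cocycleSection h hhq) := by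
  have e : A.cocycleSection h hhq ∘ₗ R.q₁ = A.q₁ ∘ₗ A.cocycleSection h hhq :=
    LinearMap.ext fun v => by
      rw [LinearMap.comp_apply, LinearMap.comp_apply, hR.q₁_eq_zero, map_zero, q₁_section]
  have hmk : ∀ z, Cohomology.map _ e (Cohomology.mk R.q₁ z) = z := fun z => mk_section hhq z.1
  refine ⟨e, ?_, fun w => ⟨Cohomology.mk R.q₁ ⟨w, hR.q₁_eq_zero w⟩, hmk _⟩⟩
  rw [injective_iff_map_eq_zero]
  intro w hw
  obtain ⟨z, rfl⟩ := Submodule.mkQ_surjective _ w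
  have h0 := hmk z
  rw [hw] at h0
  rw [show z = 0 from Subtype.ext h0.symm, map_zero]

end Cohomology

/-- A formal `L∞[1]` algebra with an action of `G` is equivariantly formal if its graded pieces and
the spaces of Taylor coefficients of degree `0` on its cohomology are semisimple. -/
theorem IsFormal.isEquivariantlyFormal (hρ : IsGradedRep 𝒱 ρ) (hA : A.IsEquivariant ρ)
    (hV : ∀ i : ℤ, (gradedPiece ρ hρ i).toRepresentation.IsSemisimpleRepresentation)
    (hHom : ∀ n : ℕ, 2 ≤ n → (homRep (A.repH hA) (A.repH_isGradedRep hA hρ) 0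
      n).toRepresentation.IsSemisimpleRepresentation)
    (hformal : A.IsFormal) : A.IsEquivariantlyFormal hA := by
  obtain ⟨R, hRA, P, hP⟩ := hformal
  have hR := isQuadratic_of_q_eq_zero hRA.ne_two
  obtain ⟨h, hh, hhρ, hhq⟩ := exists_homotopy ρ hρ hV A.q₁ A.q₁_hasDegree (q₁_comm hA)
  let γ := LinearEquiv.ofBijective _ (bijective_linearPart_section hhq hR hP.isQuasiIso)
  obtain ⟨F, hF, hFρ, hFi⟩ := exists_equivariant_morphism hR
    (proj_comm_of_isEquivariant (hρ := hρ) hA A.proj_Q_one) (bracket_comm hhq hρ hA hh hhρ hRA) hHom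
    hh hhρ hhq (section_hasDegree hhq hh) (section_comm hhq hA hhρ) (q₁_section hhq)
    (fun v hv => ⟨_, sub_section_mk_mem_range hhq ⟨v, hv⟩⟩)
    (fun x hx => section_bracket hhq hh hRA hx) hP.isMorphism γ (fun v => rfl)
  refine ⟨R, hRA, F, ⟨hF, ?_⟩, fun g n _ v => ?_⟩
  · rw [show linearPart F = A.cocycleSection h hhq from LinearMap.ext hFi]
    exact isQuasiIso_section hhq hR
  · have := hFρ g (prod A.gradingH n v)
    rw [Sym.map_prod] at this
    exact this

end LInftyStr

end LInfty

theorem mainTheorem6 {K G V : Type*} [Field K] [CharZero K] [Group G] [AddCommGroup V] [Module K V]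
    (𝒱 : ℤ → Submodule K V) [DirectSum.Decomposition 𝒱]
    (ρ : Representation K G V) (hρ : LInfty.IsGradedRep 𝒱 ρ)
    (A : LInfty.LInftyStr 𝒱) (hA : A.IsEquivariant ρ)
    (hV : ∀ i : ℤ, (LInfty.gradedPiece ρ hρ i).toRepresentation.IsSemisimpleRepresentation)
    (hHom : ∀ j : ℤ, j = 0 ∨ j = 1 → ∀ n : ℕ, 2 ≤ n →
      (LInfty.homRep (A.repH hA) (A.repH_isGradedRep hA hρ) j
        n).toRepresentation.IsSemisimpleRepresentation)
    (hformal : A.IsFormal) :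
    A.IsEquivariantlyFormal hA :=
  hformal.isEquivariantlyFormal hρ hA hV (hHom 0 (Or.inl rfl))

end
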